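/- **The routing model.** Let $n,d,C$ be positive integers and $\lambda>0$. Let $V_n=\{1,\dots,n\}$ and let $L_n$ be the set of links $\{u,v\}$, $u\ne v$, of the complete graph $K_n$. A *load vector* $x$ gives for each $e\in L_n$ the number $x(e,0)\ge 0$ of calls in progress routed along the link $e$, and for each $e=\{u,v\}\in L_n$ and $w\notin e$ the number $x(e,w)\ge0$ of calls with endpoints $u,v$ routed along $\{u,w\},\{v,w\}$. The load of a link is $$x(\{u,v\}) = x(\{u,v\},0)+\sum_{w\notin\{u,v\}}\bigl(x(\{u,w\},v)+x(\{v,w\},u)\bigr),$$ and the state space consists of the load vectors in which every link has load at most $C$. Let $\|x\|_1$ be the total number of calls in $x$. The process $X=(X_t)_{t\ge0}$ is the right-continuous continuous-time Markov chain on the state space with the following transitions. Calls arrive at rate $\lambda$ for each pair $\{u,v\}\in L_n$. If the link $\{u,v\}$ has load less than $C$, the call is routed along it. Otherwise $(w_1,\dots,w_d)\in (V_n\setminus\{u,v\})^d$ is chosen uniformly at random, and the call is routed via the first $w_i$ that minimises $\max(x(\{u,w_i\}),x(\{v,w_i\}))$, provided that this maximum is less than $C$; if it is not, the call is lost. Each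 call in progress ends at rate $1$. For $v\in V_n$ let $f_{v,k}(x)$ be the number of links $\{v,w\}$, $w\neq v$, with $x(\{v,w\})=k$. Let $\mathbb I_{uv}^j(x)=1$ if $u\ne v$ and $x(\{u,v\})=j$, and $0$ otherwise. Let $\phi=\max\{\phi^1,\phi^2,\phi^3\}$, where $$\phi^1(x)=\max_{u\ne v}\max_{0\le j,k\le C}\Bigl|\tfrac1{n-2}\sum_w \mathbb I_{uw}^j(x)\mathbb I_{vw}^k(x)-\tfrac1{(n-2)^2}\sum_{w\ne u,v}\mathbb I_{uw}^j(x)\sum_{w'\ne u,v}\mathbb I_{vw'}^k(x)\Bigr|,$$ $$\phi^2(x)=\max_{u\neq v}\max_{0\le j\le C}\tfrac1{n-2}|f_{u,j}(x)-f_{v,j}(x)|,\qquad \phi^3(x)=\max_{u\ne v}\tfrac1{n-2}\sum_{w\ne u,v}x(\{u,v\},w).$$ **The differential equation.** For $\xi=(\xi(0),\dots,\xi(C))\in\mathbb R^{C+1}$ write $\xi(\le j)=\sum_{k=0}^j\xi(k)$ and, for $0\le j\le C-1$, let $$g_j(\xi)=2\xi(C)\xi(j)\xi(\le j)\sum_{r=1}^d(1-\xi(\le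 j)^2)^{r-1}(1-\xi(\le j-1)^2)^{d-r}+2\xi(C)\xi(j)\sum_{i=j+1}^{C-1}\xi(i)\sum_{r=1}^d(1-\xi(\le i)^2)^{r-1}(1-\xi(\le i-1)^2)^{d-r}.$$ Define $F:\mathbb R^{C+1}\to\mathbb R^{C+1}$ by $$F_0(\xi)=-\lambda\xi(0)-\lambda g_0(\xi)+\xi(1),\qquad F_C(\xi)=\lambda\xi(C-1)+\lambda g_{C-1}(\xi)-C\xi(C),$$ $$F_k(\xi)=\lambda\xi(k-1)-\lambda\xi(k)+\lambda g_{k-1}(\xi)-\lambda g_k(\xi)-k\xi(k)+(k+1)\xi(k+1)\qquad(0<k<C).$$ **Theorem.** Let $\lambda,t_0$ be positive reals and $d,C$ positive integers. Set $$\gamma=\frac1{2^{25}(d^8+d^4C/\lambda)(8\lambda t_0+1)^3e^{800d\lambda t_0}},$$ and let $n$ satisfy $$n\ge \max\Bigl(2^{18}(\lambda+1/\lambda)^4d^4(C+1)^6(t_0+1/t_0)^2,\;e^{8/\gamma}\Bigr).$$ Let $\xi_0\in\mathbb R^{C+1}$ have non-negative coordinates with $\sum_{k=0}^C\xi_0(k)=1$.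 Then the equation $d\xi_t/dt=F(\xi_t)$ has a unique solution $(\xi_t)$ on $[0,t_0]$ with initial value $\xi_0$. Suppose that (almost surely) $\|X_0\|_1\le2\lambda\binom n2$; the initial state may be deterministic or random. Let $B_n$ be the event that, for all $v\in V_n$, $k\in\{0,\dots,C\}$ and $t\in[0,t_0]$, $$|f_{v,k}(X_t)-(n-1)\xi_t(k)|\le\Bigl(\sup_{u,j}\bigl|f_{u,j}(X_0)-(n-1)\xi_0(j)\bigr|+64(\lambda+1)(t_0+1)d^2(C+1)^3\bigl(n\phi(X_0)+3n^{1/2}\log n\bigr)\Bigr)e^{216(\lambda+1)d^2(C+1)^3t_0},$$ where the supremum is over $u\in V_n$ and $0\le j\le C$. Then $\mathbb P(\overline{B_n})\le e^{-\frac12\gamma\log^2n}$. In particular, suppose moreover that (almost surely) there is $v_0\in V_n$ with $\xi_0(j)=\frac1{n-1}f_{v_0,j}(X_0)$ for $j=0,\dots,C$. Let $B_n'$ be the event that, for all $v\in V_n$, $k\in\{0,\dots,C\}$ and $t\in[0,t_0]$, $$|f_{v,k}(X_t)-(n-1)\xi_t(k)|\le64(\lambda+1)(t_0+1)d^2(C+1)^3\bigl(2n\phi(X_0)+3n^{1/2}\log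 n\bigr)e^{216(\lambda+1)d^2(C+1)^3t_0}.$$ Then $\mathbb P(\overline{B_n'})\le e^{-\frac12\gamma\log^2n}$. -/

import Mathlib

open scoped NNReal Topology
open MeasureTheory

noncomputable section

namespace BDAR

/-! ### Routes and load vectors -/

/-- The links of the complete graph on the nodes `Fin n`: unordered pairs of distinct nodes. -/
abbrev Link (n : ℕ) : Type := {e : Sym2 (Fin n) // ¬ e.IsDiag}

/-- A possible intermediate node for a call with endpoints `e`. -/
abbrev Mid {n : ℕ} (e : Link n) : Type := {w : Fin n // w ∉ e.1}

/-- The routes: `⟨e, none⟩` is the direct route along the link `e`, and `⟨e, some w⟩` is the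
two-link path joining the ends of `e` through the intermediate node `w`. -/
abbrev Route (n : ℕ) : Type := (e : Link n) × Option (Mid e)

/-- The links occupied by a call on a given route: `{e}` for a direct route, and
`{u, w}, {v, w}` for the path through `w` between the ends `u, v` of `e`. -/
def Route.links {n : ℕ} : Route n → Finset (Sym2 (Fin n))
  | ⟨e, none⟩ => {e.1}
  | ⟨e, some w⟩ => (Finset.univ.filter (fun u => u ∈ e.1)).image (fun u => s(u, w.1))

/-- The load of a link: the number of calls in progress that use it. -/
def load {n : ℕ} (x : Route n → ℕ) (e : Sym2 (Fin n)) : ℕ :=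
  ∑ r : Route n, if e ∈ r.links then x r else 0

/-- The load vectors (numbers of calls in progress on each route) that respect the capacity `C`
of every link. -/
def State (n C : ℕ) : Type := {x : Route n → ℕ // ∀ e : Link n, load x e.1 ≤ C}

instance (n C : ℕ) : DecidableEq (State n C) :=
  inferInstanceAs (DecidableEq {x : Route n → ℕ // ∀ e : Link n, load x e.1 ≤ C})

theorem exists_link {n : ℕ} (r : Route n) : ∃ e : Link n, e.1 ∈ r.links := by
  obtain ⟨e, _ | w⟩ := r
  · exact ⟨e, by simp [Route.links]⟩
  · obtain ⟨u, hu⟩ : ∃ u, u ∈ e.1 := ⟨e.1.out.1, e.1.out_fst_mem⟩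
    refine ⟨⟨s(u, w.1), ?_⟩, ?_⟩
    · rw [Sym2.mk_isDiag_iff]
      rintro rfl
      exact w.2 hu
    · simp only [Route.links, Finset.mem_image, Finset.mem_filter, Finset.mem_univ, true_and]
      exact ⟨u, hu, rfl⟩

theorem State.le_capacity {n C : ℕ} (x : State n C) (r : Route n) : x.1 r ≤ C := by
  obtain ⟨e, he⟩ := exists_link r
  refine le_trans ?_ (x.2 e)
  have h := Finset.single_le_sum
    (f := fun r : Route n => if e.1 ∈ r.links then x.1 r else 0)
    (fun _ _ => Nat.zero_le _) (Finset.mem_univ r)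
  simpa [he, load] using h

instance (n C : ℕ) : Finite (State n C) :=
  Finite.of_injective
    (fun (x : State n C) (r : Route n) =>
      (⟨x.1 r, Nat.lt_succ_of_le (x.le_capacity r)⟩ : Fin (C + 1)))
    (fun _ _ h => Subtype.ext (funext fun r => congrArg Fin.val (congrFun h r)))

instance (n C : ℕ) : Fintype (State n C) := Fintype.ofFinite _

/-- The total number of calls in progress, i.e. the `ℓ¹`-norm of the load vector. -/
def calls {n C : ℕ} (x : State n C) : ℕ := ∑ r : Route n, x.1 r

/-! ### The dynamics -/

/-- The larger of the current loads on the two links of the path between the ends of `e`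
through `w`. -/
def pathLoad {n C : ℕ} (x : State n C) (e : Link n) (w : Mid e) : ℕ :=
  (Route.links ⟨e, some w⟩).sup (load x.1)

/-- `Accepts x e w r`: in state `x`, an arriving call with endpoints `e` and list `w` of possible
intermediate nodes is accepted on the route `r`. It takes the direct route if that has spare
capacity. Otherwise it takes the path through the first `w i` that minimises the larger of the
two link loads, provided that this path has spare capacity. (If neither is possible the call is
lost, and no `r` qualifies.) -/
def Accepts {n C d : ℕ} (x : State n C) (e : Link n) (w : Fin d → Mid e) (r : Route n) : Prop :=
  (load x.1 e.1 < C ∧ r = ⟨e, none⟩) ∨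
  (¬ load x.1 e.1 < C ∧ ∃ i : Fin d,
    pathLoad x e (w i) < C ∧
    (∀ s, pathLoad x e (w i) ≤ pathLoad x e (w s)) ∧
    (∀ s, s < i → pathLoad x e (w i) < pathLoad x e (w s)) ∧
    r = ⟨e, some (w i)⟩)

open Classical in
/-- The rate of jumps from `x` to `y`. Calls arrive at rate `λ` for every pair of endpoints, with
a uniformly random list in `(V ∖ {u, v}) ^ d` of possible intermediate nodes, and
every call in progress ends at rate `1`. -/
def rate {n C : ℕ} (lam : ℝ) (d : ℕ) (x y : State n C) : ℝ :=
  (∑ e : Link n, lam * (((n : ℝ) - 2) ^ d)⁻¹ *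
    ∑ w : Fin d → Mid e, ∑ r : Route n,
      if Accepts x e w r ∧ y.1 = x.1 + Pi.single r 1 then (1 : ℝ) else 0)
  + ∑ r : Route n, if x.1 = y.1 + Pi.single r 1 then (x.1 r : ℝ) else 0

/-- The generator matrix of the routing process. -/
def generator (n C : ℕ) (lam : ℝ) (d : ℕ) : Matrix (State n C) (State n C) ℝ :=
  fun x y => if x = y then - ∑ z ∈ Finset.univ.erase x, rate lam d x z else rate lam d x y

/-- The transition matrices `P_t = exp (t Q)`. -/
def transition (n C : ℕ) (lam : ℝ) (d : ℕ) (t : ℝ) : Matrix (State n C) (State n C) ℝ :=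
  NormedSpace.exp (t • generator n C lam d)

/-- `X` is a (right-continuous) continuous-time Markov chain on the load vectors, with the
generator of the BDAR routing model and arbitrary initial law. -/
structure IsProcess {Ω : Type*} [MeasurableSpace Ω] (μ : Measure Ω) {n C : ℕ} (lam : ℝ) (d : ℕ)
    (X : ℝ≥0 → Ω → State n C) : Prop where
  measurable : ∀ t x, MeasurableSet {ω | X t ω = x}
  rightContinuous : ∀ᵐ ω ∂μ, ∀ t : ℝ≥0, ∀ᶠ s in 𝓝[>] t, X s ω = X t ω
  markov : ∀ (m : ℕ) (t : Fin (m + 1) → ℝ≥0) (x : Fin (m + 1) → State n C),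
    t 0 = 0 → Monotone t →
    μ.real {ω | ∀ i, X (t i) ω = x i} =
      μ.real {ω | X 0 ω = x 0} *
        ∏ i : Fin m, transition n C lam d ((t i.succ : ℝ) - t i.castSucc) (x i.castSucc) (x i.succ)

/-! ### Observables -/

/-- `f_{v,k}(x)`: the number of links at the node `v` that carry exactly `k` calls. -/
def count {n C : ℕ} (v : Fin n) (k : ℕ) (x : State n C) : ℕ :=
  (Finset.univ.filter (fun w : Fin n => w ≠ v ∧ load x.1 s(v, w) = k)).card

/-- The indicator that `{u, v}` is a link of load `j` (so it vanishes for `u = v`). -/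
def ind {n C : ℕ} (j : ℕ) (u v : Fin n) (x : State n C) : ℝ :=
  if u ≠ v ∧ load x.1 s(u, v) = j then 1 else 0

/-- Ordered pairs of distinct nodes. -/
abbrev Pair (n : ℕ) : Type := {p : Fin n × Fin n // p.1 ≠ p.2}

def phi1 {n C : ℕ} (x : State n C) : ℝ :=
  ⨆ p : Pair n, ⨆ jk : Fin (C + 1) × Fin (C + 1),
    |1 / ((n : ℝ) - 2) * ∑ w : Fin n, ind jk.1 p.1.1 w x * ind jk.2 p.1.2 w x
      - 1 / ((n : ℝ) - 2) ^ 2 *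
        ((∑ w ∈ Finset.univ.filter (fun w => w ≠ p.1.1 ∧ w ≠ p.1.2), ind jk.1 p.1.1 w x) *
          ∑ w ∈ Finset.univ.filter (fun w => w ≠ p.1.1 ∧ w ≠ p.1.2), ind jk.2 p.1.2 w x)|

def phi2 {n C : ℕ} (x : State n C) : ℝ :=
  ⨆ p : Pair n, ⨆ j : Fin (C + 1),
    1 / ((n : ℝ) - 2) * |(count p.1.1 j x : ℝ) - count p.1.2 j x|

def phi3 {n C : ℕ} (x : State n C) : ℝ :=
  ⨆ e : Link n, 1 / ((n : ℝ) - 2) * ∑ w : Mid e, (x.1 ⟨e, some w⟩ : ℝ)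

def phi {n C : ℕ} (x : State n C) : ℝ := max (phi1 x) (max (phi2 x) (phi3 x))

/-! ### The differential equation -/

/-- `ξ(k)`, for `k = 0, …, C` (and `0` for `k > C`, which is never used). -/
def coord {C : ℕ} (ξ : Fin (C + 1) → ℝ) (k : ℕ) : ℝ :=
  if h : k < C + 1 then ξ ⟨k, h⟩ else 0

/-- `cum ξ m = ∑_{k < m} ξ(k)`, so that `ξ(≤ j) = cum ξ (j + 1)` and `ξ(≤ j - 1) = cum ξ j`. -/
def cum {C : ℕ} (ξ : Fin (C + 1) → ℝ) (m : ℕ) : ℝ := ∑ k ∈ Finset.range m, coord ξ k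

/-- `∑_{r=1}^d (1 - ξ(≤ i)²)^{r-1} (1 - ξ(≤ i-1)²)^{d-r}`. -/
def choiceSum {C : ℕ} (d : ℕ) (ξ : Fin (C + 1) → ℝ) (i : ℕ) : ℝ :=
  ∑ r ∈ Finset.Icc 1 d, (1 - cum ξ (i + 1) ^ 2) ^ (r - 1) * (1 - cum ξ i ^ 2) ^ (d - r)

/-- The function `g_j`, `0 ≤ j ≤ C - 1`. -/
def g {C : ℕ} (d : ℕ) (j : ℕ) (ξ : Fin (C + 1) → ℝ) : ℝ :=
  2 * coord ξ C * coord ξ j * cum ξ (j + 1) * choiceSum d ξ j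
  + 2 * coord ξ C * coord ξ j *
    ∑ i ∈ Finset.Icc (j + 1) (C - 1), coord ξ i * choiceSum d ξ i

/-- The vector field `F`. -/
def F {C : ℕ} (lam : ℝ) (d : ℕ) (ξ : Fin (C + 1) → ℝ) : Fin (C + 1) → ℝ := fun k =>
  if (k : ℕ) = 0 then
    - lam * coord ξ 0 - lam * g d 0 ξ + coord ξ 1
  else if (k : ℕ) < C then
    lam * coord ξ (k - 1) - lam * coord ξ k + lam * g d (k - 1) ξ - lam * g d k ξ
      - k * coord ξ k + (k + 1) * coord ξ (k + 1)
  else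
    lam * coord ξ (C - 1) + lam * g d (C - 1) ξ - C * coord ξ C

/-- `ξ` solves `dξ/dt = F(ξ)` on `[0, t₀]` with `ξ(0) = ξ₀`. -/
def IsSolution {C : ℕ} (lam : ℝ) (d : ℕ) (t₀ : ℝ) (ξ₀ : Fin (C + 1) → ℝ)
    (ξ : ℝ → Fin (C + 1) → ℝ) : Prop :=
  ξ 0 = ξ₀ ∧ ∀ t ∈ Set.Icc 0 t₀, HasDerivWithinAt ξ (F lam d (ξ t)) (Set.Icc 0 t₀) t

/-! ### Constants and error bounds -/

def gam (lam : ℝ) (d C : ℕ) (t₀ : ℝ) : ℝ :=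
  1 / (2 ^ 25 * ((d : ℝ) ^ 8 + (d : ℝ) ^ 4 * C / lam) * (8 * lam * t₀ + 1) ^ 3 *
    Real.exp (800 * d * lam * t₀))

def nZero (lam : ℝ) (d C : ℕ) (t₀ : ℝ) : ℝ :=
  max (2 ^ 18 * (lam + 1 / lam) ^ 4 * (d : ℝ) ^ 4 * ((C : ℝ) + 1) ^ 6 * (t₀ + 1 / t₀) ^ 2)
    (Real.exp (8 / gam lam d C t₀))

/-- The initial discrepancy `sup_{u,j} |f_{u,j}(x) - (n-1) ξ₀(j)|`. -/
def discrepancy {n C : ℕ} (ξ₀ : Fin (C + 1) → ℝ) (x : State n C) : ℝ :=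
  ⨆ u : Fin n, ⨆ j : Fin (C + 1), |(count u j x : ℝ) - ((n : ℝ) - 1) * ξ₀ j|

/-- The error bound from the initial state `x`, for a general `ξ₀`. -/
def errorBound {n C : ℕ} (lam : ℝ) (d : ℕ) (t₀ : ℝ) (ξ₀ : Fin (C + 1) → ℝ) (x : State n C) : ℝ :=
  (discrepancy ξ₀ x +
    64 * (lam + 1) * (t₀ + 1) * (d : ℝ) ^ 2 * ((C : ℝ) + 1) ^ 3 *
      (n * phi x + 3 * Real.sqrt n * Real.log n)) *
  Real.exp (216 * (lam + 1) * (d : ℝ) ^ 2 * ((C : ℝ) + 1) ^ 3 * t₀)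

/-- The error bound from the initial state `x`, when `ξ₀` is the load profile of some node. -/
def errorBound' {n C : ℕ} (lam : ℝ) (d : ℕ) (t₀ : ℝ) (x : State n C) : ℝ :=
  64 * (lam + 1) * (t₀ + 1) * (d : ℝ) ^ 2 * ((C : ℝ) + 1) ^ 3 *
    (2 * n * phi x + 3 * Real.sqrt n * Real.log n) *
  Real.exp (216 * (lam + 1) * (d : ℝ) ^ 2 * ((C : ℝ) + 1) ^ 3 * t₀)

end BDAR

end

noncomputable section

namespace BDAR

open Filter

/-! ### Transition matrices of a finite generator -/

section Kernel

variable {S : Type*} [Fintype S] [DecidableEq S]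

/-! Each observable minus the accumulated drift is a martingale with small jumps, so the problem
reduces to drift estimates that close on themselves. The observables are the counts `cnt v k`, the
centred pair counts `pairDev u v j k` and the numbers `altCalls e` of rerouted calls. They determine
φ: `psi`, which is n - 2 times φ, is the largest of the |`pairDev`|, the differences of counts at
two nodes, and the `altCalls` (`psi_le`).

Mean-field closure. Arrivals on a link are governed by pair counts. If these nearly factorise and
all nodes have nearly the same load profile, i.e. if φ is small, then the arrival rate on a link of
load k is, up to O((psi + 1) / n), the number `rates` read off from the profile of any node
(`abs_linkArr_sub_le`, `rateApprox_profile`). Every link then behaves like a birth-and-death chain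
whose flow is F (`F_eq_flow`), and the counts at v drift like (n - 1) F up to O(psi + 1)
(`abs_gen_cnt_sub_F_le`). The drift of `psi` is also O(psi + 1). Indeed a pair count and the
matching product of counts follow the same linear flow, so their difference does too; simultaneous
jumps of {u,w} and {v,w} come only from calls between u and v carried through w, and these are what
φ³ measures (`abs_gen_pairDev_le_psi`, `abs_gen_cnt_sub_le_psi`, `gen_altCalls_le`).

Fluctuations. On a fine time grid, exponentials of compensated observables are supermartingales.
Ville's inequality (`ville_path`) and a union bound over O(n²) observables keep all of them within
√n log n of zero, with the stated failure probability (`eventually_prob_not_goodPath_le_exp`).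

On that event a discrete Gronwall argument for discrepancy + K psi gives the error bound at grid
points (`discrepancy_le_exp_of_good`). Bad events on dyadic grids increase, so the probability bound
passes to their union (`measure_iUnion_dyadicBad_le`), and right-continuity reaches all times
(`discrepancy_le_of_dyadic`). The equation is solved by truncating the field and proving the simplex
invariant (`exists_isSolution`). -/

theorem exp_apply_nonneg {A : Matrix S S ℝ} (hA : ∀ x y, 0 ≤ A x y) (x y : S) :
    0 ≤ NormedSpace.exp A x y := by
  open scoped Matrix.Norms.Operator in
  have h := NormedSpace.exp_series_hasSum_exp' (𝕂 := ℝ) A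
  have h2 : HasSum (fun k : ℕ => (((k.factorial : ℝ)⁻¹) • A ^ k) x y) (NormedSpace.exp A x y) :=
    Pi.hasSum.1 (Pi.hasSum.1 h x) y
  refine h2.nonneg fun k => ?_
  have hk : ∀ k x y, 0 ≤ (A ^ k) x y := by
    intro k
    induction k with
    | zero => intro x y; rw [pow_zero, Matrix.one_apply]; split_ifs <;> simp
    | succ k ih =>
      intro x y
      rw [pow_succ, Matrix.mul_apply]
      exact Finset.sum_nonneg fun z _ => mul_nonneg (ih x z) (hA z y)
  rw [Matrix.smul_apply, smul_eq_mul]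
  exact mul_nonneg (by positivity) (hk k x y)

/-- Only diagonal entries can be negative; adding a multiple of the identity repairs them and
changes the exponential by a positive scalar factor. -/
theorem exp_smul_generator_nonneg {Q : Matrix S S ℝ} (hQ : ∀ x y, x ≠ y → 0 ≤ Q x y) {t : ℝ}
    (ht : 0 ≤ t) (x y : S) : 0 ≤ NormedSpace.exp (t • Q) x y := by
  set c : ℝ := ∑ x, |Q x x| with hc
  have hsplit : t • Q = t • (Q + c • (1 : Matrix S S ℝ)) + Matrix.diagonal (fun _ => -(t * c)) := by
    ext a b
    by_cases hab : a = b
    · subst hab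
      simp
    · simp [hab]
  have hcomm : Commute (t • (Q + c • (1 : Matrix S S ℝ)))
      (Matrix.diagonal (fun _ : S => -(t * c))) := by
    have : Matrix.diagonal (fun _ : S => -(t * c)) = (-(t * c)) • (1 : Matrix S S ℝ) := by
      rw [Matrix.smul_one_eq_diagonal]
    rw [this]
    exact (Commute.one_right _).smul_right _
  rw [hsplit, Matrix.exp_add_of_commute _ _ hcomm, Matrix.exp_diagonal, Matrix.mul_diagonal]
  refine mul_nonneg (exp_apply_nonneg (fun a b => ?_) x y) ?_
  · rw [Matrix.smul_apply, smul_eq_mul, Matrix.add_apply, Matrix.smul_apply, smul_eq_mul]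
    refine mul_nonneg ht ?_
    by_cases hab : a = b
    · subst hab
      have h1 : |Q a a| ≤ c := Finset.single_le_sum (f := fun x => |Q x x|)
        (fun _ _ => abs_nonneg _) (Finset.mem_univ a)
      have h2 := neg_abs_le (Q a a)
      simp only [Matrix.one_apply_eq, mul_one]
      linarith
    · simpa [hab] using hQ a b hab
  · rw [Pi.coe_exp, ← Real.exp_eq_exp_ℝ]
    exact (Real.exp_pos _).le

/-- `Q` annihilates constants, so only the zeroth term of the exponential series contributes to a
row sum. -/
theorem exp_smul_generator_rowSum {Q : Matrix S S ℝ} (hQ : ∀ x, ∑ y, Q x y = 0) (t : ℝ) (x : S) :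
    ∑ y, NormedSpace.exp (t • Q) x y = 1 := by
  open scoped Matrix.Norms.Operator in
  have h := NormedSpace.exp_series_hasSum_exp' (𝕂 := ℝ) (t • Q)
  have h2 : HasSum (fun k : ℕ => ∑ y, (((k.factorial : ℝ)⁻¹) • (t • Q) ^ k) x y)
      (∑ y, NormedSpace.exp (t • Q) x y) :=
    hasSum_sum fun y _ => Pi.hasSum.1 (Pi.hasSum.1 h x) y
  refine h2.unique ?_
  have hk : ∀ k, ∑ y, (((k.factorial : ℝ)⁻¹) • (t • Q) ^ k) x y = if k = 0 then 1 else 0 := by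
    intro k
    rcases k with _ | k
    · simp [Matrix.one_apply]
    · simp only [Matrix.smul_apply, smul_eq_mul, ← Finset.mul_sum, pow_succ, Matrix.mul_apply]
      rw [Finset.sum_comm]
      simp [← Finset.mul_sum, hQ]
  simp_rw [hk]
  exact hasSum_ite_eq 0 (1 : ℝ)

theorem exp_smul_expansion (Q : Matrix S S ℝ) {η : ℝ} (hη : 0 < η) :
    ∀ᶠ δ : ℝ in 𝓝[>] 0, ∀ x y,
      |NormedSpace.exp (δ • Q) x y - (1 : Matrix S S ℝ) x y - δ * Q x y| ≤ η * δ := by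
  open scoped Matrix.Norms.Operator in
  have h := hasDerivAt_exp_smul_const (𝕂 := ℝ) Q (0 : ℝ)
  have h2 : ∀ x y, HasDerivAt (fun δ : ℝ => NormedSpace.exp (δ • Q) x y) (Q x y) 0 := by
    intro x y
    have := hasDerivAt_pi.1 (hasDerivAt_pi.1 h x) y
    simp only [zero_smul, NormedSpace.exp_zero, one_mul] at this
    exact this
  have h3 : ∀ x y, ∀ᶠ δ : ℝ in 𝓝[>] 0,
      |NormedSpace.exp (δ • Q) x y - (1 : Matrix S S ℝ) x y - δ * Q x y| ≤ η * δ := by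
    intro x y
    have h4 := (hasDerivAt_iff_isLittleO.1 (h2 x y)).def hη
    have h5 := h4.filter_mono (nhdsWithin_le_nhds (s := Set.Ioi (0 : ℝ)))
    filter_upwards [h5, self_mem_nhdsWithin] with δ hδ hpos
    simp only [zero_smul, NormedSpace.exp_zero, sub_zero, smul_eq_mul, Real.norm_eq_abs] at hδ
    rwa [abs_of_pos (show (0 : ℝ) < δ from hpos)] at hδ
  simp only [eventually_all]
  exact h3

/-- A short-time bound for the exponential moments of the increment of `h`. -/
theorem exp_smul_expMoment_le (Q : Matrix S S ℝ) (h : S → ℝ)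
    (θ V : ℝ)
    (hV : ∀ x, ∑ y, Q x y * Real.exp (θ * (h y - h x)) ≤ θ * ∑ y, Q x y * h y + V)
    {η : ℝ} (hη : 0 < η) :
    ∀ᶠ δ : ℝ in 𝓝[>] 0, ∀ x, ∑ y, NormedSpace.exp (δ • Q) x y * Real.exp (θ * (h y - h x)) ≤
      Real.exp (δ * (θ * ∑ y, Q x y * h y + V + η)) := by
  have hM : ∃ M : ℝ, 0 < M ∧ ∀ x, ∑ y, Real.exp (θ * (h y - h x)) ≤ M := by
    refine ⟨1 + ∑ x, ∑ y, Real.exp (θ * (h y - h x)), by positivity, fun x => ?_⟩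
    have := Finset.single_le_sum (f := fun x => ∑ y, Real.exp (θ * (h y - h x)))
      (fun _ _ => by positivity) (Finset.mem_univ x)
    linarith
  obtain ⟨M, hM0, hM⟩ := hM
  -- `M` bounds the total weight of any row, so an entrywise error of `η / M * δ` costs at most `η *
  -- δ`.
  filter_upwards [exp_smul_expansion Q (div_pos hη hM0), self_mem_nhdsWithin] with δ hδ hpos x
  have hpos : 0 < δ := hpos
  calc ∑ y, NormedSpace.exp (δ • Q) x y * Real.exp (θ * (h y - h x))
      ≤ ∑ y, ((1 : Matrix S S ℝ) x y + δ * Q x y + η / M * δ) * Real.exp (θ * (h y - h x)) := by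
        refine Finset.sum_le_sum fun y _ => mul_le_mul_of_nonneg_right ?_ (Real.exp_pos _).le
        have := (abs_le.1 (hδ x y)).2
        linarith
    _ = 1 + δ * ∑ y, Q x y * Real.exp (θ * (h y - h x))
        + η / M * δ * ∑ y, Real.exp (θ * (h y - h x)) := by
        simp only [add_mul, Finset.sum_add_distrib, Finset.mul_sum, mul_assoc]
        congr 2
        simp [Matrix.one_apply]
    _ ≤ 1 + δ * (θ * ∑ y, Q x y * h y + V) + η / M * δ * M := by
        gcongr
        · exact hV x
        · exact hM x
    _ = δ * (θ * ∑ y, Q x y * h y + V + η) + 1 := by field_simp; ring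
    _ ≤ _ := Real.add_one_le_exp _

end Kernel

/-! ### A maximal inequality along finite Markov paths -/

section Ville

variable {S : Type*}

/-- The product of the first `k` one-step values of `w` along a finite path. -/
def stepProd {N : ℕ} (w : S → S → ℝ) (x : Fin (N + 1) → S) (k : ℕ) : ℝ :=
  ∏ i : Fin N, if (i : ℕ) < k then w (x i.castSucc) (x i.succ) else 1

theorem sum_cons [Fintype S] {N : ℕ} (f : (Fin (N + 1) → S) → ℝ) :
    ∑ x, f x = ∑ a, ∑ y : Fin N → S, f (Fin.cons a y) := by
  rw [← (Fin.consEquiv (fun _ : Fin (N + 1) => S)).sum_comp, Fintype.sum_prod_type]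
  rfl

theorem prod_path_cons {N : ℕ} (P : S → S → ℝ) (a b : S) (y : Fin N → S) :
    ∏ i : Fin (N + 1), P ((Fin.cons a (Fin.cons b y : Fin (N + 1) → S) : Fin (N + 2) → S)
        i.castSucc) ((Fin.cons a (Fin.cons b y : Fin (N + 1) → S) : Fin (N + 2) → S) i.succ)
      = P a b * ∏ i : Fin N, P ((Fin.cons b y : Fin (N + 1) → S) i.castSucc)
          ((Fin.cons b y : Fin (N + 1) → S) i.succ) := by
  rw [Fin.prod_univ_succ]
  simp

theorem stepProd_cons {N : ℕ} (w : S → S → ℝ) (a b : S) (y : Fin N → S) (k : ℕ) :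
    stepProd w (Fin.cons a (Fin.cons b y : Fin (N + 1) → S) : Fin (N + 2) → S) (k + 1)
      = w a b * stepProd w (Fin.cons b y : Fin (N + 1) → S) k := by
  unfold stepProd
  rw [Fin.prod_univ_succ]
  simp

theorem stepProd_eq {N k : ℕ} (hk : k ≤ N) (w : S → S → ℝ) (x : ℕ → S) :
    stepProd w (fun i : Fin (N + 1) => x i) k = ∏ i ∈ Finset.range k, w (x i) (x (i + 1)) := by
  unfold stepProd
  simp only [Fin.val_castSucc, Fin.val_succ]
  rw [Fin.prod_univ_eq_prod_range (fun i => if i < k then w (x i) (x (i + 1)) else 1) N,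
    ← Finset.prod_filter]
  congr 1
  ext i
  simp only [Finset.mem_filter, Finset.mem_range]
  omega

variable [Fintype S]

theorem sum_path_eq_one {P : S → S → ℝ} (hP : ∀ x, ∑ y, P x y = 1) (N : ℕ) (a : S) :
    ∑ y : Fin N → S, ∏ i : Fin N, P ((Fin.cons a y : Fin (N + 1) → S) i.castSucc)
      ((Fin.cons a y : Fin (N + 1) → S) i.succ) = 1 := by
  induction N generalizing a with
  | zero => simp
  | succ N ih =>
    rw [sum_cons]
    simp only [prod_path_cons, ← Finset.mul_sum, ih, mul_one, hP]

open Classical in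
/-- Ville's maximal inequality for multiplicative supermartingales along a finite Markov chain. -/
theorem ville_path {P w : S → S → ℝ} (hP0 : ∀ x y, 0 ≤ P x y) (hP : ∀ x, ∑ y, P x y = 1)
    (hw0 : ∀ x y, 0 ≤ w x y) (hw : ∀ x, ∑ y, P x y * w x y ≤ 1) {A : ℝ} (hA : 0 < A)
    (N : ℕ) {z : ℝ} (hz : 0 ≤ z) (a : S) :
    ∑ y : Fin N → S, (if ∃ k, k ≤ N ∧ A ≤ z * stepProd w (Fin.cons a y : Fin (N + 1) → S) k
      then ∏ i : Fin N, P ((Fin.cons a y : Fin (N + 1) → S) i.castSucc)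
        ((Fin.cons a y : Fin (N + 1) → S) i.succ) else 0) ≤ z / A := by
  -- Condition on the first step, with `z` the current value of the supermartingale. If `z` has
  -- reached `A`, the bound is at least 1. Otherwise the crossing index is not 0, and the rest of
  -- the path starts afresh from `b` with value `z * w a b`.
  induction N generalizing z a with
  | zero =>
    simp only [stepProd, Finset.univ_eq_empty, Finset.prod_empty, mul_one]
    by_cases h : A ≤ z
    · simpa [h] using (one_le_div hA).2 h
    · simp only [h, and_false, exists_false, if_false, Finset.sum_const_zero]
      positivity
  | succ N ih =>
    by_cases h : A ≤ z
    · refine le_trans (Finset.sum_le_sum (g := fun y => ∏ i : Fin (N + 1),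
        P ((Fin.cons a y : Fin (N + 2) → S) i.castSucc)
        ((Fin.cons a y : Fin (N + 2) → S) i.succ)) fun y _ => ?_) ?_
      · split_ifs
        · exact le_rfl
        · exact Finset.prod_nonneg fun _ _ => hP0 _ _
      · rw [sum_path_eq_one hP]
        exact (one_le_div hA).2 h
    · rw [sum_cons]
      calc _ ≤ ∑ b, P a b * ∑ y : Fin N → S,
            (if ∃ k, k ≤ N ∧ A ≤ z * w a b * stepProd w (Fin.cons b y : Fin (N + 1) → S) k
            then ∏ i : Fin N, P ((Fin.cons b y : Fin (N + 1) → S) i.castSucc)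
              ((Fin.cons b y : Fin (N + 1) → S) i.succ) else 0) := by
            refine Finset.sum_le_sum fun b _ => ?_
            rw [Finset.mul_sum]
            refine Finset.sum_le_sum fun y _ => ?_
            rw [prod_path_cons]
            by_cases hk : ∃ k, k ≤ N ∧ A ≤ z * w a b *
                stepProd w (Fin.cons b y : Fin (N + 1) → S) k
            · rw [if_pos hk]
              split_ifs
              · exact le_rfl
              · exact mul_nonneg (hP0 _ _) (Finset.prod_nonneg fun _ _ => hP0 _ _)
            · rw [if_neg hk, if_neg]
              · simp
              · rintro ⟨k, hkN, hk'⟩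
                rcases k with _ | k
                · exact h (by simpa [stepProd] using hk')
                · refine hk ⟨k, by omega, ?_⟩
                  rwa [stepProd_cons, ← mul_assoc] at hk'
        _ ≤ ∑ b, P a b * (z * w a b / A) := by
            refine Finset.sum_le_sum fun b _ => mul_le_mul_of_nonneg_left
              (ih (mul_nonneg hz (hw0 _ _)) b) (hP0 _ _)
        _ = z / A * ∑ b, P a b * w a b := by
            rw [Finset.mul_sum]
            exact Finset.sum_congr rfl fun b _ => by ring
        _ ≤ z / A := mul_le_of_le_one_right (by positivity) (hw a)

/-- Only the joint law at the grid times enters: the event is covered by the cylinders over the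
finitely many paths whose product crosses `A`, and `ville_path` is averaged over the initial law. No
filtration is needed. -/
theorem ville_measure {Ω : Type*} [MeasurableSpace Ω] (μ : Measure Ω) [IsProbabilityMeasure μ]
    {P w : S → S → ℝ} (hP0 : ∀ x y, 0 ≤ P x y) (hP : ∀ x, ∑ y, P x y = 1)
    (hw0 : ∀ x y, 0 ≤ w x y) (hw : ∀ x, ∑ y, P x y * w x y ≤ 1) {A : ℝ} (hA : 0 < A)
    (N : ℕ) (X : ℕ → Ω → S) (hXm : ∀ x, MeasurableSet {ω | X 0 ω = x})
    (hX : ∀ x : Fin (N + 1) → S, μ.real {ω | ∀ i : Fin (N + 1), X i ω = x i} =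
      μ.real {ω | X 0 ω = x 0} * ∏ i : Fin N, P (x i.castSucc) (x i.succ)) :
    μ.real {ω | ∃ k, k ≤ N ∧ A ≤ ∏ i ∈ Finset.range k, w (X i ω) (X (i + 1) ω)} ≤ 1 / A := by
  classical
  have hsub : {ω | ∃ k, k ≤ N ∧ A ≤ ∏ i ∈ Finset.range k, w (X i ω) (X (i + 1) ω)} ⊆
      ⋃ x ∈ Finset.univ.filter (fun x : Fin (N + 1) → S => ∃ k, k ≤ N ∧ A ≤ 1 * stepProd w x k),
        {ω | ∀ i : Fin (N + 1), X i ω = x i} := by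
    rintro ω ⟨k, hk, h⟩
    simp only [Finset.mem_filter, Finset.mem_univ, true_and, Set.mem_iUnion, exists_prop]
    exact ⟨fun i => X i ω, ⟨k, hk, by
      rwa [one_mul, stepProd_eq hk w (fun i => X i ω)]⟩, fun _ => rfl⟩
  refine (measureReal_mono hsub (measure_ne_top _ _)).trans ((measureReal_biUnion_finset_le _ _).trans ?_)
  rw [Finset.sum_filter, sum_cons]
  calc _ = ∑ a, μ.real {ω | X 0 ω = a} * ∑ y : Fin N → S,
        (if ∃ k, k ≤ N ∧ A ≤ 1 * stepProd w (Fin.cons a y : Fin (N + 1) → S) k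
        then ∏ i : Fin N, P ((Fin.cons a y : Fin (N + 1) → S) i.castSucc)
          ((Fin.cons a y : Fin (N + 1) → S) i.succ) else 0) := by
        refine Finset.sum_congr rfl fun a _ => ?_
        rw [Finset.mul_sum]
        refine Finset.sum_congr rfl fun y _ => ?_
        rw [hX, mul_ite, mul_zero, Fin.cons_zero]
    _ ≤ ∑ a, μ.real {ω | X 0 ω = a} * (1 / A) :=
        Finset.sum_le_sum fun a _ => mul_le_mul_of_nonneg_left
          (ville_path hP0 hP hw0 hw hA N zero_le_one a) measureReal_nonneg
    _ = μ.real (⋃ a ∈ (Finset.univ : Finset S), {ω | X 0 ω = a}) * (1 / A) := by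
        rw [← Finset.sum_mul, measureReal_biUnion_finset]
        · intro a _ b _ hab
          exact Set.disjoint_left.2 fun ω h1 h2 => hab (h1.symm.trans h2)
        · exact fun a _ => hXm a
    _ ≤ 1 / A := mul_le_of_le_one_left (by positivity) measureReal_le_one

end Ville

/-! ### Exponential tail bounds for compensated observables -/

section Deviation

variable {n C : ℕ}

theorem rate_nonneg {lam : ℝ} (hlam : 0 ≤ lam) (hn : 2 ≤ n) (d : ℕ) (x y : State n C) :
    0 ≤ rate lam d x y := by
  have h2 : (0 : ℝ) ≤ (n : ℝ) - 2 := by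
    have : (2 : ℝ) ≤ n := by exact_mod_cast hn
    linarith
  unfold rate
  refine add_nonneg (Finset.sum_nonneg fun e _ => mul_nonneg (by positivity)
    (Finset.sum_nonneg fun w _ => Finset.sum_nonneg fun r _ => ?_))
    (Finset.sum_nonneg fun r _ => ?_)
  · split_ifs <;> simp
  · split_ifs <;> simp

theorem generator_nonneg {lam : ℝ} (hlam : 0 ≤ lam) (hn : 2 ≤ n) (d : ℕ) (x y : State n C)
    (hxy : x ≠ y) : 0 ≤ generator n C lam d x y := by
  rw [generator, if_neg hxy]
  exact rate_nonneg hlam hn d x y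

/-- The diagonal of the generator balances its row, so only increments of `h` matter, and the value
of `rate` on the diagonal is immaterial. -/
theorem sum_generator_mul (lam : ℝ) (d : ℕ) (h : State n C → ℝ) (x : State n C) :
    ∑ y, generator n C lam d x y * h y = ∑ y, rate lam d x y * (h y - h x) := by
  rw [← Finset.add_sum_erase _ _ (Finset.mem_univ x),
    ← Finset.add_sum_erase _ (fun y => rate lam d x y * (h y - h x)) (Finset.mem_univ x)]
  simp only [generator, if_true, sub_self, mul_zero, zero_add, neg_mul, Finset.sum_mul, mul_sub,
    Finset.sum_sub_distrib]
  rw [add_comm, sub_eq_add_neg]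
  congr 1
  refine Finset.sum_congr rfl fun y hy => ?_
  rw [if_neg (Finset.ne_of_mem_erase hy).symm]

theorem sum_generator (lam : ℝ) (d : ℕ) (x : State n C) :
    ∑ y, generator n C lam d x y = 0 := by
  have := sum_generator_mul lam d (fun _ => 1) x
  simpa using this

/-- The `k`-th point of the grid of mesh `T / N`. -/
def grid (T : ℝ≥0) (N k : ℕ) : ℝ≥0 := T / N * k

theorem coe_grid (T : ℝ≥0) (N k : ℕ) : ((grid T N k : ℝ≥0) : ℝ) = T / N * k := by
  simp [grid]

/-- The drift of `h` at `x`: the generator applied to `h`. -/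
def drift (lam : ℝ) (d : ℕ) (h : State n C → ℝ) (x : State n C) : ℝ :=
  ∑ y, generator n C lam d x y * h y

/-- The increment of `h` along the grid, compensated by the drift. -/
def comp {Ω : Type*} (lam : ℝ) (d : ℕ) (T : ℝ≥0) (X : ℝ≥0 → Ω → State n C) (h : State n C → ℝ)
    (N k : ℕ) (ω : Ω) : ℝ :=
  h (X (grid T N k) ω) - h (X (grid T N 0) ω)
    - T / N * ∑ i ∈ Finset.range k, drift lam d h (X (grid T N i) ω)

/-- For small mesh, the exponential of θ times the compensated increment, reduced by `V` per unit
time, is a multiplicative supermartingale on the grid. Ville's inequality turns the level `a` into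
the factor `exp (-θ a)`, and `T * V` is the total reduction. -/
theorem prob_comp_ge_le {Ω : Type*} [MeasurableSpace Ω] {μ : Measure Ω} [IsProbabilityMeasure μ]
    {lam : ℝ} (hlam : 0 ≤ lam) (hn : 2 ≤ n) {d : ℕ} {X : ℝ≥0 → Ω → State n C}
    (hX : IsProcess μ lam d X) {T : ℝ≥0} (hT : 0 < T) (h : State n C → ℝ) {θ V : ℝ} (hV0 : 0 ≤ V)
    (hθ : 0 < θ)
    (hV : ∀ x, ∑ y, generator n C lam d x y * Real.exp (θ * (h y - h x)) ≤
      θ * drift lam d h x + V) (a : ℝ) :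
    ∀ᶠ N : ℕ in atTop, μ.real {ω | ∃ k, k ≤ N ∧ a ≤ comp lam d T X h N k ω} ≤
      Real.exp (-(θ * a) + T * V + 1) := by
  have hT' : (0 : ℝ) < T := by exact_mod_cast hT
  -- With `η = 1 / T` the short-time errors over the whole grid add up to at most 1, which is the `+
  -- 1` in the exponent.
  have h1 := exp_smul_expMoment_le (generator n C lam d) h θ V hV
    (η := 1 / (T : ℝ)) (by positivity)
  have h2 : Tendsto (fun N : ℕ => (T : ℝ) / N) atTop (𝓝[>] 0) := by
    refine tendsto_nhdsWithin_iff.2 ⟨tendsto_const_div_atTop_nhds_zero_nat _, ?_⟩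
    filter_upwards [eventually_gt_atTop 0] with N hN
    have : (0 : ℝ) < N := by exact_mod_cast hN
    exact div_pos hT' this
  filter_upwards [h2.eventually h1, eventually_gt_atTop 0] with N hN hN0
  have hN0' : (0 : ℝ) < N := by exact_mod_cast hN0
  set δ : ℝ := (T : ℝ) / N with hδ
  have hδ0 : 0 < δ := div_pos hT' hN0'
  set w : State n C → State n C → ℝ := fun x y =>
    Real.exp (θ * (h y - h x) - δ * (θ * drift lam d h x + V + 1 / T)) with hw
  have key := ville_measure μ (P := transition n C lam d δ) (w := w)
    (exp_smul_generator_nonneg (generator_nonneg hlam hn d) hδ0.le)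
    (exp_smul_generator_rowSum (sum_generator lam d) δ)
    (fun x y => (Real.exp_pos _).le)
    (fun x => by
      simp only [hw, Real.exp_sub, mul_div_assoc', ← Finset.sum_div]
      exact (div_le_one (Real.exp_pos _)).2 (hN x))
    (Real.exp_pos (θ * a - T * V - 1)) N (fun i => X (grid T N i)) (fun x => hX.measurable _ x)
    (fun x => by
      have hm := hX.markov N (fun i => grid T N i) x (by simp [grid]) (fun i j hij => by
        have : (i : ℕ) ≤ j := hij
        simp only [grid]
        gcongr)
      rw [hm]
      have h0 : grid T N 0 = 0 := by simp [grid]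
      rw [h0]
      congr 1
      refine Finset.prod_congr rfl fun i _ => ?_
      congr 1
      simp only [coe_grid, hδ, Fin.val_succ, Fin.val_castSucc]
      push_cast
      ring_nf)
  refine (measureReal_mono ?_ (measure_ne_top _ _)).trans (key.trans_eq ?_)
  · rintro ω ⟨k, hk, hka⟩
    refine ⟨k, hk, ?_⟩
    simp only [hw]
    rw [← Real.exp_sum, Real.exp_le_exp]
    have hs : ∑ i ∈ Finset.range k, (θ * (h (X (grid T N (i + 1)) ω) - h (X (grid T N i) ω))
        - δ * (θ * drift lam d h (X (grid T N i) ω) + V + 1 / T))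
        = θ * comp lam d T X h N k ω - k * δ * (V + 1 / T) := by
      rw [Finset.sum_sub_distrib, ← Finset.mul_sum,
        Finset.sum_range_sub (fun i => h (X (grid T N i) ω)), ← Finset.mul_sum,
        Finset.sum_add_distrib, Finset.sum_add_distrib, ← Finset.mul_sum, comp]
      simp only [Finset.sum_const, Finset.card_range, nsmul_eq_mul]
      ring
    rw [hs]
    have h3 : (k : ℝ) * δ ≤ T := by
      have : (k : ℝ) ≤ N := by exact_mod_cast hk
      calc (k : ℝ) * δ ≤ N * δ := by gcongr
        _ = T := by rw [hδ]; field_simp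
    have h4 : (k : ℝ) * δ * (V + 1 / T) ≤ T * (V + 1 / T) := by gcongr
    have h5 : (T : ℝ) * (V + 1 / T) = T * V + 1 := by field_simp
    have h6 : θ * a ≤ θ * comp lam d T X h N k ω := by gcongr
    linarith
  · rw [one_div, ← Real.exp_neg]
    congr 1
    ring

end Deviation

/-! ### Arrival rates on routes -/

section Arrivals

variable {n C : ℕ}

theorem load_add (x y : Route n → ℕ) (l : Sym2 (Fin n)) : load (x + y) l = load x l + load y l := by
  simp only [load, ← Finset.sum_add_distrib, Pi.add_apply]
  exact Finset.sum_congr rfl fun r _ => by split_ifs <;> simp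

theorem load_single (r : Route n) (l : Sym2 (Fin n)) :
    load (Pi.single r 1) l = if l ∈ r.links then 1 else 0 := by
  classical
  unfold load
  rw [Finset.sum_eq_single r]
  · simp
  · intro b _ hb
    simp [hb]
  · simp

theorem load_add_single (x : Route n → ℕ) (r : Route n) (l : Sym2 (Fin n)) :
    load (x + Pi.single r 1) l = load x l + if l ∈ r.links then 1 else 0 := by
  rw [load_add, load_single]

theorem sub_single_add (x : Route n → ℕ) {r : Route n} (hr : x r ≠ 0) :
    x - Pi.single r 1 + Pi.single r 1 = x := by
  classical
  ext s
  simp only [Pi.add_apply, Pi.sub_apply]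
  by_cases h : s = r
  · subst h; simp; omega
  · simp [h]

theorem Accepts.load_le {d : ℕ} {x : State n C} {e : Link n} {w : Fin d → Mid e} {r : Route n}
    (h : Accepts x e w r) (l : Link n) : load (x.1 + Pi.single r 1) l.1 ≤ C := by
  rw [load_add_single]
  split_ifs with hl
  · rcases h with ⟨h1, rfl⟩ | ⟨-, i, h1, -, -, rfl⟩
    · simp only [Route.links, Finset.mem_singleton] at hl
      rw [hl]; omega
    · have : load x.1 l.1 ≤ pathLoad x e (w i) :=
        Finset.le_sup (f := load x.1) hl
      omega
  · exact x.2 l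

open Classical in
/-- The rate at which calls arrive on the route `r`. -/
def arr (lam : ℝ) (d : ℕ) (x : State n C) (r : Route n) : ℝ :=
  ∑ e : Link n, lam * (((n : ℝ) - 2) ^ d)⁻¹ *
    ∑ w : Fin d → Mid e, if Accepts x e w r then (1 : ℝ) else 0

/-- The generator applied to an observable, as a sum over the routes on which a call arrives or
ends. -/
theorem sum_rate_mul (lam : ℝ) (d : ℕ) (x : State n C) (H : (Route n → ℕ) → ℝ) :
    ∑ y : State n C, rate lam d x y * (H y.1 - H x.1) =
      ∑ r, arr lam d x r * (H (x.1 + Pi.single r 1) - H x.1)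
      + ∑ r, (x.1 r : ℝ) * (H (x.1 - Pi.single r 1) - H x.1) := by
  classical
  simp only [rate, add_mul, Finset.sum_add_distrib]
  congr 1
  · simp only [arr, Finset.sum_mul, Finset.mul_sum]
    rw [Finset.sum_comm]
    rw [Finset.sum_comm (s := (Finset.univ : Finset (Route n)))]
    refine Finset.sum_congr rfl fun e _ => ?_
    rw [Finset.sum_comm]
    rw [Finset.sum_comm (s := (Finset.univ : Finset (Route n)))]
    refine Finset.sum_congr rfl fun w _ => ?_
    rw [Finset.sum_comm]
    refine Finset.sum_congr rfl fun r _ => ?_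
    by_cases h : Accepts x e w r
    · obtain ⟨z, hz⟩ : ∃ z : State n C, z.1 = x.1 + Pi.single r 1 := ⟨⟨_, h.load_le⟩, rfl⟩
      have : ∀ y : State n C, (y.1 = z.1) ↔ y = z :=
        fun y => ⟨fun h => Subtype.ext h, fun h => by rw [h]⟩
      simp [h, ← hz, this]
    · simp [h]
  · simp only [Finset.sum_mul]
    rw [Finset.sum_comm]
    refine Finset.sum_congr rfl fun r _ => ?_
    -- Subtraction of load vectors is truncated, but on a route without calls the coefficient `x.1
    -- r` vanishes.
    by_cases hr : x.1 r = 0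
    · simp [hr]
    · have hle : ∀ l : Link n, load (x.1 - Pi.single r 1) l.1 ≤ C := by
        intro l
        refine le_trans ?_ (x.2 l)
        conv_rhs => rw [← sub_single_add x.1 hr]
        rw [load_add]
        exact Nat.le_add_right _ _
      obtain ⟨z, hz⟩ : ∃ z : State n C, z.1 = x.1 - Pi.single r 1 := ⟨⟨_, hle⟩, rfl⟩
      have : ∀ y : State n C, (x.1 = y.1 + Pi.single r 1) ↔ y = z := by
        intro y
        constructor
        · intro h
          refine Subtype.ext ?_
          rw [hz, h, add_tsub_cancel_right]
        · intro h
          rw [h, hz, sub_single_add x.1 hr]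
      simp [this, ← hz]

theorem arr_nonneg {lam : ℝ} (hlam : 0 ≤ lam) (hn : 2 ≤ n) (d : ℕ) (x : State n C) (r : Route n) :
    0 ≤ arr lam d x r := by
  have h2 : (0 : ℝ) ≤ (n : ℝ) - 2 := by
    have : (2 : ℝ) ≤ n := by exact_mod_cast hn
    linarith
  exact Finset.sum_nonneg fun e _ => mul_nonneg (by positivity)
    (Finset.sum_nonneg fun w _ => by split_ifs <;> simp)

theorem card_mid (hn : 2 ≤ n) (e : Link n) : (Fintype.card (Mid e) : ℝ) = (n : ℝ) - 2 := by
  have h := Fintype.card_subtype_compl (fun w : Fin n => w ∈ e.1)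
  have h2 : Fintype.card {w : Fin n // w ∈ e.1} = 2 := by
    rw [Fintype.card_subtype]
    have : (Finset.univ.filter fun w : Fin n => w ∈ e.1) = e.1.toFinset := by
      ext; simp
    rw [this, Sym2.card_toFinset_of_not_isDiag _ e.2]
  rw [h2, Fintype.card_fin] at h
  rw [show Fintype.card (Mid e) = n - 2 by rw [← h], Nat.cast_sub hn]
  norm_num

theorem Accepts.fst_eq {d : ℕ} {x : State n C} {e : Link n} {w : Fin d → Mid e} {r : Route n}
    (h : Accepts x e w r) : r.1 = e := by
  rcases h with ⟨-, rfl⟩ | ⟨-, i, -, -, -, rfl⟩ <;> rfl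

open Classical in
theorem arr_mk (lam : ℝ) (d : ℕ) (x : State n C) (e : Link n) (o : Option (Mid e)) :
    arr lam d x ⟨e, o⟩ = lam * (((n : ℝ) - 2) ^ d)⁻¹ *
      ∑ w : Fin d → Mid e, if Accepts x e w ⟨e, o⟩ then (1 : ℝ) else 0 := by
  unfold arr
  rw [Finset.sum_eq_single e]
  · intro e' _ he'
    rw [Finset.sum_eq_zero, mul_zero]
    intro w _
    rw [if_neg]
    exact fun h => he' h.fst_eq.symm
  · simp

theorem arr_none {lam : ℝ} {d : ℕ} (hn : 3 ≤ n) (x : State n C) (e : Link n) :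
    arr lam d x ⟨e, none⟩ = if load x.1 e.1 < C then lam else 0 := by
  have h2 : (0 : ℝ) < (n : ℝ) - 2 := by
    have : (3 : ℝ) ≤ n := by exact_mod_cast hn
    linarith
  classical
  rw [arr_mk]
  have : ∀ w : Fin d → Mid e, Accepts x e w ⟨e, none⟩ ↔ load x.1 e.1 < C := by
    intro w
    simp [Accepts]
  simp only [this]
  split_ifs
  · simp only [Finset.sum_const, Finset.card_univ, Fintype.card_fun, nsmul_eq_mul, mul_one,
      Nat.cast_pow, Fintype.card_fin, card_mid (by omega : 2 ≤ n)]
    field_simp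
  · simp

/-- The fraction of intermediate nodes whose path has larger load below `i`. -/
def below (x : State n C) (e : Link n) (i : ℕ) : ℝ :=
  ((Finset.univ.filter fun w : Mid e => pathLoad x e w < i).card : ℝ) / ((n : ℝ) - 2)

/-- The analogue of `choiceSum` for the link `e`. -/
def localChoice (d : ℕ) (x : State n C) (e : Link n) (i : ℕ) : ℝ :=
  ∑ r ∈ Finset.Icc 1 d, (1 - below x e (i + 1)) ^ (r - 1) * (1 - below x e i) ^ (d - r)

theorem sum_Icc_eq_sum_fin (d : ℕ) (a b : ℝ) :
    ∑ r ∈ Finset.Icc 1 d, a ^ (r - 1) * b ^ (d - r) =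
      ∑ i : Fin d, a ^ (i : ℕ) * b ^ (d - 1 - i) := by
  rw [Fin.sum_univ_eq_sum_range (fun i => a ^ i * b ^ (d - 1 - i)) d,
    ← Finset.Ico_add_one_right_eq_Icc, Finset.sum_Ico_eq_sum_range]
  refine Finset.sum_congr (by simp) fun i _ => ?_
  rw [show 1 + i - 1 = i by omega, show d - (1 + i) = d - 1 - i by omega]

theorem one_sub_below (hn : 3 ≤ n) (x : State n C) (e : Link n) (i : ℕ) :
    1 - below x e i =
      ((Finset.univ.filter fun w : Mid e => i ≤ pathLoad x e w).card : ℝ) / ((n : ℝ) - 2) := by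
  have h2 : (0 : ℝ) < (n : ℝ) - 2 := by
    have : (3 : ℝ) ≤ n := by exact_mod_cast hn
    linarith
  rw [below, eq_div_iff h2.ne', sub_mul, div_mul_cancel₀ _ h2.ne', one_mul,
    ← card_mid (by omega : 2 ≤ n) e, ← Finset.card_univ,
    ← Finset.card_filter_add_card_filter_not (fun w : Mid e => pathLoad x e w < i)]
  push_cast
  simp only [not_lt]
  ring

/-- The event is a product over positions: position `i` is pinned, earlier ones must be strictly
worse than `w₀`, later ones at least as bad. Breaking ties by order is what separates the two
factors. -/
theorem card_first_min {M : Type*} [Fintype M] [DecidableEq M] {d : ℕ} (p : M → ℕ) (w₀ : M) (i : Fin d) :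
    ((Finset.univ.filter fun w : Fin d → M => w i = w₀ ∧ (∀ s, p w₀ ≤ p (w s)) ∧
      ∀ s, s < i → p w₀ < p (w s)).card : ℝ)
      = ((Finset.univ.filter fun w : M => p w₀ + 1 ≤ p w).card : ℝ) ^ (i : ℕ) *
        ((Finset.univ.filter fun w : M => p w₀ ≤ p w).card : ℝ) ^ (d - 1 - i) := by
  have h1 : (Finset.univ.filter fun w : Fin d → M => w i = w₀ ∧ (∀ s, p w₀ ≤ p (w s)) ∧
      ∀ s, s < i → p w₀ < p (w s)) = Fintype.piFinset (fun s : Fin d =>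
        if s = i then {w₀} else if s < i then Finset.univ.filter fun w : M => p w₀ + 1 ≤ p w
          else Finset.univ.filter fun w : M => p w₀ ≤ p w) := by
    ext w
    simp only [Finset.mem_filter, Finset.mem_univ, true_and, Fintype.mem_piFinset]
    constructor
    · rintro ⟨h1, h2, h3⟩ s
      split_ifs with hs hs'
      · simp [hs, h1]
      · simpa using h3 s hs'
      · simpa using h2 s
    · intro h
      have h1 : w i = w₀ := by simpa using h i
      have h3 : ∀ s, s < i → p w₀ < p (w s) := by
        intro s hs
        have := h s
        rw [if_neg hs.ne, if_pos hs] at this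
        simpa using this
      refine ⟨h1, fun s => ?_, h3⟩
      rcases lt_trichotomy s i with hs | hs | hs
      · exact (h3 s hs).le
      · rw [hs, h1]
      · have := h s
        rw [if_neg hs.ne', if_neg hs.not_gt] at this
        simpa using this
  rw [h1, Fintype.card_piFinset]
  push_cast
  set a : ℝ := ((Finset.univ.filter fun w : M => p w₀ + 1 ≤ p w).card : ℝ)
  set b : ℝ := ((Finset.univ.filter fun w : M => p w₀ ≤ p w).card : ℝ)
  have h2 : ∀ s : Fin d, (((if s = i then {w₀} else if s < i then
      Finset.univ.filter fun w : M => p w₀ + 1 ≤ p w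
      else Finset.univ.filter fun w : M => p w₀ ≤ p w) : Finset M).card : ℝ)
      = (if s < i then a else 1) * (if i < s then b else 1) := by
    intro s
    rcases lt_trichotomy s i with hs | hs | hs
    · simp [hs, hs.ne, hs.not_gt, a]
    · simp [hs]
    · simp [hs, hs.ne', hs.not_gt, b]
  simp only [h2]
  rw [Finset.prod_mul_distrib, Finset.prod_ite, Finset.prod_ite]
  simp only [Finset.prod_const, one_pow, mul_one]
  congr 2
  · rw [show (Finset.univ.filter fun s : Fin d => s < i) = Finset.Iio i by ext; simp, Fin.card_Iio]
  · rw [show (Finset.univ.filter fun s : Fin d => i < s) = Finset.Ioi i by ext; simp, Fin.card_Ioi]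

/-- The events that `w₀` is the first minimiser, at position `i`, are disjoint in `i`, and
`card_first_min` counts each. Dividing by `(n - 2) ^ d` turns the counts into powers of `1 - below`,
with one factor left over for the pinned position. -/
theorem arr_some {lam : ℝ} {d : ℕ} (hn : 3 ≤ n) (x : State n C) (e : Link n) (w₀ : Mid e) :
    arr lam d x ⟨e, some w₀⟩ = if load x.1 e.1 < C then 0 else
      if pathLoad x e w₀ < C then
        lam / ((n : ℝ) - 2) * localChoice d x e (pathLoad x e w₀) else 0 := by
  have h2 : (0 : ℝ) < (n : ℝ) - 2 := by
    have : (3 : ℝ) ≤ n := by exact_mod_cast hn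
    linarith
  classical
  rw [arr_mk]
  have hacc : ∀ w : Fin d → Mid e, Accepts x e w ⟨e, some w₀⟩ ↔
      (¬ load x.1 e.1 < C ∧ pathLoad x e w₀ < C) ∧ ∃ i, w i = w₀ ∧
      (∀ s, pathLoad x e w₀ ≤ pathLoad x e (w s)) ∧
      ∀ s, s < i → pathLoad x e w₀ < pathLoad x e (w s) := by
    intro w
    simp only [Accepts, reduceCtorEq, and_false, false_or, Sigma.mk.injEq, heq_eq_eq, true_and,
      Option.some.injEq]
    constructor
    · rintro ⟨h1, i, h3, h4, h5, rfl⟩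
      exact ⟨⟨h1, h3⟩, i, rfl, h4, h5⟩
    · rintro ⟨⟨h1, h3⟩, i, rfl, h4, h5⟩
      exact ⟨h1, i, h3, h4, h5, rfl⟩
  by_cases h1 : load x.1 e.1 < C
  · simp [hacc, h1]
  by_cases h3 : pathLoad x e w₀ < C
  · simp only [hacc, h1, h3, not_false_eq_true, true_and, if_true, if_false]
    have hind : ∀ w : Fin d → Mid e, (if ∃ i, w i = w₀ ∧
        (∀ s, pathLoad x e w₀ ≤ pathLoad x e (w s)) ∧
        ∀ s, s < i → pathLoad x e w₀ < pathLoad x e (w s) then (1 : ℝ) else 0) =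
        ∑ i : Fin d, if w i = w₀ ∧ (∀ s, pathLoad x e w₀ ≤ pathLoad x e (w s)) ∧
          ∀ s, s < i → pathLoad x e w₀ < pathLoad x e (w s) then (1 : ℝ) else 0 := by
      intro w
      split_ifs with h
      · obtain ⟨i, hi⟩ := h
        rw [Finset.sum_eq_single i, if_pos hi]
        · intro j _ hj
          rw [if_neg]
          rintro ⟨hj1, hj2, hj3⟩
          rcases lt_or_gt_of_ne hj with hlt | hlt
          · have := hi.2.2 j hlt
            rw [hj1] at this
            exact lt_irrefl _ this
          · have := hj3 i hlt
            rw [hi.1] at this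
            exact lt_irrefl _ this
        · simp
      · symm
        exact Finset.sum_eq_zero fun i _ => if_neg fun hi => h ⟨i, hi⟩
    simp only [hind]
    rw [Finset.sum_comm]
    simp only [Finset.sum_boole]
    rw [localChoice, sum_Icc_eq_sum_fin, Finset.mul_sum, Finset.mul_sum, one_sub_below hn, one_sub_below hn]
    refine Finset.sum_congr rfl fun i _ => ?_
    have hid : (i : ℕ) < d := i.2
    rw [card_first_min (pathLoad x e) w₀, div_pow, div_pow]
    have hpow : ((n : ℝ) - 2) ^ d =
        ((n : ℝ) - 2) * (((n : ℝ) - 2) ^ (i : ℕ) * ((n : ℝ) - 2) ^ (d - 1 - i)) := by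
      rw [← pow_add, ← pow_succ']
      congr 1
      omega
    rw [hpow]
    field_simp
  · simp [hacc, h1, h3]

end Arrivals

/-! ### Stability of the mixed geometric sum -/

section Geometric

/-- `∑_{r=1}^d a^{r-1} b^{d-r}`. -/
def geomMix (d : ℕ) (a b : ℝ) : ℝ := ∑ r ∈ Finset.Icc 1 d, a ^ (r - 1) * b ^ (d - r)

theorem geomMix_nonneg (d : ℕ) {a b : ℝ} (ha : 0 ≤ a) (hb : 0 ≤ b) : 0 ≤ geomMix d a b :=
  Finset.sum_nonneg fun _ _ => by positivity

theorem geomMix_le (d : ℕ) {a b : ℝ} (ha : 0 ≤ a) (ha1 : a ≤ 1) (hb : 0 ≤ b) (hb1 : b ≤ 1) :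
    geomMix d a b ≤ d := by
  refine (Finset.sum_le_card_nsmul _ _ 1 fun r _ => ?_).trans (by simp)
  exact mul_le_one₀ (pow_le_one₀ ha ha1) (by positivity) (pow_le_one₀ hb hb1)

theorem abs_pow_sub_pow_le_mul {a b : ℝ} (ha : 0 ≤ a) (ha1 : a ≤ 1) (hb : 0 ≤ b) (hb1 : b ≤ 1)
    (k : ℕ) : |a ^ k - b ^ k| ≤ k * |a - b| := by
  induction k with
  | zero => simp
  | succ k ih =>
    have h : a ^ (k + 1) - b ^ (k + 1) = a ^ k * (a - b) + (a ^ k - b ^ k) * b := by ring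
    rw [h]
    refine (abs_add_le _ _).trans ?_
    rw [abs_mul, abs_mul, abs_of_nonneg (pow_nonneg ha k), abs_of_nonneg hb]
    have h1 : a ^ k * |a - b| ≤ 1 * |a - b| :=
      mul_le_mul_of_nonneg_right (pow_le_one₀ ha ha1) (abs_nonneg _)
    have h2 : |a ^ k - b ^ k| * b ≤ k * |a - b| * 1 := mul_le_mul ih hb1 hb (by positivity)
    push_cast
    linarith

theorem abs_mul_sub_mul_le {a b a' b' A B : ℝ} (ha : |a| ≤ A) (hb' : |b'| ≤ B) :
    |a * b - a' * b'| ≤ A * |b - b'| + B * |a - a'| := by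
  have h : a * b - a' * b' = a * (b - b') + b' * (a - a') := by ring
  rw [h]
  refine (abs_add_le _ _).trans ?_
  rw [abs_mul, abs_mul]
  gcongr

/-- Each of the `d` summands is a product of `d - 1` factors from `[0, 1]`, hence moves by at most
`d * η`. -/
theorem abs_geomMix_sub_le (d : ℕ) {a b a' b' η : ℝ} (ha : 0 ≤ a) (ha1 : a ≤ 1) (hb : 0 ≤ b)
    (hb1 : b ≤ 1) (ha' : 0 ≤ a') (ha1' : a' ≤ 1) (hb' : 0 ≤ b') (hb1' : b' ≤ 1)
    (h : |a - a'| ≤ η) (h' : |b - b'| ≤ η) :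
    |geomMix d a b - geomMix d a' b'| ≤ (d : ℝ) ^ 2 * η := by
  have hη : 0 ≤ η := (abs_nonneg _).trans h
  unfold geomMix
  rw [← Finset.sum_sub_distrib]
  refine (Finset.abs_sum_le_sum_abs _ _).trans ?_
  refine (Finset.sum_le_card_nsmul _ _ (d * η) fun r hr => ?_).trans (by simp [sq, mul_assoc])
  rw [Finset.mem_Icc] at hr
  refine (abs_mul_sub_mul_le (A := 1) (B := 1) ?_ ?_).trans ?_
  · rw [abs_of_nonneg (by positivity)]
    exact pow_le_one₀ ha ha1
  · rw [abs_of_nonneg (by positivity)]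
    exact pow_le_one₀ hb' hb1'
  · have h1 := abs_pow_sub_pow_le_mul ha ha1 ha' ha1' (r - 1)
    have h2 := abs_pow_sub_pow_le_mul hb hb1 hb' hb1' (d - r)
    have h3 : ((r - 1 : ℕ) : ℝ) + ((d - r : ℕ) : ℝ) ≤ d := by
      exact_mod_cast (by omega : r - 1 + (d - r) ≤ d)
    calc _ ≤ ((d - r : ℕ) : ℝ) * η + ((r - 1 : ℕ) : ℝ) * η := by
          rw [one_mul, one_mul]
          exact add_le_add (h2.trans (by gcongr)) (h1.trans (by gcongr))
      _ = (((r - 1 : ℕ) : ℝ) + ((d - r : ℕ) : ℝ)) * η := by ring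
      _ ≤ d * η := by gcongr

end Geometric

/-! ### Sums over the routes through a link, and arrival rates on links -/

section Links

variable {n C : ℕ}

theorem sum_link_mem (u : Fin n) (g : Link n → ℝ) :
    ∑ e : Link n, (if u ∈ e.1 then g e else 0) =
      ∑ y, if h : u ≠ y then g ⟨s(u, y), by simpa using h⟩ else 0 := by
  rw [← Finset.sum_filter]
  have h1 : ∑ y, (if h : u ≠ y then g ⟨s(u, y), by simpa using h⟩ else 0) =
      ∑ y ∈ Finset.univ.filter (fun y => u ≠ y),
        if h : u ≠ y then g ⟨s(u, y), by simpa using h⟩ else 0 := by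
    rw [Finset.sum_filter]
    refine Finset.sum_congr rfl fun y _ => ?_
    by_cases h : u = y <;> simp [h]
  rw [h1]
  symm
  refine Finset.sum_bij (fun y hy => ⟨s(u, y), by simpa using hy⟩) ?_ ?_ ?_ ?_
  · intro y hy
    simp
  · intro y hy z hz h
    exact Sym2.congr_right.1 (congrArg Subtype.val h)
  · rintro ⟨e, he⟩ hu
    simp only [Finset.mem_filter, Finset.mem_univ, true_and] at hu
    obtain ⟨y, rfl⟩ := hu
    exact ⟨y, by simpa using he, rfl⟩
  · intro y hy
    simp only [Finset.mem_filter, Finset.mem_univ, true_and] at hy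
    rw [dif_pos hy]

theorem mid_mem {u v w : Fin n} (h : u ≠ v ∧ w ≠ u ∧ w ≠ v) : w ∉ s(u, v) := by
  simp [h.2.1, h.2.2]

/-- The value of `T` on the path from `u` to `v` through `w`. -/
def alt (T : Route n → ℝ) (u v w : Fin n) : ℝ :=
  if h : u ≠ v ∧ w ≠ u ∧ w ≠ v then
    T ⟨⟨s(u, v), by simpa using h.1⟩, some ⟨w, mid_mem h⟩⟩ else 0

theorem mem_links_some {e : Link n} {z : Mid e} {u w : Fin n} :
    s(u, w) ∈ Route.links ⟨e, some z⟩ ↔ (u ∈ e.1 ∧ z.1 = w) ∨ (w ∈ e.1 ∧ z.1 = u) := by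
  simp only [Route.links, Finset.mem_image, Finset.mem_filter, Finset.mem_univ, true_and,
    Sym2.eq_iff]
  constructor
  · rintro ⟨a, ha, ⟨rfl, rfl⟩ | ⟨rfl, rfl⟩⟩
    · exact Or.inl ⟨ha, rfl⟩
    · exact Or.inr ⟨ha, rfl⟩
  · rintro (⟨h1, h2⟩ | ⟨h1, h2⟩)
    · exact ⟨u, h1, Or.inl ⟨rfl, h2⟩⟩
    · exact ⟨w, h1, Or.inr ⟨rfl, h2⟩⟩

theorem sum_alt (T : Route n → ℝ) (u w : Fin n) :
    ∑ e : Link n, ∑ z : Mid e, (if u ∈ e.1 ∧ z.1 = w then T ⟨e, some z⟩ else 0) =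
      ∑ y, alt T u y w := by
  have h1 : ∀ e : Link n, ∑ z : Mid e, (if u ∈ e.1 ∧ z.1 = w then T ⟨e, some z⟩ else 0) =
      if u ∈ e.1 then (if h : w ∉ e.1 then T ⟨e, some ⟨w, h⟩⟩ else 0) else 0 := by
    intro e
    by_cases hu : u ∈ e.1
    · by_cases hw : w ∉ e.1
      · have : ∀ z : Mid e, z.1 = w ↔ z = ⟨w, hw⟩ := 
          fun z => ⟨fun h => Subtype.ext h, fun h => by rw [h]⟩
        simp [hu, hw, this]
      · rw [if_pos hu, dif_neg hw]
        refine Finset.sum_eq_zero fun z _ => if_neg ?_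
        rintro ⟨-, rfl⟩
        exact hw z.2
    · simp [hu]
  simp only [h1]
  rw [sum_link_mem u (fun e => if h : w ∉ e.1 then T ⟨e, some ⟨w, h⟩⟩ else 0)]
  refine Finset.sum_congr rfl fun y _ => ?_
  unfold alt
  by_cases h : u ≠ y ∧ w ≠ u ∧ w ≠ y
  · rw [dif_pos h, dif_pos h.1, dif_pos (mid_mem h)]
  · rw [dif_neg h]
    by_cases hy : u ≠ y
    · rw [dif_pos hy, dif_neg]
      simp only [Sym2.mem_iff]
      tauto
    · rw [dif_neg hy]

/-- A sum over the routes that use the link `{u, w}`. -/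
theorem sum_links {u w : Fin n} (h : u ≠ w) (T : Route n → ℝ) :
    ∑ r : Route n, (if s(u, w) ∈ r.links then T r else 0) =
      T ⟨⟨s(u, w), by simpa using h⟩, none⟩ + ∑ y, (alt T u y w + alt T w y u) := by
  rw [Fintype.sum_sigma]
  simp only [Fintype.sum_option, Finset.sum_add_distrib]
  congr 1
  · rw [Finset.sum_eq_single ⟨s(u, w), by simpa using h⟩]
    · simp [Route.links]
    · intro e _ he
      rw [if_neg]
      simp only [Route.links, Finset.mem_singleton]
      exact fun h' => he (Subtype.ext h'.symm)
    · simp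
  · rw [← sum_alt, ← sum_alt, ← Finset.sum_add_distrib]
    refine Finset.sum_congr rfl fun e _ => ?_
    rw [← Finset.sum_add_distrib]
    refine Finset.sum_congr rfl fun z _ => ?_
    rw [if_congr mem_links_some rfl rfl]
    by_cases h1 : u ∈ e.1 ∧ z.1 = w
    · have h2 : ¬ (w ∈ e.1 ∧ z.1 = u) := fun h2 => h (h2.2.symm.trans h1.2)
      rw [if_pos (Or.inl h1), if_pos h1, if_neg h2, add_zero]
    · by_cases h2 : w ∈ e.1 ∧ z.1 = u
      · rw [if_pos (Or.inr h2), if_neg h1, if_pos h2, zero_add]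
      · rw [if_neg (not_or.2 ⟨h1, h2⟩), if_neg h1, if_neg h2, zero_add]

/-- The rate at which calls arrive on a link. -/
def linkArr (lam : ℝ) (d : ℕ) (x : State n C) (l : Sym2 (Fin n)) : ℝ :=
  ∑ r : Route n, if l ∈ r.links then arr lam d x r else 0

theorem pathLoad_mk (x : State n C) {u v w : Fin n} (h : u ≠ v ∧ w ≠ u ∧ w ≠ v) :
    pathLoad x ⟨s(u, v), by simpa using h.1⟩ ⟨w, mid_mem h⟩ =
      max (load x.1 s(u, w)) (load x.1 s(v, w)) := by
  unfold pathLoad Route.links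
  have : (Finset.univ.filter fun a => a ∈ s(u, v)) = {u, v} := by
    ext a; simp
  simp only [this, Finset.image_insert, Finset.image_singleton, Finset.sup_insert,
    Finset.sup_singleton]

theorem two_lt_cast (hn : 3 ≤ n) : (0 : ℝ) < (n : ℝ) - 2 := by
  have : (3 : ℝ) ≤ n := by exact_mod_cast hn
  linarith

theorem below_nonneg (hn : 3 ≤ n) (x : State n C) (e : Link n) (i : ℕ) : 0 ≤ below x e i :=
  div_nonneg (Nat.cast_nonneg _) (two_lt_cast hn).le

theorem one_sub_below_nonneg (hn : 3 ≤ n) (x : State n C) (e : Link n) (i : ℕ) :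
    0 ≤ 1 - below x e i := by
  rw [one_sub_below hn]
  exact div_nonneg (Nat.cast_nonneg _) (two_lt_cast hn).le

theorem localChoice_eq (d : ℕ) (x : State n C) (e : Link n) (i : ℕ) :
    localChoice d x e i = geomMix d (1 - below x e (i + 1)) (1 - below x e i) := rfl

theorem localChoice_le (hn : 3 ≤ n) (d : ℕ) (x : State n C) (e : Link n) (i : ℕ) :
    localChoice d x e i ≤ d :=
  geomMix_le d (one_sub_below_nonneg hn _ _ _) (by linarith [below_nonneg hn x e (i + 1)])
    (one_sub_below_nonneg hn _ _ _) (by linarith [below_nonneg hn x e i])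

theorem alt_arr {lam : ℝ} {d : ℕ} (hn : 3 ≤ n) (x : State n C) {u v w : Fin n}
    (h : u ≠ v ∧ w ≠ u ∧ w ≠ v) :
    alt (arr lam d x) u v w = if load x.1 s(u, v) < C then 0 else
      if max (load x.1 s(u, w)) (load x.1 s(v, w)) < C then
        lam / ((n : ℝ) - 2) * localChoice d x ⟨s(u, v), by simpa using h.1⟩
          (max (load x.1 s(u, w)) (load x.1 s(v, w))) else 0 := by
  rw [alt, dif_pos h, arr_some hn, pathLoad_mk x h]

theorem alt_nonneg {T : Route n → ℝ} (hT : ∀ r, 0 ≤ T r) (u v w : Fin n) : 0 ≤ alt T u v w := by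
  unfold alt
  split_ifs
  · exact hT _
  · exact le_rfl

theorem alt_arr_le {lam : ℝ} (hlam : 0 ≤ lam) {d : ℕ} (hn : 3 ≤ n) (x : State n C) (u v w : Fin n) :
    alt (arr lam d x) u v w ≤
      if u ≠ v ∧ w ≠ u ∧ w ≠ v then lam / ((n : ℝ) - 2) * d else 0 := by
  have h2 := two_lt_cast hn
  by_cases h : u ≠ v ∧ w ≠ u ∧ w ≠ v
  · rw [alt_arr hn x h, if_pos h]
    split_ifs
    · positivity
    · exact mul_le_mul_of_nonneg_left (localChoice_le hn _ _ _ _) (by positivity)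
    · positivity
  · rw [if_neg h, alt, dif_neg h]

theorem card_ne_ne (hn : 2 ≤ n) {u v : Fin n} (h : u ≠ v) :
    ((Finset.univ.filter fun w : Fin n => w ≠ u ∧ w ≠ v).card : ℝ) = (n : ℝ) - 2 := by
  have h1 : (Finset.univ.filter fun w : Fin n => w ≠ u ∧ w ≠ v) = (Finset.univ.erase u).erase v := by
    ext w
    simp [and_comm]
  rw [h1, Finset.card_erase_of_mem (by simp [h.symm]), Finset.card_erase_of_mem (by simp)]
  rw [Finset.card_univ, Fintype.card_fin, Nat.sub_sub, Nat.cast_sub hn]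
  norm_num

/-- Each of the `n - 2` third nodes contributes at most `lam * d / (n - 2)`. Here the intermediate
node is fixed and the far endpoint varies; `sum_alt_arr_mid_le` exchanges these roles. -/
theorem sum_alt_arr_le {lam : ℝ} (hlam : 0 ≤ lam) {d : ℕ} (hn : 3 ≤ n) (x : State n C)
    (u w : Fin n) : ∑ y, alt (arr lam d x) u y w ≤ lam * d := by
  have h2 := two_lt_cast hn
  by_cases huw : u = w
  · subst huw
    simp [alt]
    positivity
  calc ∑ y, alt (arr lam d x) u y w
      ≤ ∑ y, if y ≠ u ∧ y ≠ w then lam / ((n : ℝ) - 2) * d else 0 := by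
        refine Finset.sum_le_sum fun y _ => (alt_arr_le hlam hn x u y w).trans_eq ?_
        refine if_congr ?_ rfl rfl
        constructor
        · rintro ⟨h1, h2, h3⟩; exact ⟨h1.symm, h3.symm⟩
        · rintro ⟨h1, h3⟩; exact ⟨h1.symm, fun h => huw h.symm, h3.symm⟩
    _ = lam * d := by
        rw [← Finset.sum_filter, Finset.sum_const, nsmul_eq_mul, card_ne_ne (by omega) huw]
        field_simp

theorem sum_alt_arr_mid_le {lam : ℝ} (hlam : 0 ≤ lam) {d : ℕ} (hn : 3 ≤ n) (x : State n C)
    (u v : Fin n) : ∑ w, alt (arr lam d x) u v w ≤ lam * d := by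
  have h2 := two_lt_cast hn
  by_cases huv : u = v
  · subst huv
    simp [alt]
    positivity
  calc ∑ w, alt (arr lam d x) u v w
      ≤ ∑ w, if w ≠ u ∧ w ≠ v then lam / ((n : ℝ) - 2) * d else 0 := by
        refine Finset.sum_le_sum fun y _ => (alt_arr_le hlam hn x u v y).trans_eq ?_
        refine if_congr ?_ rfl rfl
        tauto
    _ = lam * d := by
        rw [← Finset.sum_filter, Finset.sum_const, nsmul_eq_mul, card_ne_ne (by omega) huv]
        field_simp

/-- One `lam * d` each for direct calls, calls from `u` through `w`, and calls from `w` through `u`.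
-/
theorem linkArr_le {lam : ℝ} (hlam : 0 ≤ lam) {d : ℕ} (hd : 1 ≤ d) (hn : 3 ≤ n) (x : State n C)
    {u w : Fin n} (h : u ≠ w) : linkArr lam d x s(u, w) ≤ 3 * lam * d := by
  have hd' : (1 : ℝ) ≤ d := by exact_mod_cast hd
  rw [linkArr, sum_links h, arr_none hn, Finset.sum_add_distrib]
  have h1 := sum_alt_arr_le hlam (d := d) hn x u w
  have h2 := sum_alt_arr_le hlam (d := d) hn x w u
  have h3 : (if load x.1 s(u, w) < C then lam else 0) ≤ lam * d := by
    split_ifs <;> nlinarith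
  linarith

theorem cast_load (x : Route n → ℕ) (l : Sym2 (Fin n)) :
    (load x l : ℝ) = ∑ r : Route n, if l ∈ r.links then (x r : ℝ) else 0 := by
  simp only [load, Nat.cast_sum, Nat.cast_ite, Nat.cast_zero]

theorem load_le (x : State n C) {u w : Fin n} (h : u ≠ w) : load x.1 s(u, w) ≤ C :=
  x.2 ⟨s(u, w), by simpa using h⟩

end Links

/-! ### The generator on observables, and their local variation -/

section Observables

variable {n C : ℕ}

/-- The generator acting on functions of the load vector. -/
def gen (lam : ℝ) (d : ℕ) (x : State n C) (H : (Route n → ℕ) → ℝ) : ℝ :=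
  ∑ r, arr lam d x r * (H (x.1 + Pi.single r 1) - H x.1)
    + ∑ r, (x.1 r : ℝ) * (H (x.1 - Pi.single r 1) - H x.1)

theorem drift_eq_gen (lam : ℝ) (d : ℕ) (x : State n C) (H : (Route n → ℕ) → ℝ) :
    drift lam d (fun y => H y.1) x = gen lam d x H := by
  rw [drift, sum_generator_mul, sum_rate_mul, gen]

/-- `H` changes by at most `b r` when a call on the route `r` arrives. -/
def Local (H : (Route n → ℕ) → ℝ) (b : Route n → ℝ) : Prop :=
  ∀ x r, |H (x + Pi.single r 1) - H x| ≤ b r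

/-- `Local` quantifies over all load vectors, not only admissible ones, so a departure is an arrival
read backwards. -/
theorem Local.sub {H : (Route n → ℕ) → ℝ} {b : Route n → ℝ} (h : Local H b) {x : Route n → ℕ}
    {r : Route n} (hr : x r ≠ 0) : |H (x - Pi.single r 1) - H x| ≤ b r := by
  have := h (x - Pi.single r 1) r
  rwa [sub_single_add x hr, abs_sub_comm] at this

theorem Local.nonneg {H : (Route n → ℕ) → ℝ} {b : Route n → ℝ} (h : Local H b) (r : Route n) :
    0 ≤ b r := (abs_nonneg _).trans (h 0 r)

theorem Local.mono {H : (Route n → ℕ) → ℝ} {b b' : Route n → ℝ} (h : Local H b)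
    (hb : ∀ r, b r ≤ b' r) : Local H b' := fun x r => (h x r).trans (hb r)

theorem gen_add (lam : ℝ) (d : ℕ) (x : State n C) (H K : (Route n → ℕ) → ℝ) :
    gen lam d x (fun y => H y + K y) = gen lam d x H + gen lam d x K := by
  simp only [gen, add_sub_add_comm, mul_add, Finset.sum_add_distrib]
  ring

theorem gen_const_mul (lam : ℝ) (d : ℕ) (x : State n C) (a : ℝ) (H : (Route n → ℕ) → ℝ) :
    gen lam d x (fun y => a * H y) = a * gen lam d x H := by
  simp only [gen, mul_add, Finset.mul_sum, ← mul_sub]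
  congr 1 <;> exact Finset.sum_congr rfl fun r _ => by ring

theorem gen_sub (lam : ℝ) (d : ℕ) (x : State n C) (H K : (Route n → ℕ) → ℝ) :
    gen lam d x (fun y => H y - K y) = gen lam d x H - gen lam d x K := by
  have := gen_add lam d x H (fun y => (-1) * K y)
  rw [gen_const_mul] at this
  simpa [sub_eq_add_neg] using this

theorem gen_sum {ι : Type*} (s : Finset ι) (lam : ℝ) (d : ℕ) (x : State n C)
    (H : ι → (Route n → ℕ) → ℝ) :
    gen lam d x (fun y => ∑ i ∈ s, H i y) = ∑ i ∈ s, gen lam d x (H i) := by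
  classical
  induction s using Finset.induction_on with
  | empty => simp [gen]
  | insert i s hi ih =>
    simp only [Finset.sum_insert hi, gen_add, ih]

/-- Leibniz rule for a jump process: the defect is the covariation, the sum over jumps of rate times
the product of the two increments. -/
theorem gen_mul_sub_le {lam : ℝ} (hlam : 0 ≤ lam) (hn : 2 ≤ n) (d : ℕ) (x : State n C)
    {H K : (Route n → ℕ) → ℝ} {b b' : Route n → ℝ} (hH : Local H b) (hK : Local K b') :
    |gen lam d x (fun y => H y * K y) - (H x.1 * gen lam d x K + K x.1 * gen lam d x H)| ≤
      ∑ r, (arr lam d x r + x.1 r) * (b r * b' r) := by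
  have h1 : gen lam d x (fun y => H y * K y) - (H x.1 * gen lam d x K + K x.1 * gen lam d x H) =
      ∑ r, (arr lam d x r * ((H (x.1 + Pi.single r 1) - H x.1) * (K (x.1 + Pi.single r 1) - K x.1))
        + (x.1 r : ℝ) * ((H (x.1 - Pi.single r 1) - H x.1) * (K (x.1 - Pi.single r 1) - K x.1))) := by
    simp only [gen, mul_add, Finset.mul_sum, ← Finset.sum_add_distrib, ← Finset.sum_sub_distrib]
    exact Finset.sum_congr rfl fun r _ => by ring
  rw [h1]
  refine (Finset.abs_sum_le_sum_abs _ _).trans (Finset.sum_le_sum fun r _ => ?_)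
  refine (abs_add_le _ _).trans ?_
  rw [add_mul, abs_mul, abs_mul, abs_mul, abs_mul, abs_of_nonneg (arr_nonneg hlam hn d x r),
    Nat.abs_cast]
  refine add_le_add ?_ ?_
  · exact mul_le_mul_of_nonneg_left (mul_le_mul (hH _ _) (hK _ _) (abs_nonneg _) (hH.nonneg r))
      (arr_nonneg hlam hn d x r)
  · by_cases hr : x.1 r = 0
    · simp [hr]
    · exact mul_le_mul_of_nonneg_left (mul_le_mul (hH.sub hr) (hK.sub hr) (abs_nonneg _)
        (hH.nonneg r)) (Nat.cast_nonneg _)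

/-- The exponential generator of a local observable. -/
theorem expGenerator_le {lam : ℝ} (hlam : 0 ≤ lam) (hn : 2 ≤ n) (d : ℕ)
    {H : (Route n → ℕ) → ℝ} {b : Route n → ℝ} (hH : Local H b) {θ : ℝ} (hθ : 0 ≤ θ)
    (hb : ∀ r, θ * b r ≤ 1) (σ : ℝ) (ε : ℝ) (hε : ε ^ 2 = 1) (x : State n C)
    (hσ : ∑ r, (arr lam d x r + x.1 r) * b r ^ 2 ≤ σ) :
    ∑ y : State n C, generator n C lam d x y * Real.exp (θ * (ε * H y.1 - ε * H x.1)) ≤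
      θ * drift lam d (fun y => ε * H y.1) x + θ ^ 2 * σ := by
  -- Second-order bound `|exp y - 1 - y| ≤ y ^ 2` for `|y| ≤ 1`. The sign `ε = ±1` makes one
  -- estimate serve both tails.
  have hexp : ∀ z b : ℝ, |z| ≤ b → θ * b ≤ 1 →
      Real.exp (θ * (ε * z)) - 1 ≤ θ * (ε * z) + θ ^ 2 * b ^ 2 := by
    intro z b hz hb
    have h1 : |θ * (ε * z)| ≤ 1 := by
      have : |ε| = 1 :=
        (pow_eq_one_iff_of_nonneg (abs_nonneg ε) two_ne_zero).1 (by rw [sq_abs, hε])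
      rw [abs_mul, abs_mul, this, one_mul, abs_of_nonneg hθ]
      exact (mul_le_mul_of_nonneg_left hz hθ).trans hb
    have h2 := Real.abs_exp_sub_one_sub_id_le h1
    have h3 : (θ * (ε * z)) ^ 2 = θ ^ 2 * z ^ 2 := by
      calc (θ * (ε * z)) ^ 2 = θ ^ 2 * z ^ 2 * ε ^ 2 := by ring
        _ = _ := by rw [hε, mul_one]
    have h4 : z ^ 2 ≤ b ^ 2 := sq_le_sq' (by linarith [neg_le_of_abs_le hz]) (le_of_abs_le hz)
    have h5 := (abs_le.1 h2).2
    have h6 : θ ^ 2 * z ^ 2 ≤ θ ^ 2 * b ^ 2 := by gcongr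
    linarith
  rw [sum_generator_mul]
  have h1 := sum_rate_mul lam d x (fun y => Real.exp (θ * (ε * H y - ε * H x.1)))
  have h2 := drift_eq_gen lam d x (fun y => ε * H y)
  rw [h1, h2, gen]
  have h3 : θ ^ 2 * ∑ r, (arr lam d x r + x.1 r) * b r ^ 2 ≤ θ ^ 2 * σ := by gcongr
  refine le_trans ?_ (add_le_add_right h3 _)
  rw [mul_add, Finset.mul_sum, Finset.mul_sum, Finset.mul_sum, ← Finset.sum_add_distrib,
    ← Finset.sum_add_distrib, ← Finset.sum_add_distrib]
  refine Finset.sum_le_sum fun r _ => ?_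
  simp only [← mul_sub, sub_self, mul_zero, Real.exp_zero]
  have ha := mul_le_mul_of_nonneg_left (hexp _ _ (hH x.1 r) (hb r)) (arr_nonneg hlam hn d x r)
  have hx : (x.1 r : ℝ) * (Real.exp (θ * (ε * (H (x.1 - Pi.single r 1) - H x.1))) - 1) ≤
      (x.1 r : ℝ) * (θ * (ε * (H (x.1 - Pi.single r 1) - H x.1)) + θ ^ 2 * b r ^ 2) := by
    by_cases hr : x.1 r = 0
    · simp [hr]
    · exact mul_le_mul_of_nonneg_left (hexp _ _ (hH.sub hr) (hb r)) (Nat.cast_nonneg _)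
  linarith

/-- The indicator that the link `l` has load `k`. -/
def lind (k : ℕ) (l : Sym2 (Fin n)) (x : Route n → ℕ) : ℝ := if load x l = k then 1 else 0

/-- The number of links from `v` to nodes of `s` with load `k`. -/
def cntOn (s : Finset (Fin n)) (v : Fin n) (k : ℕ) (x : Route n → ℕ) : ℝ :=
  ∑ w ∈ s, lind k s(v, w) x

/-- The nodes other than `u` and `v`. -/
def others (u v : Fin n) : Finset (Fin n) := Finset.univ.filter fun w => w ≠ u ∧ w ≠ v

/-- The number of nodes `w` such that `{u, w}` has load `j` and `{v, w}` has load `k`. -/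
def pairCount (u v : Fin n) (j k : ℕ) (x : Route n → ℕ) : ℝ :=
  ∑ w ∈ others u v, lind j s(u, w) x * lind k s(v, w) x

/-- The number of calls with endpoints `e` that are routed via an intermediate node. -/
def altCalls (e : Link n) (x : Route n → ℕ) : ℝ := ∑ w : Mid e, (x ⟨e, some w⟩ : ℝ)

theorem lind_nonneg (k : ℕ) (l : Sym2 (Fin n)) (x : Route n → ℕ) : 0 ≤ lind k l x := by
  unfold lind; split_ifs <;> simp

theorem lind_le_one (k : ℕ) (l : Sym2 (Fin n)) (x : Route n → ℕ) : lind k l x ≤ 1 := by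
  unfold lind; split_ifs <;> simp

theorem abs_lind_le (k : ℕ) (l : Sym2 (Fin n)) (x : Route n → ℕ) : |lind k l x| ≤ 1 := by
  rw [abs_of_nonneg (lind_nonneg k l x)]; exact lind_le_one k l x

theorem local_lind (k : ℕ) (l : Sym2 (Fin n)) :
    Local (lind k l) (fun r => if l ∈ r.links then 1 else 0) := by
  intro x r
  unfold lind
  rw [load_add_single]
  split_ifs <;> simp_all

/-- The number of links at `v` used by the route `r`. -/
def deg (v : Fin n) (r : Route n) : ℝ :=
  ∑ w ∈ Finset.univ.erase v, if s(v, w) ∈ r.links then (1 : ℝ) else 0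

theorem deg_nonneg (v : Fin n) (r : Route n) : 0 ≤ deg v r :=
  Finset.sum_nonneg fun _ _ => by split_ifs <;> simp

theorem card_links_le (r : Route n) : r.links.card ≤ 2 := by
  obtain ⟨e, _ | w⟩ := r
  · simp [Route.links]
  · refine Finset.card_image_le.trans ?_
    have : (Finset.univ.filter fun u : Fin n => u ∈ e.1) = e.1.toFinset := by
      ext; simp
    rw [this, Sym2.card_toFinset_of_not_isDiag _ e.2]

theorem sum_mem_links_le (s : Finset (Fin n)) (v : Fin n) (r : Route n) :
    ∑ w ∈ s, (if s(v, w) ∈ r.links then (1 : ℝ) else 0) ≤ 2 := by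
  rw [Finset.sum_boole]
  have h1 : (s.filter fun w => s(v, w) ∈ r.links).card ≤ r.links.card :=
    Finset.card_le_card_of_injOn (fun w => s(v, w)) (fun w hw => (Finset.mem_filter.1 hw).2)
      (fun a _ b _ h => Sym2.congr_right.1 h)
  exact_mod_cast h1.trans (card_links_le r)

theorem deg_le (v : Fin n) (r : Route n) : deg v r ≤ 2 := sum_mem_links_le _ v r

theorem sum_mem_links_le_deg {s : Finset (Fin n)} {v : Fin n} (hv : v ∉ s) (r : Route n) :
    ∑ w ∈ s, (if s(v, w) ∈ r.links then (1 : ℝ) else 0) ≤ deg v r := by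
  refine Finset.sum_le_sum_of_subset_of_nonneg (fun w hw => ?_) fun _ _ _ => by
    split_ifs <;> simp
  refine Finset.mem_erase.2 ⟨?_, Finset.mem_univ _⟩
  rintro rfl
  exact hv hw

/-- Jumps touching `v` occur on its links, each with arrival rate at most `3 * lam * d` and
departure rate equal to its load. This bound, linear in `n`, on the quadratic variation is why
fluctuations have order √n. -/
theorem sum_mul_deg_le {lam : ℝ} (hlam : 0 ≤ lam) {d : ℕ} (hd : 1 ≤ d) (hn : 3 ≤ n)
    (x : State n C) (v : Fin n) :
    ∑ r, (arr lam d x r + x.1 r) * deg v r ≤ n * (3 * lam * d + C) := by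
  have h1 : ∑ r, (arr lam d x r + x.1 r) * deg v r =
      ∑ w ∈ Finset.univ.erase v, (linkArr lam d x s(v, w) + load x.1 s(v, w)) := by
    simp only [deg, Finset.mul_sum]
    rw [Finset.sum_comm]
    refine Finset.sum_congr rfl fun w _ => ?_
    rw [cast_load, linkArr, ← Finset.sum_add_distrib]
    exact Finset.sum_congr rfl fun r _ => by split_ifs <;> simp
  rw [h1]
  refine (Finset.sum_le_card_nsmul _ _ (3 * lam * d + C) fun w hw => ?_).trans ?_
  · have hw' : v ≠ w := (Finset.ne_of_mem_erase hw).symm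
    have := linkArr_le hlam hd hn x hw'
    have h2 : (load x.1 s(v, w) : ℝ) ≤ C := by exact_mod_cast load_le x hw'
    linarith
  · rw [nsmul_eq_mul]
    refine mul_le_mul_of_nonneg_right ?_ (by positivity)
    have : (Finset.univ.erase v).card ≤ n := (Finset.card_le_univ _).trans (by simp)
    exact_mod_cast this

theorem local_sum {ι : Type*} (s : Finset ι) {H : ι → (Route n → ℕ) → ℝ} {b : ι → Route n → ℝ}
    (h : ∀ i ∈ s, Local (H i) (b i)) :
    Local (fun x => ∑ i ∈ s, H i x) (fun r => ∑ i ∈ s, b i r) := by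
  intro x r
  rw [← Finset.sum_sub_distrib]
  exact (Finset.abs_sum_le_sum_abs _ _).trans (Finset.sum_le_sum fun i hi => h i hi x r)

theorem local_mul {H K : (Route n → ℕ) → ℝ} {b b' : Route n → ℝ} {A B : ℝ} (hH : Local H b)
    (hK : Local K b') (hA : ∀ x, |H x| ≤ A) (hB : ∀ x, |K x| ≤ B) :
    Local (fun x => H x * K x) (fun r => A * b' r + B * b r) := by
  intro x r
  have hA0 : 0 ≤ A := (abs_nonneg _).trans (hA x)
  have hB0 : 0 ≤ B := (abs_nonneg _).trans (hB x)
  refine (abs_mul_sub_mul_le (hA _) (hB _)).trans ?_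
  exact add_le_add (mul_le_mul_of_nonneg_left (hK x r) hA0)
    (mul_le_mul_of_nonneg_left (hH x r) hB0)

theorem local_cntOn (s : Finset (Fin n)) (v : Fin n) (k : ℕ) :
    Local (cntOn s v k) (fun r => ∑ w ∈ s, if s(v, w) ∈ r.links then (1 : ℝ) else 0) :=
  local_sum s fun w _ => local_lind k s(v, w)

theorem cntOn_nonneg (s : Finset (Fin n)) (v : Fin n) (k : ℕ) (x : Route n → ℕ) :
    0 ≤ cntOn s v k x := Finset.sum_nonneg fun _ _ => lind_nonneg _ _ _

theorem cntOn_le (s : Finset (Fin n)) (v : Fin n) (k : ℕ) (x : Route n → ℕ) :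
    cntOn s v k x ≤ s.card :=
  (Finset.sum_le_card_nsmul _ _ 1 fun _ _ => lind_le_one _ _ _).trans (by simp)

theorem left_notMem_others (u v : Fin n) : u ∉ others u v := by simp [others]

theorem right_notMem_others (u v : Fin n) : v ∉ others u v := by simp [others]

theorem local_pairCount (u v : Fin n) (j k : ℕ) :
    Local (pairCount u v j k) (fun r => deg u r + deg v r) := by
  refine (local_sum (others u v) fun w _ => local_mul (local_lind j s(u, w))
    (local_lind k s(v, w)) (abs_lind_le _ _) (abs_lind_le _ _)).mono fun r => ?_
  simp only [one_mul, Finset.sum_add_distrib]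
  have h1 := sum_mem_links_le_deg (left_notMem_others u v) r
  have h2 := sum_mem_links_le_deg (right_notMem_others u v) r
  linarith

/-- The centred pair counts, `n - 2` times the quantities in `phi1`. -/
def pairDev (u v : Fin n) (j k : ℕ) (x : Route n → ℕ) : ℝ :=
  pairCount u v j k x -
    ((n : ℝ) - 2)⁻¹ * (cntOn (others u v) u j x * cntOn (others u v) v k x)

theorem abs_cntOn_others_le (hn : 2 ≤ n) {u v : Fin n} (huv : u ≠ v) (w : Fin n) (k : ℕ)
    (x : Route n → ℕ) : |cntOn (others u v) w k x| ≤ (n : ℝ) - 2 := by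
  rw [abs_of_nonneg (cntOn_nonneg _ _ _ _)]
  exact (cntOn_le _ _ _ _).trans_eq (card_ne_ne hn huv)

/-- Changing one link moves the product of the two counts by at most `n - 2`, which the prefactor
cancels; this part therefore costs as much as the pair count itself, whence the 2. -/
theorem local_pairDev (hn : 3 ≤ n) {u v : Fin n} (huv : u ≠ v) (j k : ℕ) :
    Local (pairDev u v j k) (fun r => 2 * (deg u r + deg v r)) := by
  intro x r
  have h2 := two_lt_cast hn
  have h3 := local_pairCount u v j k x r
  have h4 := local_mul
    ((local_cntOn (others u v) u j).mono (sum_mem_links_le_deg (left_notMem_others u v)))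
    ((local_cntOn (others u v) v k).mono (sum_mem_links_le_deg (right_notMem_others u v)))
    (abs_cntOn_others_le (by omega) huv u j) (abs_cntOn_others_le (by omega) huv v k) x r
  have h5 : pairDev u v j k (x + Pi.single r 1) - pairDev u v j k x =
      (pairCount u v j k (x + Pi.single r 1) - pairCount u v j k x) -
      ((n : ℝ) - 2)⁻¹ * (cntOn (others u v) u j (x + Pi.single r 1) *
        cntOn (others u v) v k (x + Pi.single r 1)
        - cntOn (others u v) u j x * cntOn (others u v) v k x) := by
    unfold pairDev; ring
  rw [h5]
  refine (abs_sub _ _).trans ?_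
  rw [abs_mul, abs_of_pos (inv_pos.2 h2)]
  have h6 := mul_le_mul_of_nonneg_left h4 (inv_pos.2 h2).le
  beta_reduce at h3 h6 ⊢
  rw [← mul_add, inv_mul_cancel_left₀ h2.ne'] at h6
  linarith

/-- An arrival on a counted path uses a link at `u`; an arrival on any other route leaves the sum
unchanged. -/
theorem local_altCalls (u v : Fin n) (huv : u ≠ v) :
    Local (altCalls ⟨s(u, v), by simpa using huv⟩) (deg u) := by
  classical
  intro x r
  unfold altCalls
  rw [← Finset.sum_sub_distrib]
  simp only [Pi.add_apply, Nat.cast_add, add_sub_cancel_left]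
  obtain ⟨e, _ | w⟩ := r
  · have : ∀ z : Mid (⟨s(u, v), by simpa using huv⟩ : Link n),
        (Pi.single (M := fun _ : Route n => ℕ) (⟨e, none⟩ : Route n) 1
          (⟨⟨s(u, v), by simpa using huv⟩, some z⟩ : Route n)) = 0 := by
      intro z
      refine Pi.single_eq_of_ne ?_ _
      intro h
      obtain ⟨h1, h2⟩ := Sigma.mk.inj h
      subst h1
      simp at h2
    simp only [this]
    simpa using deg_nonneg u _
  · by_cases he : e = ⟨s(u, v), by simpa using huv⟩
    · subst he
      have h1 : ∀ z : Mid (⟨s(u, v), by simpa using huv⟩ : Link n),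
          (Pi.single (M := fun _ : Route n => ℕ)
            (⟨⟨s(u, v), by simpa using huv⟩, some w⟩ : Route n) 1
          (⟨⟨s(u, v), by simpa using huv⟩, some z⟩ : Route n)) = if z = w then 1 else 0 := by
        intro z
        rw [Pi.single_apply]
        simp
      simp only [h1, Nat.cast_ite, Nat.cast_one, Nat.cast_zero, Finset.sum_ite_eq',
        Finset.mem_univ, if_true, abs_one]
      have hw : w.1 ≠ u := by
        rintro h
        exact w.2 (by rw [h]; simp)
      have h2 : s(u, w.1) ∈ Route.links ⟨⟨s(u, v), by simpa using huv⟩, some w⟩ :=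
        mem_links_some.2 (Or.inl ⟨by simp, rfl⟩)
      unfold deg
      have := Finset.single_le_sum (f := fun z => if s(u, z) ∈
        Route.links ⟨⟨s(u, v), by simpa using huv⟩, some w⟩ then (1 : ℝ) else 0)
        (fun z _ => by split_ifs <;> simp)
        (Finset.mem_erase.2 ⟨hw, Finset.mem_univ _⟩)
      simpa only [h2, if_true] using this
    · have : ∀ z : Mid (⟨s(u, v), by simpa using huv⟩ : Link n),
          (Pi.single (M := fun _ : Route n => ℕ) (⟨e, some w⟩ : Route n) 1
          (⟨⟨s(u, v), by simpa using huv⟩, some z⟩ : Route n)) = 0 := by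
        intro z
        refine Pi.single_eq_of_ne ?_ _
        intro h
        exact he (Sigma.mk.inj h).1.symm
      simp only [this]
      simpa using deg_nonneg u _

end Observables

/-! ### The birth-and-death flow -/

section Flow

/-- The birth-and-death flow with birth rates `c` and death rates `k`. -/
def flow (c p : ℕ → ℝ) (k : ℕ) : ℝ :=
  (if k = 0 then 0 else c (k - 1) * p (k - 1)) - c k * p k + ((k + 1) * p (k + 1) - k * p k)

theorem flow_sum {ι : Type*} (s : Finset ι) (c : ℕ → ℝ) (p : ι → ℕ → ℝ) (k : ℕ) :
    flow c (fun k => ∑ i ∈ s, p i k) k = ∑ i ∈ s, flow c (p i) k := by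
  unfold flow
  simp only [Finset.sum_add_distrib, Finset.sum_sub_distrib, Finset.mul_sum]
  congr 2
  by_cases h : k = 0 <;> simp [h]

theorem flow_const_mul (c p : ℕ → ℝ) (a : ℝ) (k : ℕ) :
    flow c (fun k => a * p k) k = a * flow c p k := by
  unfold flow
  by_cases h : k = 0
  · simp only [h, if_true]; ring
  · simp only [h, if_false]; ring

theorem flow_mul_const (c p : ℕ → ℝ) (a : ℝ) (k : ℕ) :
    flow c (fun k => p k * a) k = a * flow c p k := by
  simp only [mul_comm _ a, flow_const_mul]

theorem flow_sub (c p p' : ℕ → ℝ) (k : ℕ) :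
    flow c (fun k => p k - p' k) k = flow c p k - flow c p' k := by
  unfold flow
  by_cases h : k = 0
  · simp only [h, if_true]; ring
  · simp only [h, if_false]; ring

theorem flow_sub_rate (c c' p : ℕ → ℝ) (k : ℕ) :
    flow c p k - flow c' p k =
      (if k = 0 then 0 else (c (k - 1) - c' (k - 1)) * p (k - 1)) - (c k - c' k) * p k := by
  unfold flow
  by_cases h : k = 0
  · simp only [h, if_true]; ring
  · simp only [h, if_false]; ring

/-- Vanishing at `C + 1` removes the inflow into level `C` from above, so both death terms have
coefficient at most `C`. -/
theorem abs_flow_le {C : ℕ} {c p : ℕ → ℝ} {a M : ℝ} (ha : ∀ k, |c k| ≤ a) (hM : ∀ k, |p k| ≤ M)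
    (hp : p (C + 1) = 0) {k : ℕ} (hk : k ≤ C) : |flow c p k| ≤ (2 * a + 2 * C) * M := by
  have hM0 : 0 ≤ M := (abs_nonneg _).trans (hM 0)
  have ha0 : 0 ≤ a := (abs_nonneg _).trans (ha 0)
  have h1 : ∀ i j, |c i * p j| ≤ a * M := fun i j => by
    rw [abs_mul]; exact mul_le_mul (ha i) (hM j) (abs_nonneg _) ha0
  have h2 : |if k = 0 then 0 else c (k - 1) * p (k - 1)| ≤ a * M := by
    split_ifs
    · simpa using mul_nonneg ha0 hM0
    · exact h1 _ _
  have h3 : |((k : ℝ) + 1) * p (k + 1)| ≤ C * M := by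
    rcases hk.eq_or_lt with rfl | hlt
    · rw [hp, mul_zero, abs_zero]; positivity
    · rw [abs_mul, abs_of_nonneg (by positivity)]
      have : (k : ℝ) + 1 ≤ C := by exact_mod_cast hlt
      exact mul_le_mul this (hM _) (abs_nonneg _) (by positivity)
  have h4 : |(k : ℝ) * p k| ≤ C * M := by
    rw [abs_mul, Nat.abs_cast]
    have : (k : ℝ) ≤ C := by exact_mod_cast hk
    exact mul_le_mul this (hM _) (abs_nonneg _) (by positivity)
  unfold flow
  refine (abs_add_le _ _).trans ?_
  have h5 := abs_sub (if k = 0 then 0 else c (k - 1) * p (k - 1)) (c k * p k)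
  have h6 := abs_sub (((k : ℝ) + 1) * p (k + 1)) (k * p k)
  have := h1 k k
  linarith

end Flow

/-! ### The vector field on the simplex as a flow -/

section Rates

variable {C : ℕ}

/-- `gain d ξ k` is `g_k(ξ) / ξ(k)`. -/
def gain (d : ℕ) (ξ : Fin (C + 1) → ℝ) (k : ℕ) : ℝ :=
  2 * coord ξ C * ∑ i ∈ Finset.range C, coord ξ i * choiceSum d ξ (max k i)

/-- The arrival rate on a link of load `k` when the loads are distributed according to `ξ`. -/
def rates (lam : ℝ) (d : ℕ) (ξ : Fin (C + 1) → ℝ) (k : ℕ) : ℝ :=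
  if k < C then lam * (1 + gain d ξ k) else 0

theorem choiceSum_eq (d : ℕ) (ξ : Fin (C + 1) → ℝ) (i : ℕ) :
    choiceSum d ξ i = geomMix d (1 - cum ξ (i + 1) ^ 2) (1 - cum ξ i ^ 2) := rfl

/-- A path whose links have loads `k` and `i` has larger load `max k i`. The term with ξ(≤ k)
collects the `i ≤ k`, the other sum the `i > k`. -/
theorem g_eq (d : ℕ) (ξ : Fin (C + 1) → ℝ) {k : ℕ} (hk : k < C) :
    g d k ξ = coord ξ k * gain d ξ k := by
  unfold g gain
  have h : ∑ i ∈ Finset.range C, coord ξ i * choiceSum d ξ (max k i) =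
      cum ξ (k + 1) * choiceSum d ξ k +
        ∑ i ∈ Finset.Icc (k + 1) (C - 1), coord ξ i * choiceSum d ξ i := by
    rw [← Finset.sum_range_add_sum_Ico _ (show k + 1 ≤ C from hk)]
    congr 1
    · rw [cum, Finset.sum_mul]
      refine Finset.sum_congr rfl fun i hi => ?_
      rw [max_eq_left (by have := Finset.mem_range.1 hi; omega)]
    · rw [show Finset.Icc (k + 1) (C - 1) = Finset.Ico (k + 1) C by ext i; simp; omega]
      refine Finset.sum_congr rfl fun i hi => ?_
      rw [max_eq_right (by have := (Finset.mem_Ico.1 hi).1; omega)]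
  rw [h]
  ring

theorem coord_of_lt (ξ : Fin (C + 1) → ℝ) {k : ℕ} (h : C < k) : coord ξ k = 0 :=
  dif_neg (by omega)

/-- One formula absorbs the boundary cases: `rates` vanishes at `C`, stopping births there, and
`coord` vanishes beyond `C`, stopping deaths from above. -/
theorem F_eq_flow (hC : 1 ≤ C) (lam : ℝ) (d : ℕ) (ξ : Fin (C + 1) → ℝ) (k : Fin (C + 1)) :
    F lam d ξ k = flow (rates lam d ξ) (coord ξ) k := by
  have hk : (k : ℕ) ≤ C := Nat.lt_succ_iff.1 k.2
  unfold F flow rates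
  by_cases h0 : (k : ℕ) = 0
  · simp only [h0, if_true, show 0 < C from hC, g_eq d ξ (show 0 < C from hC)]
    simp
    ring
  · by_cases h1 : (k : ℕ) < C
    · simp only [h0, h1, if_true, if_false, show (k : ℕ) - 1 < C by omega, g_eq d ξ h1,
        g_eq d ξ (show (k : ℕ) - 1 < C by omega)]
      ring
    · have h2 : (k : ℕ) = C := by omega
      simp only [show ¬ C = 0 by omega, if_false, h2, show C - 1 < C by omega, if_true,
        g_eq d ξ (show C - 1 < C by omega), coord_of_lt ξ (Nat.lt_succ_self C), lt_irrefl]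
      ring

/-- The probability simplex of load profiles. -/
def IsProfile (ξ : Fin (C + 1) → ℝ) : Prop := (∀ k, 0 ≤ ξ k) ∧ ∑ k, ξ k = 1

theorem coord_nonneg {ξ : Fin (C + 1) → ℝ} (h : ∀ k, 0 ≤ ξ k) (k : ℕ) : 0 ≤ coord ξ k := by
  unfold coord
  split_ifs
  · exact h _
  · exact le_rfl

theorem sum_coord (ξ : Fin (C + 1) → ℝ) : ∑ k ∈ Finset.range (C + 1), coord ξ k = ∑ k, ξ k := by
  rw [← Fin.sum_univ_eq_sum_range]
  exact Finset.sum_congr rfl fun k _ => dif_pos k.2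

theorem cum_nonneg {ξ : Fin (C + 1) → ℝ} (h : ∀ k, 0 ≤ ξ k) (i : ℕ) : 0 ≤ cum ξ i :=
  Finset.sum_nonneg fun _ _ => coord_nonneg h _

theorem cum_le_one {ξ : Fin (C + 1) → ℝ} (h : IsProfile ξ) (i : ℕ) : cum ξ i ≤ 1 := by
  rw [← h.2, ← sum_coord]
  rcases le_total i (C + 1) with hi | hi
  · exact Finset.sum_le_sum_of_subset_of_nonneg (Finset.range_mono hi)
      fun k _ _ => coord_nonneg h.1 k
  · refine le_of_eq (Finset.sum_subset (Finset.range_mono hi) fun k _ hk => ?_).symm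
    exact coord_of_lt ξ (by simpa using hk)

theorem coord_le_one {ξ : Fin (C + 1) → ℝ} (h : IsProfile ξ) (k : ℕ) : coord ξ k ≤ 1 := by
  have h1 := cum_le_one h (k + 1)
  rw [cum, Finset.sum_range_succ] at h1
  have := Finset.sum_nonneg fun i (_ : i ∈ Finset.range k) => coord_nonneg h.1 i
  linarith

theorem one_sub_cum_mem {ξ : Fin (C + 1) → ℝ} (h : IsProfile ξ) (i : ℕ) :
    0 ≤ 1 - cum ξ i ^ 2 ∧ 1 - cum ξ i ^ 2 ≤ 1 := by
  have h1 := cum_le_one h i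
  have h2 := cum_nonneg h.1 i
  exact ⟨by nlinarith, by nlinarith⟩

theorem choiceSum_nonneg {ξ : Fin (C + 1) → ℝ} (h : IsProfile ξ) (d i : ℕ) :
    0 ≤ choiceSum d ξ i :=
  geomMix_nonneg d (one_sub_cum_mem h _).1 (one_sub_cum_mem h _).1

theorem choiceSum_le {ξ : Fin (C + 1) → ℝ} (h : IsProfile ξ) (d i : ℕ) : choiceSum d ξ i ≤ d :=
  geomMix_le d (one_sub_cum_mem h _).1 (one_sub_cum_mem h _).2 (one_sub_cum_mem h _).1
    (one_sub_cum_mem h _).2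

theorem gain_nonneg {ξ : Fin (C + 1) → ℝ} (h : IsProfile ξ) (d k : ℕ) : 0 ≤ gain d ξ k :=
  mul_nonneg (mul_nonneg two_pos.le (coord_nonneg h.1 _)) (Finset.sum_nonneg fun _ _ =>
    mul_nonneg (coord_nonneg h.1 _) (choiceSum_nonneg h _ _))

theorem sum_coord_mul_le {ξ : Fin (C + 1) → ℝ} (h : IsProfile ξ) {f : ℕ → ℝ} {a : ℝ}
    (ha : 0 ≤ a) (hf : ∀ i < C, f i ≤ a) : ∑ i ∈ Finset.range C, coord ξ i * f i ≤ a := by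
  calc ∑ i ∈ Finset.range C, coord ξ i * f i ≤ ∑ i ∈ Finset.range C, coord ξ i * a :=
        Finset.sum_le_sum fun i hi => mul_le_mul_of_nonneg_left (hf i (Finset.mem_range.1 hi))
          (coord_nonneg h.1 i)
    _ = cum ξ C * a := by rw [cum, Finset.sum_mul]
    _ ≤ a := mul_le_of_le_one_left ha (cum_le_one h C)

theorem gain_le {ξ : Fin (C + 1) → ℝ} (h : IsProfile ξ) (d k : ℕ) : gain d ξ k ≤ 2 * d := by
  have h1 : ∑ i ∈ Finset.range C, coord ξ i * choiceSum d ξ (max k i) ≤ d :=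
    sum_coord_mul_le h (Nat.cast_nonneg d) fun i _ => choiceSum_le h d _
  have h2 := coord_le_one h C
  have h3 := coord_nonneg h.1 C
  have h4 : 0 ≤ ∑ i ∈ Finset.range C, coord ξ i * choiceSum d ξ (max k i) :=
    Finset.sum_nonneg fun _ _ => mul_nonneg (coord_nonneg h.1 _) (choiceSum_nonneg h _ _)
  unfold gain
  nlinarith

theorem rates_nonneg {lam : ℝ} (hlam : 0 ≤ lam) {ξ : Fin (C + 1) → ℝ} (h : IsProfile ξ)
    (d k : ℕ) : 0 ≤ rates lam d ξ k := by
  have := gain_nonneg h d k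
  unfold rates
  split_ifs <;> positivity

theorem abs_rates_le {lam : ℝ} (hlam : 0 ≤ lam) {d : ℕ} (hd : 1 ≤ d) {ξ : Fin (C + 1) → ℝ}
    (h : IsProfile ξ) (k : ℕ) : |rates lam d ξ k| ≤ 3 * lam * d := by
  have hd' : (1 : ℝ) ≤ d := by exact_mod_cast hd
  rw [abs_of_nonneg (rates_nonneg hlam h d k)]
  have := gain_le h d k
  unfold rates
  split_ifs
  · nlinarith
  · positivity

theorem abs_cum_sub_le {ξ ζ : Fin (C + 1) → ℝ} {Δ : ℝ} (hΔ : ∀ k, |coord ξ k - coord ζ k| ≤ Δ)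
    (i : ℕ) : |cum ξ i - cum ζ i| ≤ i * Δ := by
  unfold cum
  rw [← Finset.sum_sub_distrib]
  exact (Finset.abs_sum_le_sum_abs _ _).trans
    ((Finset.sum_le_card_nsmul _ _ Δ fun k _ => hΔ k).trans (by simp))

/-- A cumulative mass moves by at most `C * Δ`, squaring numbers in `[0, 1]` doubles this, and the
geometric sum contributes `d ^ 2`. -/
theorem abs_choiceSum_sub_le {ξ ζ : Fin (C + 1) → ℝ} (hξ : IsProfile ξ) (hζ : IsProfile ζ) {Δ : ℝ}
    (hΔ : ∀ k, |coord ξ k - coord ζ k| ≤ Δ) (d : ℕ) {i : ℕ} (hi : i < C) :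
    |choiceSum d ξ i - choiceSum d ζ i| ≤ (d : ℝ) ^ 2 * (2 * C * Δ) := by
  have hΔ0 : 0 ≤ Δ := (abs_nonneg _).trans (hΔ 0)
  have h : ∀ j ≤ C, |(1 - cum ξ j ^ 2) - (1 - cum ζ j ^ 2)| ≤ 2 * C * Δ := by
    intro j hj
    have h1 := abs_cum_sub_le hΔ j
    have h2 : (1 - cum ξ j ^ 2) - (1 - cum ζ j ^ 2) = -((cum ξ j + cum ζ j) * (cum ξ j - cum ζ j)) := by
      ring
    have hj' : (j : ℝ) ≤ C := by exact_mod_cast hj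
    rw [h2, abs_neg, abs_mul, abs_of_nonneg (add_nonneg (cum_nonneg hξ.1 j) (cum_nonneg hζ.1 j)),
      mul_assoc]
    refine mul_le_mul ?_ (h1.trans (by gcongr)) (abs_nonneg _) two_pos.le
    linarith [cum_le_one hξ j, cum_le_one hζ j]
  exact abs_geomMix_sub_le d (one_sub_cum_mem hξ _).1 (one_sub_cum_mem hξ _).2
    (one_sub_cum_mem hξ _).1 (one_sub_cum_mem hξ _).2 (one_sub_cum_mem hζ _).1
    (one_sub_cum_mem hζ _).2 (one_sub_cum_mem hζ _).1 (one_sub_cum_mem hζ _).2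
    (h _ hi) (h _ hi.le)

theorem abs_gain_sub_le {ξ ζ : Fin (C + 1) → ℝ} (hξ : IsProfile ξ) (hζ : IsProfile ζ) {Δ : ℝ}
    (hΔ : ∀ k, |coord ξ k - coord ζ k| ≤ Δ) {d : ℕ} (hd : 1 ≤ d) {k : ℕ} (hk : k < C) :
    |gain d ξ k - gain d ζ k| ≤ 8 * C * (d : ℝ) ^ 2 * Δ := by
  have hd' : (1 : ℝ) ≤ d := by exact_mod_cast hd
  have hΔ0 : 0 ≤ Δ := (abs_nonneg _).trans (hΔ 0)
  have h1 : |∑ i ∈ Finset.range C, coord ξ i * choiceSum d ξ (max k i)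
      - ∑ i ∈ Finset.range C, coord ζ i * choiceSum d ζ (max k i)| ≤
      (d : ℝ) ^ 2 * (2 * C * Δ) + C * (d * Δ) := by
    rw [← Finset.sum_sub_distrib]
    refine (Finset.abs_sum_le_sum_abs _ _).trans ?_
    have h2 : ∀ i ∈ Finset.range C, |coord ξ i * choiceSum d ξ (max k i) -
        coord ζ i * choiceSum d ζ (max k i)| ≤
        coord ξ i * ((d : ℝ) ^ 2 * (2 * C * Δ)) + d * Δ := by
      intro i hi
      have hi' := Finset.mem_range.1 hi
      refine (abs_mul_sub_mul_le (A := coord ξ i) (B := d)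
        (abs_of_nonneg (coord_nonneg hξ.1 i)).le ?_).trans ?_
      · rw [abs_of_nonneg (choiceSum_nonneg hζ _ _)]
        exact choiceSum_le hζ _ _
      · refine add_le_add (mul_le_mul_of_nonneg_left ?_ (coord_nonneg hξ.1 i))
          (mul_le_mul_of_nonneg_left (hΔ i) (by positivity))
        exact abs_choiceSum_sub_le hξ hζ hΔ d (max_lt hk hi')
    refine (Finset.sum_le_sum h2).trans ?_
    rw [Finset.sum_add_distrib, Finset.sum_const, Finset.card_range, nsmul_eq_mul]
    exact add_le_add (sum_coord_mul_le hξ (by positivity) fun _ _ => le_rfl) le_rfl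
  have h3 : |∑ i ∈ Finset.range C, coord ζ i * choiceSum d ζ (max k i)| ≤ d := by
    rw [abs_of_nonneg (Finset.sum_nonneg fun _ _ =>
      mul_nonneg (coord_nonneg hζ.1 _) (choiceSum_nonneg hζ _ _))]
    exact sum_coord_mul_le hζ (Nat.cast_nonneg d) fun i _ => choiceSum_le hζ d _
  have h4 : |coord ξ C| ≤ 1 := by
    rw [abs_of_nonneg (coord_nonneg hξ.1 C)]; exact coord_le_one hξ C
  have h5 := abs_mul_sub_mul_le (A := 1) (B := d) (b := ∑ i ∈ Finset.range C, coord ξ i *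
    choiceSum d ξ (max k i)) (a' := coord ζ C) h4 h3
  have h6 := hΔ C
  have hC' : (1 : ℝ) ≤ C := by exact_mod_cast (by omega : 1 ≤ C)
  unfold gain
  rw [mul_assoc, mul_assoc, ← mul_sub, abs_mul, abs_two]
  have h7 : (d : ℝ) * |coord ξ C - coord ζ C| ≤ d * Δ := by gcongr
  have h8 : (d : ℝ) * Δ ≤ C * ((d : ℝ) ^ 2 * Δ) := by
    have : (d : ℝ) * 1 ≤ C * (d : ℝ) ^ 2 := by nlinarith
    nlinarith
  have h9 : C * ((d : ℝ) * Δ) ≤ C * ((d : ℝ) ^ 2 * Δ) := by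
    have : (d : ℝ) ≤ (d : ℝ) ^ 2 := by nlinarith
    gcongr
  nlinarith

/-- The vector field `F` is Lipschitz on the simplex, for the supremum norm. -/
theorem abs_F_sub_le (hC : 1 ≤ C) {lam : ℝ} (hlam : 0 ≤ lam) {d : ℕ} (hd : 1 ≤ d)
    {ξ ζ : Fin (C + 1) → ℝ} (hξ : IsProfile ξ) (hζ : IsProfile ζ) {Δ : ℝ}
    (hΔ : ∀ k, |ξ k - ζ k| ≤ Δ) (k : Fin (C + 1)) :
    |F lam d ξ k - F lam d ζ k| ≤
      (6 * lam * d + 2 * C + 16 * lam * C * (d : ℝ) ^ 2) * Δ := by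
  have hΔ0 : 0 ≤ Δ := (abs_nonneg _).trans (hΔ 0)
  have hΔ' : ∀ k, |coord ξ k - coord ζ k| ≤ Δ := by
    intro k
    unfold coord
    split_ifs
    · exact hΔ _
    · simpa using hΔ0
  have hk : (k : ℕ) ≤ C := Nat.lt_succ_iff.1 k.2
  have hrate : ∀ j, |rates lam d ξ j - rates lam d ζ j| ≤ 8 * lam * C * (d : ℝ) ^ 2 * Δ := by
    intro j
    unfold rates
    split_ifs with hj
    · have := abs_gain_sub_le hξ hζ hΔ' hd hj
      rw [show lam * (1 + gain d ξ j) - lam * (1 + gain d ζ j) =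
        lam * (gain d ξ j - gain d ζ j) by ring, abs_mul, abs_of_nonneg hlam]
      calc _ ≤ lam * (8 * C * (d : ℝ) ^ 2 * Δ) := by gcongr
        _ = _ := by ring
    · simp only [sub_self, abs_zero]; positivity
  rw [F_eq_flow hC, F_eq_flow hC]
  -- Split into a change of distribution at fixed rates and a change of rates at fixed distribution.
  have h1 : flow (rates lam d ξ) (coord ξ) k - flow (rates lam d ζ) (coord ζ) k =
      flow (rates lam d ξ) (fun k => coord ξ k - coord ζ k) k +
      (flow (rates lam d ξ) (coord ζ) k - flow (rates lam d ζ) (coord ζ) k) := by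
    rw [flow_sub]; ring
  have h2 := abs_flow_le (C := C) (abs_rates_le hlam hd hξ) hΔ'
    (by simp [coord_of_lt]) hk
  have h3 : ∀ j, |(rates lam d ξ j - rates lam d ζ j) * coord ζ j| ≤
      8 * lam * C * (d : ℝ) ^ 2 * Δ := by
    intro j
    rw [abs_mul, abs_of_nonneg (coord_nonneg hζ.1 j)]
    exact (mul_le_of_le_one_right (abs_nonneg _) (coord_le_one hζ j)).trans (hrate j)
  rw [h1]
  refine (abs_add_le _ _).trans ?_
  rw [flow_sub_rate]
  have h4 := abs_sub (if (k : ℕ) = 0 then 0 else (rates lam d ξ (k - 1) - rates lam d ζ (k - 1)) *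
    coord ζ (k - 1)) ((rates lam d ξ k - rates lam d ζ k) * coord ζ k)
  have h5 : |if (k : ℕ) = 0 then 0 else (rates lam d ξ (k - 1) - rates lam d ζ (k - 1)) *
    coord ζ (k - 1)| ≤ 8 * lam * C * (d : ℝ) ^ 2 * Δ := by
    split_ifs
    · rw [abs_zero]; positivity
    · exact h3 _
  have h6 := h3 k
  linarith

end Rates

/-! ### Link arrival rates predicted by a profile -/

section Approx

variable {n C : ℕ}

theorem sum_mid {u v : Fin n} (h : u ≠ v) (f : Fin n → ℝ) :
    ∑ z : Mid (⟨s(u, v), by simpa using h⟩ : Link n), f z.1 = ∑ w ∈ others u v, f w := by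
  refine (Finset.sum_subtype (others u v) (p := fun w => w ∉ s(u, v)) (fun w => ?_) f).symm
  simp [others]

theorem mem_others {u v w : Fin n} : w ∈ others u v ↔ w ≠ u ∧ w ≠ v := by simp [others]

/-- The larger load is below `i` exactly when both loads are, so `below` is a sum of pair counts
over a square of load pairs. If pair counts factorise, it becomes `cum q i ^ 2`. -/
theorem below_eq (x : State n C) {u v : Fin n} (h : u ≠ v) (i : ℕ) :
    below x ⟨s(u, v), by simpa using h⟩ i =
      (∑ j ∈ Finset.range i, ∑ k ∈ Finset.range i, pairCount u v j k x.1) / ((n : ℝ) - 2) := by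
  unfold below
  congr 1
  rw [Finset.card_filter]
  push_cast
  have h1 : ∀ z : Mid (⟨s(u, v), by simpa using h⟩ : Link n),
      (if pathLoad x ⟨s(u, v), by simpa using h⟩ z < i then (1 : ℝ) else 0) =
      if max (load x.1 s(u, z.1)) (load x.1 s(v, z.1)) < i then 1 else 0 := by
    rintro ⟨z, hz⟩
    have hz' : z ≠ u ∧ z ≠ v := by simpa using hz
    rw [pathLoad_mk x ⟨h, hz'⟩]
  rw [Finset.sum_congr rfl fun z _ => h1 z,
    sum_mid h (fun w => if max (load x.1 s(u, w)) (load x.1 s(v, w)) < i then (1 : ℝ) else 0)]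
  simp only [pairCount]
  rw [Finset.sum_congr rfl fun j _ => Finset.sum_comm, Finset.sum_comm]
  refine Finset.sum_congr rfl fun w _ => ?_
  simp only [← Finset.mul_sum, ← Finset.sum_mul, lind, Finset.sum_ite_eq, Finset.mem_range,
    max_lt_iff]
  by_cases h1 : load x.1 s(u, w) < i <;> by_cases h2 : load x.1 s(v, w) < i <;> simp [h1, h2]

/-- At `x`, all pair counts are within `(n - 2) η` of what the profile `q` predicts. -/
def PairApprox (x : State n C) (q : Fin (C + 1) → ℝ) (η : ℝ) : Prop :=
  ∀ u v, u ≠ v → ∀ j ≤ C, ∀ k ≤ C,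
    |pairCount u v j k x.1 / ((n : ℝ) - 2) - coord q j * coord q k| ≤ η

theorem abs_below_sub_le {x : State n C} {q : Fin (C + 1) → ℝ} {η : ℝ} (hη : 0 ≤ η)
    (h : PairApprox x q η) {u v : Fin n} (huv : u ≠ v) {i : ℕ} (hi : i ≤ C) :
    |below x ⟨s(u, v), by simpa using huv⟩ i - cum q i ^ 2| ≤ (C : ℝ) ^ 2 * η := by
  rw [below_eq x huv, cum, sq, Finset.sum_mul_sum, Finset.sum_div, ← Finset.sum_sub_distrib]
  have hi' : (i : ℝ) ≤ C := by exact_mod_cast hi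
  refine (Finset.abs_sum_le_sum_abs _ _).trans ?_
  refine (Finset.sum_le_card_nsmul _ _ (i * η) fun j hj => ?_).trans ?_
  · rw [Finset.sum_div, ← Finset.sum_sub_distrib]
    refine (Finset.abs_sum_le_sum_abs _ _).trans ?_
    refine (Finset.sum_le_card_nsmul _ _ η fun k hk => ?_).trans (by simp)
    exact h u v huv j (by have := Finset.mem_range.1 hj; omega) k
      (by have := Finset.mem_range.1 hk; omega)
  · rw [Finset.card_range, nsmul_eq_mul, ← mul_assoc, ← sq]
    gcongr

theorem abs_localChoice_sub_le (hn : 3 ≤ n) {x : State n C} {q : Fin (C + 1) → ℝ} {η : ℝ}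
    (hη : 0 ≤ η) (hq : IsProfile q) (h : PairApprox x q η) (d : ℕ) {u v : Fin n} (huv : u ≠ v)
    {i : ℕ} (hi : i < C) :
    |localChoice d x ⟨s(u, v), by simpa using huv⟩ i - choiceSum d q i| ≤
      (d : ℝ) ^ 2 * ((C : ℝ) ^ 2 * η) := by
  rw [localChoice_eq, choiceSum_eq]
  have hb : ∀ j ≤ C, |(1 - below x ⟨s(u, v), by simpa using huv⟩ j) - (1 - cum q j ^ 2)| ≤
      (C : ℝ) ^ 2 * η := by
    intro j hj
    have := abs_below_sub_le hη h huv hj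
    rwa [sub_sub_sub_cancel_left, abs_sub_comm]
  have hb1 : ∀ j, 1 - below x ⟨s(u, v), by simpa using huv⟩ j ≤ 1 := fun j => by
    linarith [below_nonneg hn x ⟨s(u, v), by simpa using huv⟩ j]
  exact abs_geomMix_sub_le d (one_sub_below_nonneg hn _ _ _) (hb1 _)
    (one_sub_below_nonneg hn _ _ _) (hb1 _) (one_sub_cum_mem hq _).1 (one_sub_cum_mem hq _).2
    (one_sub_cum_mem hq _).1 (one_sub_cum_mem hq _).2 (hb _ hi) (hb _ hi.le)

theorem sum_alt_eq_others (T : Route n → ℝ) {u w : Fin n} :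
    ∑ y, alt T u y w = ∑ y ∈ others u w, alt T u y w := by
  refine (Finset.sum_subset (Finset.subset_univ _) fun y _ hy => ?_).symm
  unfold alt
  rw [dif_neg]
  rw [mem_others] at hy
  tauto

/-- The rate of arrivals on `{u, w}` of calls with endpoint `u` that are routed through `w`. -/
theorem abs_sum_alt_arr_sub_le {lam : ℝ} (hlam : 0 ≤ lam) (hn : 3 ≤ n) {x : State n C}
    {q : Fin (C + 1) → ℝ} {η : ℝ} (hη : 0 ≤ η) (hq : IsProfile q) (h : PairApprox x q η)
    {d : ℕ} {u w : Fin n} (huw : u ≠ w) (hk : load x.1 s(u, w) < C) :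
    |∑ y, alt (arr lam d x) u y w -
      lam * (coord q C * ∑ i ∈ Finset.range C, coord q i *
        choiceSum d q (max (load x.1 s(u, w)) i))| ≤
      lam * ((d : ℝ) ^ 2 * ((C : ℝ) ^ 2 * η) + C * (d * η)) := by
  have h2 := two_lt_cast hn
  set k := load x.1 s(u, w) with hkdef
  have hcs : ∀ i < C, choiceSum d q (max k i) ≤ d := fun i _ => choiceSum_le hq d _
  -- replace the local choice probabilities by those of `q`
  have h1 : |∑ y, alt (arr lam d x) u y w - ∑ y ∈ others u w, lam / ((n : ℝ) - 2) *
      ∑ i ∈ Finset.range C, lind C s(u, y) x.1 * lind i s(w, y) x.1 * choiceSum d q (max k i)| ≤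
      lam * ((d : ℝ) ^ 2 * ((C : ℝ) ^ 2 * η)) := by
    rw [sum_alt_eq_others, ← Finset.sum_sub_distrib]
    refine (Finset.abs_sum_le_sum_abs _ _).trans ?_
    refine (Finset.sum_le_card_nsmul _ _
      (lam / ((n : ℝ) - 2) * ((d : ℝ) ^ 2 * ((C : ℝ) ^ 2 * η))) fun y hy => ?_).trans ?_
    · rw [mem_others] at hy
      have huy : u ≠ y := hy.1.symm
      have hle := load_le x huy
      rw [alt_arr hn x ⟨huy, huw.symm, hy.2.symm⟩, Sym2.eq_swap (a := y) (b := w)]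
      -- A call between `u` and `y` is rerouted only when its direct link is full, the source of the
      -- factor `coord q C`. The second link `{w, y}` then has some load `i`, and the path load is
      -- `max k i`.
      by_cases hc : load x.1 s(u, y) < C
      · have : ∀ i, lind C s(u, y) x.1 * lind i s(w, y) x.1 * choiceSum d q (max k i) = 0 := by
          intro i
          simp [lind, hc.ne]
        simp only [this, hc, if_true, Finset.sum_const_zero, mul_zero, sub_self, abs_zero]
        positivity
      · have hc' : load x.1 s(u, y) = C := by omega
        have : ∑ i ∈ Finset.range C, lind C s(u, y) x.1 * lind i s(w, y) x.1 *
            choiceSum d q (max k i) = if load x.1 s(w, y) < C then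
              choiceSum d q (max k (load x.1 s(w, y))) else 0 := by
          simp [lind, hc']
        rw [this, if_neg hc, ← hkdef]
        by_cases hc2 : load x.1 s(w, y) < C
        · rw [if_pos (max_lt hk hc2), if_pos hc2, ← mul_sub, abs_mul,
            abs_of_nonneg (show 0 ≤ lam / ((n : ℝ) - 2) by positivity)]
          exact mul_le_mul_of_nonneg_left
            (abs_localChoice_sub_le hn hη hq h d huy (max_lt hk hc2)) (by positivity)
        · rw [if_neg (fun hh => hc2 ((le_max_right _ _).trans_lt hh)), if_neg hc2]
          simp only [mul_zero, sub_self, abs_zero]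
          positivity
    · rw [nsmul_eq_mul, show ((others u w).card : ℝ) = (n : ℝ) - 2 from card_ne_ne (by omega) huw]
      refine le_of_eq ?_
      field_simp
  -- replace the pair counts by their approximations
  have h3 : ∑ y ∈ others u w, lam / ((n : ℝ) - 2) *
      ∑ i ∈ Finset.range C, lind C s(u, y) x.1 * lind i s(w, y) x.1 * choiceSum d q (max k i) =
      lam * ∑ i ∈ Finset.range C, pairCount u w C i x.1 / ((n : ℝ) - 2) *
        choiceSum d q (max k i) := by
    rw [← Finset.mul_sum, Finset.sum_comm]
    simp only [← Finset.sum_mul, pairCount, Finset.mul_sum]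
    exact Finset.sum_congr rfl fun i _ => by ring
  have h4 : |lam * ∑ i ∈ Finset.range C, pairCount u w C i x.1 / ((n : ℝ) - 2) *
        choiceSum d q (max k i) -
      lam * (coord q C * ∑ i ∈ Finset.range C, coord q i * choiceSum d q (max k i))| ≤
      lam * (C * (d * η)) := by
    rw [← mul_sub, abs_mul, abs_of_nonneg hlam]
    refine mul_le_mul_of_nonneg_left ?_ hlam
    rw [Finset.mul_sum, ← Finset.sum_sub_distrib]
    refine (Finset.abs_sum_le_sum_abs _ _).trans ?_
    refine (Finset.sum_le_card_nsmul _ _ (d * η) fun i hi => ?_).trans (by simp)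
    have hi' := Finset.mem_range.1 hi
    rw [← mul_assoc, ← sub_mul, abs_mul, abs_of_nonneg (choiceSum_nonneg hq _ _), mul_comm]
    exact mul_le_mul (hcs i hi') (h u w huw C le_rfl i hi'.le) (abs_nonneg _)
      (Nat.cast_nonneg d)
  rw [h3] at h1
  have h5 := abs_sub_le (∑ y, alt (arr lam d x) u y w)
    (lam * ∑ i ∈ Finset.range C, pairCount u w C i x.1 / ((n : ℝ) - 2) * choiceSum d q (max k i))
    (lam * (coord q C * ∑ i ∈ Finset.range C, coord q i * choiceSum d q (max k i)))
  linarith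

/-- An exact zero: a full link takes no direct call and lies on no path with spare capacity. It
matches the zero of `rates` at full load. -/
theorem linkArr_of_full {lam : ℝ} {d : ℕ} (hn : 3 ≤ n) (x : State n C) {u w : Fin n} (h : u ≠ w)
    (hk : ¬ load x.1 s(u, w) < C) : linkArr lam d x s(u, w) = 0 := by
  have h0 : ∀ u w, ¬ load x.1 s(u, w) < C → ∀ y, alt (arr lam d x) u y w = 0 := by
    intro u w hk y
    by_cases hy : u ≠ y ∧ w ≠ u ∧ w ≠ y
    · rw [alt_arr hn x hy, if_neg fun h => hk ((le_max_left _ _).trans_lt h), ite_self]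
    · rw [alt, dif_neg hy]
  rw [linkArr, sum_links h, arr_none hn, if_neg hk]
  simp [h0 u w hk, h0 w u (by rwa [Sym2.eq_swap])]

/-- The arrival rate on every link is close to the one predicted by the profile `q`. -/
theorem abs_linkArr_sub_le {lam : ℝ} (hlam : 0 ≤ lam) (hn : 3 ≤ n) {x : State n C}
    {q : Fin (C + 1) → ℝ} {η : ℝ} (hη : 0 ≤ η) (hq : IsProfile q) (h : PairApprox x q η)
    {d : ℕ} (hd : 1 ≤ d) {u w : Fin n} (huw : u ≠ w) :
    |linkArr lam d x s(u, w) - rates lam d q (load x.1 s(u, w))| ≤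
      2 * lam * (d : ℝ) ^ 2 * ((C : ℝ) + 1) ^ 2 * η := by
  have hd' : (1 : ℝ) ≤ d := by exact_mod_cast hd
  by_cases hk : load x.1 s(u, w) < C
  · rw [linkArr, sum_links huw, arr_none hn, if_pos hk, rates, if_pos hk, Finset.sum_add_distrib]
    have h1 := abs_sum_alt_arr_sub_le hlam hn hη hq h (d := d) huw hk
    have h2 := abs_sum_alt_arr_sub_le hlam hn hη hq h (d := d) huw.symm (by rwa [Sym2.eq_swap])
    rw [Sym2.eq_swap (a := w) (b := u)] at h2
    unfold gain
    set A := ∑ y, alt (arr lam d x) u y w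
    set B := ∑ y, alt (arr lam d x) w y u
    set S := ∑ i ∈ Finset.range C, coord q i * choiceSum d q (max (load x.1 s(u, w)) i)
    -- Both ends of the link contribute the same predicted amount, which is the factor 2 in `gain`.
    have h3 : lam + (A + B) - lam * (1 + 2 * coord q C * S) =
        (A - lam * (coord q C * S)) + (B - lam * (coord q C * S)) := by ring
    rw [h3]
    refine (abs_add_le _ _).trans ?_
    have h4 : lam * ((d : ℝ) ^ 2 * ((C : ℝ) ^ 2 * η) + C * (d * η)) ≤
        lam * ((d : ℝ) ^ 2 * ((C : ℝ) + 1) ^ 2 * η) := by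
      refine mul_le_mul_of_nonneg_left ?_ hlam
      have h5 : (C : ℝ) * d ≤ C * (d : ℝ) ^ 2 := by
        have : (d : ℝ) ≤ (d : ℝ) ^ 2 := by nlinarith
        gcongr
      have h6 : (C : ℝ) * d * η ≤ C * (d : ℝ) ^ 2 * η := by gcongr
      have h7 : 0 ≤ (C : ℝ) * ((d : ℝ) ^ 2 * η) := by positivity
      have h8 : 0 ≤ (d : ℝ) ^ 2 * η := by positivity
      nlinarith
    linarith
  · rw [linkArr_of_full hn x huw hk, rates, if_neg hk, sub_self, abs_zero]
    positivity

end Approx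

/-! ### Drifts of counts, pair counts and rerouted calls -/

section Drift

variable {n C : ℕ}

/-- The load of one link moves by unit steps, up at rate `linkArr` and down at a rate equal to the
load, so its level indicators obey a birth-and-death flow. -/
theorem gen_lind (lam : ℝ) (d : ℕ) (x : State n C) (k : ℕ) (l : Sym2 (Fin n)) :
    gen lam d x (lind k l) =
      flow (fun _ => linkArr lam d x l) (fun k => lind k l x.1) k := by
  have h1 : ∀ r, arr lam d x r * (lind k l (x.1 + Pi.single r 1) - lind k l x.1) =
      (if l ∈ r.links then arr lam d x r else 0) *
        ((if load x.1 l + 1 = k then 1 else 0) - (if load x.1 l = k then 1 else 0)) := by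
    intro r
    unfold lind
    rw [load_add_single]
    by_cases h : l ∈ r.links <;> simp [h]
  have h2 : ∀ r, (x.1 r : ℝ) * (lind k l (x.1 - Pi.single r 1) - lind k l x.1) =
      (if l ∈ r.links then (x.1 r : ℝ) else 0) *
        ((if load x.1 l = k + 1 then 1 else 0) - (if load x.1 l = k then 1 else 0)) := by
    intro r
    by_cases hr : x.1 r = 0
    · simp [hr]
    · have h3 := load_add_single (x.1 - Pi.single r 1) r l
      rw [sub_single_add x.1 hr] at h3
      unfold lind
      by_cases h : l ∈ r.links
      · rw [if_pos h] at h3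
        rw [if_pos h, h3]
        simp
      · rw [if_neg h, add_zero] at h3
        rw [if_neg h, h3]
        simp
  rw [gen, Finset.sum_congr rfl fun r _ => h1 r, Finset.sum_congr rfl fun r _ => h2 r,
    ← Finset.sum_mul, ← Finset.sum_mul, ← linkArr, ← cast_load]
  unfold flow lind
  have h4 : (load x.1 l : ℝ) * (if load x.1 l = k + 1 then 1 else 0) =
      (k + 1) * if load x.1 l = k + 1 then 1 else 0 := by
    split_ifs with h
    · rw [h]; push_cast; ring
    · simp
  have h5 : (load x.1 l : ℝ) * (if load x.1 l = k then 1 else 0) =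
      k * if load x.1 l = k then 1 else 0 := by
    split_ifs with h
    · rw [h]
    · simp
  rw [mul_sub, mul_sub, h4, h5]
  congr 2
  rcases k with _ | k
  · simp
  · simp

/-- At most one of the levels `k - 1` and `k` is the actual load, so the rate error enters at most
once, and only through `c` at that load. -/
theorem abs_gen_lind_sub_le {lam : ℝ} {d : ℕ} {x : State n C} {c : ℕ → ℝ} {a : ℝ}
    {l : Sym2 (Fin n)} (h : |linkArr lam d x l - c (load x.1 l)| ≤ a) (k : ℕ) :
    |gen lam d x (lind k l) - flow c (fun k => lind k l x.1) k| ≤ a := by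
  have ha : 0 ≤ a := (abs_nonneg _).trans h
  rw [gen_lind, flow_sub_rate]
  unfold lind
  by_cases h1 : load x.1 l = k
  · rw [if_pos h1, mul_one, ← h1]
    by_cases h0 : load x.1 l = 0
    · rw [if_pos h0, zero_sub, abs_neg]
      exact h
    · rw [if_neg h0, if_neg (show ¬ load x.1 l = load x.1 l - 1 by omega), mul_zero, zero_sub,
        abs_neg]
      exact h
  · rw [if_neg h1, mul_zero, sub_zero]
    by_cases h0 : k = 0
    · simpa [h0] using ha
    · rw [if_neg h0]
      by_cases h2 : load x.1 l = k - 1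
      · rw [if_pos h2, mul_one, ← h2]
        exact h
      · simpa [h2] using ha

/-- The arrival rates on all links are given by `c`, up to `a`. -/
def RateApprox (lam : ℝ) (d : ℕ) (x : State n C) (c : ℕ → ℝ) (a : ℝ) : Prop :=
  ∀ u w, u ≠ w → |linkArr lam d x s(u, w) - c (load x.1 s(u, w))| ≤ a

theorem abs_gen_cntOn_sub_le {lam : ℝ} {d : ℕ} {x : State n C} {c : ℕ → ℝ} {a : ℝ}
    (h : RateApprox lam d x c a) {s : Finset (Fin n)} {v : Fin n} (hv : v ∉ s) (k : ℕ) :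
    |gen lam d x (cntOn s v k) - flow c (fun k => cntOn s v k x.1) k| ≤ s.card * a := by
  have h1 : gen lam d x (cntOn s v k) = ∑ w ∈ s, gen lam d x (lind k s(v, w)) :=
    gen_sum s lam d x fun w => lind k s(v, w)
  have h2 : flow c (fun k => cntOn s v k x.1) k =
      ∑ w ∈ s, flow c (fun k => lind k s(v, w) x.1) k :=
    flow_sum s c (fun w k => lind k s(v, w) x.1) k
  rw [h1, h2, ← Finset.sum_sub_distrib]
  refine (Finset.abs_sum_le_sum_abs _ _).trans ?_
  refine (Finset.sum_le_card_nsmul _ _ a fun w hw => ?_).trans (by simp)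
  refine abs_gen_lind_sub_le (h v w ?_) k
  rintro rfl
  exact hv hw

/-- No route other than the path from `u` to `v` through `w` uses both links, so this path is the
only source of simultaneous jumps. -/
theorem sum_two_links {u v w : Fin n} (huv : u ≠ v) (hw : w ∈ others u v) (T : Route n → ℝ) :
    ∑ r : Route n, T r * ((if s(u, w) ∈ r.links then 1 else 0) *
      (if s(v, w) ∈ r.links then 1 else 0)) = alt T u v w := by
  rw [mem_others] at hw
  rw [Finset.sum_eq_single
    (⟨⟨s(u, v), by simpa using huv⟩, some ⟨w, mid_mem ⟨huv, hw⟩⟩⟩ : Route n)]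
  · rw [alt, dif_pos ⟨huv, hw⟩, if_pos (mem_links_some.2 (Or.inl ⟨by simp, rfl⟩)),
      if_pos (mem_links_some.2 (Or.inl ⟨by simp, rfl⟩))]
    simp
  · rintro ⟨e, _ | z⟩ - hr
    · by_cases h1 : s(u, w) = e.1
      · have h2 : s(v, w) ≠ e.1 := by
          rw [← h1]
          intro h3
          exact huv (Sym2.congr_left.1 h3).symm
        simp [Route.links, h2]
      · simp [Route.links, h1]
    · by_cases h1 : s(u, w) ∈ Route.links ⟨e, some z⟩
      · by_cases h2 : s(v, w) ∈ Route.links ⟨e, some z⟩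
        · exfalso
          rw [mem_links_some] at h1 h2
          rcases h1 with ⟨h1, h1'⟩ | ⟨h1, h1'⟩
          · rcases h2 with ⟨h2, h2'⟩ | ⟨h2, h2'⟩
            · apply hr
              have he : e = ⟨s(u, v), by simpa using huv⟩ :=
                Subtype.ext ((Sym2.mem_and_mem_iff huv).1 ⟨h1, h2⟩)
              subst he
              congr 2
              exact Subtype.ext h1'
            · exact hw.2 (h1'.symm.trans h2')
          · rcases h2 with ⟨h2, h2'⟩ | ⟨h2, h2'⟩
            · exact hw.1 (h2'.symm.trans h1')
            · exact huv (h1'.symm.trans h2')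
        · simp [h2]
      · simp [h1]
  · simp

theorem alt_add (T T' : Route n → ℝ) (u v w : Fin n) :
    alt (fun r => T r + T' r) u v w = alt T u v w + alt T' u v w := by
  unfold alt
  split_ifs <;> simp

theorem sum_alt_calls (x : Route n → ℕ) {u v : Fin n} (huv : u ≠ v) :
    ∑ w ∈ others u v, alt (fun r => (x r : ℝ)) u v w =
      altCalls ⟨s(u, v), by simpa using huv⟩ x := by
  rw [← sum_mid huv, altCalls]
  refine Finset.sum_congr rfl fun z _ => ?_
  have hz : z.1 ≠ u ∧ z.1 ≠ v := by simpa using z.2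
  rw [alt, dif_pos ⟨huv, hz⟩]

/-- Leibniz rule for each product of indicators. The covariation over all `w` comes from calls
between `u` and `v` being rerouted, at total rate at most `lam * d`, or ending, at total rate
`altCalls`. This is why φ must contain φ³. -/
theorem abs_gen_pairCount_sub_le {lam : ℝ} (hlam : 0 ≤ lam) (hn : 3 ≤ n) {d : ℕ} {x : State n C}
    {c : ℕ → ℝ} {a : ℝ} (h : RateApprox lam d x c a) {u v : Fin n} (huv : u ≠ v) (j k : ℕ) :
    |gen lam d x (pairCount u v j k) -
      (flow c (fun k => pairCount u v j k x.1) k + flow c (fun j => pairCount u v j k x.1) j)| ≤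
      2 * (((n : ℝ) - 2) * a) + lam * d + altCalls ⟨s(u, v), by simpa using huv⟩ x.1 := by
  have h1 : gen lam d x (pairCount u v j k) =
      ∑ w ∈ others u v, gen lam d x (fun y => lind j s(u, w) y * lind k s(v, w) y) :=
    gen_sum (others u v) lam d x fun w y => lind j s(u, w) y * lind k s(v, w) y
  have h2 : flow c (fun k => pairCount u v j k x.1) k =
      ∑ w ∈ others u v, lind j s(u, w) x.1 * flow c (fun k => lind k s(v, w) x.1) k := by
    simp only [← flow_const_mul]
    exact flow_sum (others u v) c (fun w k => lind j s(u, w) x.1 * lind k s(v, w) x.1) k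
  have h3 : flow c (fun j => pairCount u v j k x.1) j =
      ∑ w ∈ others u v, lind k s(v, w) x.1 * flow c (fun j => lind j s(u, w) x.1) j := by
    simp only [← flow_mul_const]
    exact flow_sum (others u v) c (fun w j => lind j s(u, w) x.1 * lind k s(v, w) x.1) j
  rw [h1, h2, h3, ← Finset.sum_add_distrib, ← Finset.sum_sub_distrib]
  refine (Finset.abs_sum_le_sum_abs _ _).trans ?_
  have h4 : ∀ w ∈ others u v, |gen lam d x (fun y => lind j s(u, w) y * lind k s(v, w) y) -
      (lind j s(u, w) x.1 * flow c (fun k => lind k s(v, w) x.1) k +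
        lind k s(v, w) x.1 * flow c (fun j => lind j s(u, w) x.1) j)| ≤
      2 * a + (alt (arr lam d x) u v w + alt (fun r => (x.1 r : ℝ)) u v w) := by
    intro w hw
    have hw' := mem_others.1 hw
    have h5 := gen_mul_sub_le hlam (by omega) d x (local_lind j s(u, w)) (local_lind k s(v, w))
    rw [sum_two_links huv hw (fun r => arr lam d x r + x.1 r), alt_add] at h5
    have h6 := abs_gen_lind_sub_le (h v w hw'.2.symm) k
    have h7 := abs_gen_lind_sub_le (h u w hw'.1.symm) j
    have h8 : |lind j s(u, w) x.1 * (gen lam d x (lind k s(v, w)) -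
        flow c (fun k => lind k s(v, w) x.1) k)| ≤ a := by
      rw [abs_mul, ← one_mul a]
      exact mul_le_mul (abs_lind_le _ _ _) h6 (abs_nonneg _) zero_le_one
    have h9 : |lind k s(v, w) x.1 * (gen lam d x (lind j s(u, w)) -
        flow c (fun k => lind k s(u, w) x.1) j)| ≤ a := by
      rw [abs_mul, ← one_mul a]
      exact mul_le_mul (abs_lind_le _ _ _) h7 (abs_nonneg _) zero_le_one
    rw [abs_le] at *
    constructor <;> linarith [h5.1, h5.2, h8.1, h8.2, h9.1, h9.2]
  refine (Finset.sum_le_sum h4).trans ?_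
  rw [Finset.sum_add_distrib, Finset.sum_add_distrib, sum_alt_calls x.1 huv, Finset.sum_const,
    nsmul_eq_mul, show ((others u v).card : ℝ) = (n : ℝ) - 2 from card_ne_ne (by omega) huv]
  have h5 : ∑ w ∈ others u v, alt (arr lam d x) u v w ≤ lam * d :=
    (Finset.sum_le_sum_of_subset_of_nonneg (Finset.subset_univ _)
      fun w _ _ => alt_nonneg (arr_nonneg hlam (by omega) d x) u v w).trans
      (sum_alt_arr_mid_le hlam hn x u v)
  linarith

/-- A crude covariation bound suffices: one count moves by at most `deg u`, the other by at most 2.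
The result is O(n), hence bounded after the later division by `n - 2`. -/
theorem abs_gen_cntOn_mul_sub_le {lam : ℝ} (hlam : 0 ≤ lam) (hn : 3 ≤ n) {d : ℕ} (hd : 1 ≤ d)
    {x : State n C} {c : ℕ → ℝ} {a : ℝ} (h : RateApprox lam d x c a) {u v : Fin n} (huv : u ≠ v)
    (j k : ℕ) :
    |gen lam d x (fun y => cntOn (others u v) u j y * cntOn (others u v) v k y) -
      (flow c (fun k => cntOn (others u v) u j x.1 * cntOn (others u v) v k x.1) k +
       flow c (fun j => cntOn (others u v) u j x.1 * cntOn (others u v) v k x.1) j)| ≤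
      ((n : ℝ) - 2) * (2 * (((n : ℝ) - 2) * a)) + 2 * (n * (3 * lam * d + C)) := by
  have h2 := two_lt_cast hn
  have hcard : ((others u v).card : ℝ) = (n : ℝ) - 2 := card_ne_ne (by omega) huv
  have hl1 := (local_cntOn (others u v) u j).mono
    (sum_mem_links_le_deg (left_notMem_others u v))
  have hl2 := (local_cntOn (others u v) v k).mono (fun r => sum_mem_links_le (others u v) v r)
  have h5 := gen_mul_sub_le hlam (by omega) d x hl1 hl2
  have h6 : ∑ r, (arr lam d x r + x.1 r) * (deg u r * 2) ≤ 2 * (n * (3 * lam * d + C)) := by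
    rw [show ∑ r, (arr lam d x r + x.1 r) * (deg u r * 2) =
      2 * ∑ r, (arr lam d x r + x.1 r) * deg u r by
        rw [Finset.mul_sum]; exact Finset.sum_congr rfl fun r _ => by ring]
    exact mul_le_mul_of_nonneg_left (sum_mul_deg_le hlam hd hn x u) two_pos.le
  have h7 := abs_gen_cntOn_sub_le h (left_notMem_others u v) j
  have h8 := abs_gen_cntOn_sub_le h (right_notMem_others u v) k
  rw [hcard] at h7 h8
  have h9 : |cntOn (others u v) u j x.1 * (gen lam d x (cntOn (others u v) v k) -
      flow c (fun k => cntOn (others u v) v k x.1) k)| ≤ ((n : ℝ) - 2) * (((n : ℝ) - 2) * a) := by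
    rw [abs_mul]
    exact mul_le_mul (abs_cntOn_others_le (by omega) huv _ _ _) h8 (abs_nonneg _) h2.le
  have h10 : |cntOn (others u v) v k x.1 * (gen lam d x (cntOn (others u v) u j) -
      flow c (fun k => cntOn (others u v) u k x.1) j)| ≤ ((n : ℝ) - 2) * (((n : ℝ) - 2) * a) := by
    rw [abs_mul]
    exact mul_le_mul (abs_cntOn_others_le (by omega) huv _ _ _) h7 (abs_nonneg _) h2.le
  rw [flow_const_mul, flow_mul_const]
  rw [abs_le] at *
  constructor <;> linarith [h5.1, h5.2, h9.1, h9.2, h10.1, h10.2]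

theorem four_point {a b a₁ a₂ b₁ b₂ e₁ e₂ f₁ f₂ : ℝ} (h₁ : |a - (a₁ + a₂)| ≤ e₁)
    (h₂ : |b - (b₁ + b₂)| ≤ e₂) (h₃ : |a₁ - b₁| ≤ f₁) (h₄ : |a₂ - b₂| ≤ f₂) :
    |a - b| ≤ e₁ + e₂ + f₁ + f₂ := by
  rw [abs_le] at *
  constructor <;> linarith [h₁.1, h₁.2, h₂.1, h₂.2, h₃.1, h₃.2, h₄.1, h₄.2]

theorem pairDev_eq_zero_right (x : State n C) (u v : Fin n) (j : ℕ) {k : ℕ} (hk : C < k) :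
    pairDev u v j k x.1 = 0 := by
  have h0 : ∀ y ∈ others u v, lind k s(v, y) x.1 = 0 := fun y hy => by
    have := load_le x (mem_others.1 hy).2.symm
    exact if_neg (by omega)
  have h1 : cntOn (others u v) v k x.1 = 0 := Finset.sum_eq_zero h0
  have h2 : pairCount u v j k x.1 = 0 :=
    Finset.sum_eq_zero fun y hy => by rw [h0 y hy, mul_zero]
  rw [pairDev, h1, h2, mul_zero, mul_zero, sub_zero]

theorem pairDev_eq_zero_left (x : State n C) (u v : Fin n) {j : ℕ} (hj : C < j) (k : ℕ) :
    pairDev u v j k x.1 = 0 := by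
  have h0 : ∀ y ∈ others u v, lind j s(u, y) x.1 = 0 := fun y hy => by
    have := load_le x (mem_others.1 hy).1.symm
    exact if_neg (by omega)
  have h1 : cntOn (others u v) u j x.1 = 0 := Finset.sum_eq_zero h0
  have h2 : pairCount u v j k x.1 = 0 :=
    Finset.sum_eq_zero fun y hy => by rw [h0 y hy, zero_mul]
  rw [pairDev, h1, h2, zero_mul, mul_zero, sub_zero]

theorem abs_gen_prod_sub_le {lam : ℝ} (hlam : 0 ≤ lam) (hn : 3 ≤ n) {d : ℕ} (hd : 1 ≤ d)
    {x : State n C} {c : ℕ → ℝ} {a : ℝ} (h : RateApprox lam d x c a) {u v : Fin n} (huv : u ≠ v)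
    (j k : ℕ) :
    |gen lam d x (fun y => ((n : ℝ) - 2)⁻¹ *
        (cntOn (others u v) u j y * cntOn (others u v) v k y)) -
      (flow c (fun k => ((n : ℝ) - 2)⁻¹ *
        (cntOn (others u v) u j x.1 * cntOn (others u v) v k x.1)) k +
       flow c (fun j => ((n : ℝ) - 2)⁻¹ *
        (cntOn (others u v) u j x.1 * cntOn (others u v) v k x.1)) j)| ≤
      2 * (((n : ℝ) - 2) * a) + 6 * (3 * lam * d + C) := by
  have h2 := two_lt_cast hn
  have h4 := mul_le_mul_of_nonneg_left (abs_gen_cntOn_mul_sub_le hlam hn hd h huv j k)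
    (inv_pos.2 h2).le
  rw [gen_const_mul,
    flow_const_mul _ (fun k => cntOn (others u v) u j x.1 * cntOn (others u v) v k x.1),
    flow_const_mul _ (fun j => cntOn (others u v) u j x.1 * cntOn (others u v) v k x.1),
    ← mul_add, ← mul_sub, abs_mul, abs_of_pos (inv_pos.2 h2)]
  refine h4.trans ?_
  rw [mul_add, inv_mul_cancel_left₀ h2.ne']
  refine add_le_add le_rfl ?_
  rw [inv_mul_le_iff₀ h2]
  have : (3 : ℝ) ≤ n := by exact_mod_cast hn
  have h0 : 0 ≤ 3 * lam * d + C := by positivity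
  have h3 : 2 * (n : ℝ) ≤ ((n : ℝ) - 2) * 6 := by linarith
  calc 2 * ((n : ℝ) * (3 * lam * d + C)) = 2 * (n : ℝ) * (3 * lam * d + C) := by ring
    _ ≤ ((n : ℝ) - 2) * 6 * (3 * lam * d + C) := by gcongr
    _ = _ := by ring

/-- The drift of the centred pair counts. -/
theorem abs_gen_pairDev_le {lam : ℝ} (hlam : 0 ≤ lam) (hn : 3 ≤ n) {d : ℕ} (hd : 1 ≤ d)
    {x : State n C} {c : ℕ → ℝ} {a A M : ℝ} (h : RateApprox lam d x c a) (hA : ∀ k, |c k| ≤ A)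
    {u v : Fin n} (huv : u ≠ v) (hM : ∀ j k, |pairDev u v j k x.1| ≤ M) {j k : ℕ} (hj : j ≤ C)
    (hk : k ≤ C) :
    |gen lam d x (pairDev u v j k)| ≤
      2 * ((2 * A + 2 * C) * M) + 4 * (((n : ℝ) - 2) * a) + 19 * lam * d + 6 * C
        + altCalls ⟨s(u, v), by simpa using huv⟩ x.1 := by
  have h1 : gen lam d x (pairDev u v j k) = gen lam d x (pairCount u v j k) -
      gen lam d x (fun y => ((n : ℝ) - 2)⁻¹ *
        (cntOn (others u v) u j y * cntOn (others u v) v k y)) :=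
    gen_sub lam d x _ _
  -- The pair count and the normalised product of counts follow the same flow in each index.
  -- Subtracting leaves the flow of `pairDev` itself, which is controlled by `M`.
  have h5 := abs_flow_le (C := C) hA (p := fun k => pairDev u v j k x.1) (fun k => hM j k)
    (pairDev_eq_zero_right x u v j C.lt_succ_self) hk
  have h6 := abs_flow_le (C := C) hA (p := fun j => pairDev u v j k x.1) (fun j => hM j k)
    (pairDev_eq_zero_left x u v C.lt_succ_self k) hj
  simp only [pairDev, flow_sub] at h5 h6
  rw [h1]
  refine (four_point (abs_gen_pairCount_sub_le hlam hn h huv j k)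
    (abs_gen_prod_sub_le hlam hn hd h huv j k) h5 h6).trans ?_
  linarith

theorem gen_eval_le (lam : ℝ) (d : ℕ) (x : State n C) (r₀ : Route n) :
    gen lam d x (fun y => (y r₀ : ℝ)) ≤ arr lam d x r₀ := by
  classical
  have h1 : ∑ r, arr lam d x r * (((x.1 + Pi.single r 1 : Route n → ℕ) r₀ : ℝ) - x.1 r₀) =
      arr lam d x r₀ := by
    rw [Finset.sum_eq_single r₀]
    · simp
    · intro r _ hr
      simp [Pi.single_eq_of_ne hr.symm]
    · simp
  have h2 : ∑ r, (x.1 r : ℝ) * (((x.1 - Pi.single r 1 : Route n → ℕ) r₀ : ℝ) - x.1 r₀) ≤ 0 := by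
    refine Finset.sum_nonpos fun r _ => mul_nonpos_of_nonneg_of_nonpos (Nat.cast_nonneg _) ?_
    rw [sub_nonpos, Nat.cast_le]
    exact Nat.sub_le _ _
  unfold gen
  linarith

theorem gen_altCalls_le_sum (lam : ℝ) (d : ℕ) (x : State n C) (e : Link n) :
    gen lam d x (altCalls e) ≤ ∑ w : Mid e, arr lam d x ⟨e, some w⟩ := by
  have h1 : gen lam d x (altCalls e) =
      ∑ w : Mid e, gen lam d x (fun y => (y ⟨e, some w⟩ : ℝ)) :=
    gen_sum Finset.univ lam d x fun (w : Mid e) y => (y ⟨e, some w⟩ : ℝ)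
  rw [h1]
  exact Finset.sum_le_sum fun w _ => gen_eval_le lam d x _

/-- Departures only lower the number. A one-sided bound is enough, since `psi` needs this observable
bounded only from above. -/
theorem gen_altCalls_le {lam : ℝ} (hlam : 0 ≤ lam) (hn : 3 ≤ n) {d : ℕ} (x : State n C)
    {u v : Fin n} (huv : u ≠ v) :
    gen lam d x (altCalls ⟨s(u, v), by simpa using huv⟩) ≤ lam * d := by
  refine (gen_altCalls_le_sum _ _ _ _).trans (le_trans (le_of_eq ?_)
    (sum_alt_arr_mid_le hlam hn x u v))
  rw [← Finset.sum_subset (Finset.subset_univ (others u v))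
    (fun w _ hw => ?_), ← sum_mid huv]
  · refine Finset.sum_congr rfl fun z _ => ?_
    have hz : z.1 ≠ u ∧ z.1 ≠ v := by simpa using z.2
    rw [alt, dif_pos ⟨huv, hz⟩]
  · rw [mem_others] at hw
    rw [alt, dif_neg (by tauto)]

end Drift

/-! ### Closing the drift estimates in terms of φ -/

section PhiDrift

variable {n C : ℕ}

/-- The number of links at `v` with load `k`, as a function of the load vector. -/
def cnt (v : Fin n) (k : ℕ) : (Route n → ℕ) → ℝ := cntOn (Finset.univ.erase v) v k

theorem cast_count (v : Fin n) (k : ℕ) (x : State n C) : (count v k x : ℝ) = cnt v k x.1 := by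
  unfold count cnt cntOn lind
  rw [Finset.sum_boole]
  congr 2
  ext w
  simp

theorem sum_ind_mul (u v : Fin n) (j k : ℕ) (x : State n C) :
    ∑ w : Fin n, ind j u w x * ind k v w x = pairCount u v j k x.1 := by
  unfold pairCount others
  rw [Finset.sum_filter]
  refine Finset.sum_congr rfl fun w _ => ?_
  unfold ind lind
  by_cases h1 : w = u
  · subst h1; simp
  · by_cases h2 : w = v
    · subst h2; simp
    · simp [h1, h2, Ne.symm h1, Ne.symm h2]

theorem sum_ind_others (u v a : Fin n) (ha : a ∉ others u v) (j : ℕ) (x : State n C) :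
    ∑ w ∈ Finset.univ.filter (fun w => w ≠ u ∧ w ≠ v), ind j a w x =
      cntOn (others u v) a j x.1 := by
  refine Finset.sum_congr rfl fun w hw => ?_
  have : a ≠ w := by rintro rfl; exact ha hw
  simp [ind, lind, this]

theorem phi1_term (hn : 3 ≤ n) (x : State n C) {u v : Fin n} (j k : ℕ) :
    |1 / ((n : ℝ) - 2) * ∑ w : Fin n, ind j u w x * ind k v w x
      - 1 / ((n : ℝ) - 2) ^ 2 *
        ((∑ w ∈ Finset.univ.filter (fun w => w ≠ u ∧ w ≠ v), ind j u w x) *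
          ∑ w ∈ Finset.univ.filter (fun w => w ≠ u ∧ w ≠ v), ind k v w x)| =
    ((n : ℝ) - 2)⁻¹ * |pairDev u v j k x.1| := by
  have h2 := two_lt_cast hn
  rw [sum_ind_mul, sum_ind_others u v u (left_notMem_others u v),
    sum_ind_others u v v (right_notMem_others u v), ← abs_of_pos (inv_pos.2 h2), ← abs_mul,
    pairDev]
  congr 1
  field_simp

/-- `(n - 2) φ`. -/
def psi (x : State n C) : ℝ := ((n : ℝ) - 2) * phi x

theorem abs_pairDev_le_psi (hn : 3 ≤ n) (x : State n C) {u v : Fin n} (huv : u ≠ v) {j k : ℕ}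
    (hj : j ≤ C) (hk : k ≤ C) : |pairDev u v j k x.1| ≤ psi x := by
  have h2 := two_lt_cast hn
  have h1 : ((n : ℝ) - 2)⁻¹ * |pairDev u v j k x.1| ≤ phi x := by
    rw [← phi1_term hn x]
    refine le_trans ?_ (le_max_left _ _)
    refine le_ciSup_of_le (Set.finite_range _).bddAbove (⟨(u, v), huv⟩ : Pair n) ?_
    exact le_ciSup_of_le (Set.finite_range _).bddAbove
      ((⟨j, by omega⟩, ⟨k, by omega⟩) : Fin (C + 1) × Fin (C + 1)) le_rfl
  rwa [inv_mul_le_iff₀ h2] at h1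

theorem psi_nonneg (hn : 3 ≤ n) (x : State n C) : 0 ≤ psi x :=
  (abs_nonneg _).trans (abs_pairDev_le_psi hn x
    (u := ⟨0, by omega⟩) (v := ⟨1, by omega⟩) (by simp) (Nat.zero_le C) (Nat.zero_le C))

theorem abs_pairDev_le_psi' (hn : 3 ≤ n) (x : State n C) {u v : Fin n} (huv : u ≠ v) (j k : ℕ) :
    |pairDev u v j k x.1| ≤ psi x := by
  rcases le_or_gt j C with hj | hj
  · rcases le_or_gt k C with hk | hk
    · exact abs_pairDev_le_psi hn x huv hj hk
    · rw [pairDev_eq_zero_right x u v j hk, abs_zero]; exact psi_nonneg hn x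
  · rw [pairDev_eq_zero_left x u v hj k, abs_zero]; exact psi_nonneg hn x

theorem cnt_eq_zero (x : State n C) (v : Fin n) {k : ℕ} (hk : C < k) : cnt v k x.1 = 0 := by
  unfold cnt cntOn
  refine Finset.sum_eq_zero fun w hw => ?_
  have := load_le x (Finset.ne_of_mem_erase hw).symm
  exact if_neg (by omega)

theorem abs_cnt_sub_le_psi (hn : 3 ≤ n) (x : State n C) (u v : Fin n) (k : ℕ) :
    |cnt u k x.1 - cnt v k x.1| ≤ psi x := by
  have h2 := two_lt_cast hn
  by_cases huv : u = v
  · rw [huv, sub_self, abs_zero]; exact psi_nonneg hn x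
  rcases le_or_gt k C with hk | hk
  · have h1 : ((n : ℝ) - 2)⁻¹ * |cnt u k x.1 - cnt v k x.1| ≤ phi x := by
      rw [← cast_count, ← cast_count, ← one_div]
      refine le_trans ?_ ((le_max_left _ _).trans (le_max_right _ _))
      refine le_ciSup_of_le (Set.finite_range _).bddAbove (⟨(u, v), huv⟩ : Pair n) ?_
      exact le_ciSup_of_le (Set.finite_range _).bddAbove
        (⟨k, by omega⟩ : Fin (C + 1)) le_rfl
    rwa [inv_mul_le_iff₀ h2] at h1
  · rw [cnt_eq_zero x u hk, cnt_eq_zero x v hk, sub_self, abs_zero]; exact psi_nonneg hn x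

theorem altCalls_le_psi (hn : 3 ≤ n) (x : State n C) (e : Link n) : altCalls e x.1 ≤ psi x := by
  have h2 := two_lt_cast hn
  have h1 : ((n : ℝ) - 2)⁻¹ * altCalls e x.1 ≤ phi x := by
    rw [← one_div]
    refine le_trans ?_ ((le_max_right _ _).trans (le_max_right _ _))
    exact le_ciSup_of_le (Set.finite_range _).bddAbove e le_rfl
  rwa [inv_mul_le_iff₀ h2] at h1

/-- Converse to the preceding bounds, so that `psi` can be estimated one observable at a time. -/
theorem psi_le (hn : 3 ≤ n) (x : State n C) {M : ℝ}
    (h1 : ∀ u v, u ≠ v → ∀ j ≤ C, ∀ k ≤ C, |pairDev u v j k x.1| ≤ M)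
    (h2 : ∀ u v, ∀ k ≤ C, |cnt u k x.1 - cnt v k x.1| ≤ M)
    (h3 : ∀ u v, ∀ h : u ≠ v, altCalls ⟨s(u, v), by simpa using h⟩ x.1 ≤ M) : psi x ≤ M := by
  have h0 := two_lt_cast hn
  have hne : (⟨0, by omega⟩ : Fin n) ≠ ⟨1, by omega⟩ := by simp
  have hpair : Nonempty (Pair n) := ⟨⟨(⟨0, by omega⟩, ⟨1, by omega⟩), hne⟩⟩
  have hlink : Nonempty (Link n) := ⟨⟨s(⟨0, by omega⟩, ⟨1, by omega⟩), by simp⟩⟩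
  unfold psi
  rw [← le_inv_mul_iff₀ h0]
  refine max_le ?_ (max_le ?_ ?_)
  · refine ciSup_le fun p => ciSup_le fun jk => ?_
    rw [phi1_term hn]
    exact mul_le_mul_of_nonneg_left (h1 _ _ p.2 _ (by omega) _ (by omega)) (inv_pos.2 h0).le
  · refine ciSup_le fun p => ciSup_le fun j => ?_
    rw [cast_count, cast_count, one_div]
    exact mul_le_mul_of_nonneg_left (h2 _ _ _ (by omega)) (inv_pos.2 h0).le
  · refine ciSup_le fun e => ?_
    rw [one_div]
    refine mul_le_mul_of_nonneg_left ?_ (inv_pos.2 h0).le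
    obtain ⟨e, he⟩ := e
    induction e using Sym2.ind with
    | _ u v => exact h3 u v (by simpa using he)

/-- The load profile of the node `o`. -/
def profile (o : Fin n) (x : State n C) : Fin (C + 1) → ℝ := fun k => cnt o k x.1 / ((n : ℝ) - 1)

theorem sum_cnt (o : Fin n) (x : State n C) :
    ∑ k : Fin (C + 1), cnt o k x.1 = (n : ℝ) - 1 := by
  rw [Fin.sum_univ_eq_sum_range (fun k => cnt o k x.1)]
  unfold cnt cntOn
  rw [Finset.sum_comm, Finset.sum_congr rfl (g := fun _ => (1 : ℝ))]
  · have hn : 1 ≤ n := by have := o.2; omega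
    simp [Finset.card_erase_of_mem, Nat.cast_sub hn]
  · intro w hw
    have := load_le x (Finset.ne_of_mem_erase hw).symm
    unfold lind
    rw [Finset.sum_ite_eq, if_pos (Finset.mem_range.2 (by omega))]

theorem isProfile_profile (hn : 3 ≤ n) (o : Fin n) (x : State n C) : IsProfile (profile o x) := by
  have h1 : (0 : ℝ) < (n : ℝ) - 1 := by linarith [two_lt_cast hn]
  refine ⟨fun k => div_nonneg (cntOn_nonneg _ _ _ _) h1.le, ?_⟩
  unfold profile
  rw [← Finset.sum_div, sum_cnt, div_self h1.ne']

theorem coord_profile (o : Fin n) (x : State n C) (k : ℕ) :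
    coord (profile o x) k = cnt o k x.1 / ((n : ℝ) - 1) := by
  unfold coord
  split_ifs with h
  · rfl
  · rw [cnt_eq_zero x o (by omega), zero_div]

/-- Three discrepancies: node `a` against node `o`, costing `psi`; the one link at `a` left out of
`others`; and `n - 2` against `n - 1` in the normalisation. The last two cost at most 1 each. -/
theorem abs_cntOn_others_sub_le (hn : 3 ≤ n) (o : Fin n) (x : State n C) {u v a : Fin n}
    (ha : a = u ∨ a = v) (huv : u ≠ v) (k : ℕ) :
    |cntOn (others u v) a k x.1 / ((n : ℝ) - 2) - coord (profile o x) k| ≤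
      (psi x + 2) / ((n : ℝ) - 2) := by
  have h2 := two_lt_cast hn
  have h1 : (0 : ℝ) < (n : ℝ) - 1 := by linarith
  obtain ⟨b, hb, hab⟩ : ∃ b, a ≠ b ∧ others u v = (Finset.univ.erase a).erase b := by
    rcases ha with rfl | rfl
    · exact ⟨v, huv, by ext w; simp [mem_others, and_comm]⟩
    · exact ⟨u, huv.symm, by ext w; simp [mem_others]⟩
  have h3 : cntOn (others u v) a k x.1 + lind k s(a, b) x.1 = cnt a k x.1 := by
    unfold cnt cntOn
    rw [hab, Finset.sum_erase_add]
    simp [hb.symm]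
  have h4 := abs_cnt_sub_le_psi hn x a o k
  have h5 := lind_nonneg k s(a, b) x.1
  have h6 := lind_le_one k s(a, b) x.1
  have h7 : 0 ≤ cnt o k x.1 := cntOn_nonneg _ _ _ _
  have h8 : cnt o k x.1 ≤ (n : ℝ) - 1 := by
    refine (cntOn_le _ _ _ _).trans_eq ?_
    rw [Finset.card_erase_of_mem (Finset.mem_univ _), Finset.card_univ, Fintype.card_fin,
      Nat.cast_sub (by omega)]
    simp
  have h9 : cnt o k x.1 / ((n : ℝ) - 1) = (cnt o k x.1 - cnt o k x.1 / ((n : ℝ) - 1)) /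
      ((n : ℝ) - 2) := by
    field_simp
    ring
  have h10 : 0 ≤ cnt o k x.1 / ((n : ℝ) - 1) := by positivity
  have h11 : cnt o k x.1 / ((n : ℝ) - 1) ≤ 1 := (div_le_one h1).2 h8
  rw [coord_profile]
  conv_lhs => rw [h9]
  rw [← sub_div, abs_div, abs_of_pos h2]
  gcongr
  rw [abs_le] at *
  constructor <;> linarith [h4.1, h4.2]

/-- Three errors of the same size: the centred pair count, and the replacement of each of the two
counts by the profile of `o`. Any node may serve as reference. -/
theorem pairApprox_profile (hn : 3 ≤ n) (o : Fin n) (x : State n C) :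
    PairApprox x (profile o x) (3 * ((psi x + 2) / ((n : ℝ) - 2))) := by
  have h2 := two_lt_cast hn
  intro u v huv j _ k _
  have h1 := abs_pairDev_le_psi' hn x huv j k
  have h3 := abs_cntOn_others_sub_le hn o x (Or.inl rfl) huv j
  have h4 := abs_cntOn_others_sub_le hn o x (Or.inr rfl) huv k
  have hp : ∀ a k, |cntOn (others u v) a k x.1 / ((n : ℝ) - 2)| ≤ 1 := by
    intro a k
    rw [abs_div, abs_of_pos h2, div_le_one h2]
    exact abs_cntOn_others_le (by omega) huv a k x.1
  have hq : |coord (profile o x) k| ≤ 1 := by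
    rw [abs_of_nonneg (coord_nonneg (isProfile_profile hn o x).1 k)]
    exact coord_le_one (isProfile_profile hn o x) k
  have h5 := abs_mul_sub_mul_le (b := cntOn (others u v) v k x.1 / ((n : ℝ) - 2))
    (a' := coord (profile o x) j) (hp u j) hq
  have h6 : pairCount u v j k x.1 / ((n : ℝ) - 2) - coord (profile o x) j * coord (profile o x) k =
      pairDev u v j k x.1 / ((n : ℝ) - 2) +
      (cntOn (others u v) u j x.1 / ((n : ℝ) - 2) * (cntOn (others u v) v k x.1 / ((n : ℝ) - 2)) -
        coord (profile o x) j * coord (profile o x) k) := by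
    unfold pairDev
    field_simp
    ring
  have h7 : |pairDev u v j k x.1 / ((n : ℝ) - 2)| ≤ (psi x + 2) / ((n : ℝ) - 2) := by
    rw [abs_div, abs_of_pos h2]
    gcongr
    linarith
  rw [h6]
  refine (abs_add_le _ _).trans ?_
  linarith

/-- The rate that governs all drift estimates. -/
def rateConst (lam : ℝ) (d C : ℕ) : ℝ := (lam + 1) * (d : ℝ) ^ 2 * ((C : ℝ) + 1) ^ 2

theorem rateConst_bounds {lam : ℝ} (hlam : 0 ≤ lam) {d : ℕ} (hd : 1 ≤ d) (hC : 1 ≤ C) :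
    lam * (d : ℝ) ^ 2 * ((C : ℝ) + 1) ^ 2 + ((C : ℝ) + 1) ^ 2 ≤ rateConst lam d C ∧
    4 * (lam * d) ≤ lam * (d : ℝ) ^ 2 * ((C : ℝ) + 1) ^ 2 ∧
    4 * (lam * C * (d : ℝ) ^ 2) ≤ lam * (d : ℝ) ^ 2 * ((C : ℝ) + 1) ^ 2 ∧
    4 * (C : ℝ) ≤ ((C : ℝ) + 1) ^ 2 ∧ 4 ≤ ((C : ℝ) + 1) ^ 2 := by
  have hd' : (1 : ℝ) ≤ d := by exact_mod_cast hd
  have hC' : (1 : ℝ) ≤ C := by exact_mod_cast hC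
  have h1 : (4 : ℝ) ≤ ((C : ℝ) + 1) ^ 2 := by nlinarith
  have h2 : 4 * (C : ℝ) ≤ ((C : ℝ) + 1) ^ 2 := by nlinarith [sq_nonneg ((C : ℝ) - 1)]
  have h3 : (1 : ℝ) ≤ (d : ℝ) ^ 2 := by nlinarith
  have h4 : (d : ℝ) ≤ (d : ℝ) ^ 2 := by nlinarith
  refine ⟨?_, ?_, ?_, h2, h1⟩
  · unfold rateConst
    nlinarith
  · calc 4 * (lam * d) = lam * d * 4 := by ring
      _ ≤ lam * (d : ℝ) ^ 2 * ((C : ℝ) + 1) ^ 2 := by gcongr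
  · calc 4 * (lam * C * (d : ℝ) ^ 2) = lam * (d : ℝ) ^ 2 * (4 * C) := by ring
      _ ≤ lam * (d : ℝ) ^ 2 * ((C : ℝ) + 1) ^ 2 := by gcongr

theorem rateApprox_profile {lam : ℝ} (hlam : 0 ≤ lam) (hn : 3 ≤ n) {d : ℕ} (hd : 1 ≤ d)
    (o : Fin n) (x : State n C) :
    RateApprox lam d x (rates lam d (profile o x))
      (6 * (lam * (d : ℝ) ^ 2 * ((C : ℝ) + 1) ^ 2) * ((psi x + 2) / ((n : ℝ) - 2))) := by
  have h2 := two_lt_cast hn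
  have h3 := psi_nonneg hn x
  intro u w huw
  refine (abs_linkArr_sub_le hlam hn (by positivity) (isProfile_profile hn o x)
    (pairApprox_profile hn o x) hd huw).trans_eq (by ring)

theorem abs_gen_pairDev_le_psi {lam : ℝ} (hlam : 0 ≤ lam) (hn : 3 ≤ n) {d : ℕ} (hd : 1 ≤ d)
    (hC : 1 ≤ C) (x : State n C) {u v : Fin n} (huv : u ≠ v) {j k : ℕ} (hj : j ≤ C) (hk : k ≤ C) :
    |gen lam d x (pairDev u v j k)| ≤ 27 * rateConst lam d C * psi x + 53 * rateConst lam d C := by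
  have h2 := two_lt_cast hn
  have h0 := psi_nonneg hn x
  have h1 := abs_gen_pairDev_le hlam hn hd (rateApprox_profile hlam hn hd u x)
    (abs_rates_le hlam hd (isProfile_profile hn u x)) huv
    (abs_pairDev_le_psi' hn x huv) hj hk
  have h3 := altCalls_le_psi hn x ⟨s(u, v), by simpa using huv⟩
  obtain ⟨b1, b2, -, b4, b5⟩ := rateConst_bounds (C := C) hlam hd hC
  have h4 : ((n : ℝ) - 2) * (6 * (lam * (d : ℝ) ^ 2 * ((C : ℝ) + 1) ^ 2) *
      ((psi x + 2) / ((n : ℝ) - 2))) =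
      6 * (lam * (d : ℝ) ^ 2 * ((C : ℝ) + 1) ^ 2) * (psi x + 2) := by
    field_simp
  rw [h4] at h1
  set X := lam * (d : ℝ) ^ 2 * ((C : ℝ) + 1) ^ 2
  have hX : 0 ≤ X := by positivity
  -- `12 * (lam * d) + 4 * C` comes from the two flows, `24 * X` from the rate errors and 1 from
  -- `altCalls`.
  have h5 : (12 * (lam * d) + 4 * C + 24 * X + 1) * psi x ≤ 27 * rateConst lam d C * psi x := by
    gcongr
    linarith
  refine h1.trans ?_
  nlinarith

theorem abs_gen_cnt_sub_flow_le {lam : ℝ} (hlam : 0 ≤ lam) (hn : 3 ≤ n) {d : ℕ} (hd : 1 ≤ d)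
    (o v : Fin n) (x : State n C) (k : ℕ) :
    |gen lam d x (cnt v k) - flow (rates lam d (profile o x)) (fun k => cnt v k x.1) k| ≤
      12 * (lam * (d : ℝ) ^ 2 * ((C : ℝ) + 1) ^ 2) * (psi x + 2) := by
  have h2 := two_lt_cast hn
  have h0 := psi_nonneg hn x
  refine (abs_gen_cntOn_sub_le (rateApprox_profile hlam hn hd o x)
    (Finset.notMem_erase v Finset.univ) k).trans ?_
  have h3 : ((Finset.univ.erase v).card : ℝ) ≤ 2 * ((n : ℝ) - 2) := by
    rw [Finset.card_erase_of_mem (Finset.mem_univ _), Finset.card_univ, Fintype.card_fin,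
      Nat.cast_sub (by omega)]
    have : (3 : ℝ) ≤ n := by exact_mod_cast hn
    push_cast
    linarith
  calc _ ≤ 2 * ((n : ℝ) - 2) * (6 * (lam * (d : ℝ) ^ 2 * ((C : ℝ) + 1) ^ 2) *
        ((psi x + 2) / ((n : ℝ) - 2))) := by gcongr
    _ = _ := by field_simp; ring

/-- Both counts are compared with flows at the same rates, those of the profile of `u`, so the flows
differ by the flow of the difference of the counts. -/
theorem abs_gen_cnt_sub_le_psi {lam : ℝ} (hlam : 0 ≤ lam) (hn : 3 ≤ n) {d : ℕ} (hd : 1 ≤ d)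
    (hC : 1 ≤ C) (x : State n C) (u v : Fin n) {k : ℕ} (hk : k ≤ C) :
    |gen lam d x (cnt u k) - gen lam d x (cnt v k)| ≤
      27 * rateConst lam d C * psi x + 53 * rateConst lam d C := by
  have h0 := psi_nonneg hn x
  have h1 := abs_gen_cnt_sub_flow_le hlam hn hd u u x k
  have h2 := abs_gen_cnt_sub_flow_le hlam hn hd u v x k
  have h3 := abs_flow_le (C := C) (abs_rates_le hlam hd (isProfile_profile hn u x))
    (p := fun k => cnt u k x.1 - cnt v k x.1) (fun k => abs_cnt_sub_le_psi hn x u v k)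
    (by rw [cnt_eq_zero x u C.lt_succ_self, cnt_eq_zero x v C.lt_succ_self, sub_self]) hk
  rw [flow_sub] at h3
  obtain ⟨b1, b2, -, b4, b5⟩ := rateConst_bounds (C := C) hlam hd hC
  set X := lam * (d : ℝ) ^ 2 * ((C : ℝ) + 1) ^ 2
  have hX : 0 ≤ X := by positivity
  have h5 : (6 * (lam * d) + 2 * C + 24 * X) * psi x ≤ 27 * rateConst lam d C * psi x := by
    gcongr
    linarith
  have h6 : |gen lam d x (cnt u k) - gen lam d x (cnt v k)| ≤
      12 * X * (psi x + 2) + 12 * X * (psi x + 2) + (2 * (3 * lam * d) + 2 * C) * psi x := by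
    rw [abs_le] at *
    constructor <;> linarith [h1.1, h1.2, h2.1, h2.2, h3.1, h3.2]
  refine h6.trans ?_
  nlinarith

theorem gen_altCalls_le_rateConst {lam : ℝ} (hlam : 0 ≤ lam) (hn : 3 ≤ n) {d : ℕ} (hd : 1 ≤ d)
    (hC : 1 ≤ C) (x : State n C) {u v : Fin n} (huv : u ≠ v) :
    gen lam d x (altCalls ⟨s(u, v), by simpa using huv⟩) ≤
      27 * rateConst lam d C * psi x + 53 * rateConst lam d C := by
  have h0 := psi_nonneg hn x
  obtain ⟨b1, b2, -, b4, b5⟩ := rateConst_bounds (C := C) hlam hd hC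
  have hX : 0 ≤ lam * (d : ℝ) ^ 2 * ((C : ℝ) + 1) ^ 2 := by positivity
  have h1 : 0 ≤ rateConst lam d C := by linarith
  have h2 : 0 ≤ 27 * rateConst lam d C * psi x := by positivity
  have h3 : 0 ≤ lam * d := by positivity
  linarith [gen_altCalls_le hlam hn (d := d) x huv]

/-- With `v` as its own reference node, homogeneity of the flow makes the predicted drift exactly
`(n - 1) F`. -/
theorem abs_gen_cnt_sub_F_le {lam : ℝ} (hlam : 0 ≤ lam) (hn : 3 ≤ n) {d : ℕ} (hd : 1 ≤ d)
    (hC : 1 ≤ C) (x : State n C) (v : Fin n) (k : Fin (C + 1)) :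
    |gen lam d x (cnt v k) - ((n : ℝ) - 1) * F lam d (profile v x) k| ≤
      12 * rateConst lam d C * (psi x + 2) := by
  have h1 : (0 : ℝ) < (n : ℝ) - 1 := by linarith [two_lt_cast hn]
  have h0 := psi_nonneg hn x
  have h2 := abs_gen_cnt_sub_flow_le hlam hn hd v v x k
  have h3 : ((n : ℝ) - 1) * F lam d (profile v x) k =
      flow (rates lam d (profile v x)) (fun k => cnt v k x.1) k := by
    rw [F_eq_flow hC, ← flow_const_mul]
    congr 1
    ext k
    rw [coord_profile, mul_div_cancel₀ _ h1.ne']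
  obtain ⟨b1, -, -, -, b5⟩ := rateConst_bounds (C := C) hlam hd hC
  rw [h3]
  refine h2.trans ?_
  gcongr
  linarith

end PhiDrift

/-! ### Algebra of bounded Lipschitz functions -/

section BoundedLipschitz

variable {E : Type*} [NormedAddCommGroup E]

/-- Bounded and Lipschitz real functions. -/
def BddLip (f : E → ℝ) : Prop :=
  ∃ M K : ℝ, (∀ x, |f x| ≤ M) ∧ ∀ x y, |f x - f y| ≤ K * ‖x - y‖

theorem BddLip.const (a : ℝ) : BddLip fun _ : E => a := ⟨|a|, 0, by simp, by simp⟩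

theorem BddLip.add {f g : E → ℝ} (hf : BddLip f) (hg : BddLip g) :
    BddLip fun x => f x + g x := by
  obtain ⟨M, K, h1, h2⟩ := hf
  obtain ⟨M', K', h3, h4⟩ := hg
  refine ⟨M + M', K + K', fun x => (abs_add_le _ _).trans (add_le_add (h1 x) (h3 x)),
    fun x y => ?_⟩
  rw [add_sub_add_comm, add_mul]
  exact (abs_add_le _ _).trans (add_le_add (h2 x y) (h4 x y))

theorem BddLip.mul {f g : E → ℝ} (hf : BddLip f) (hg : BddLip g) :
    BddLip fun x => f x * g x := by
  obtain ⟨M, K, h1, h2⟩ := hf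
  obtain ⟨M', K', h3, h4⟩ := hg
  have hM : 0 ≤ M := (abs_nonneg _).trans (h1 0)
  have hM' : 0 ≤ M' := (abs_nonneg _).trans (h3 0)
  refine ⟨M * M', M * K' + M' * K, fun x => ?_, fun x y => ?_⟩
  · rw [abs_mul]
    exact mul_le_mul (h1 x) (h3 x) (abs_nonneg _) hM
  · refine (abs_mul_sub_mul_le (h1 x) (h3 y)).trans ?_
    have := mul_le_mul_of_nonneg_left (h4 x y) hM
    have := mul_le_mul_of_nonneg_left (h2 x y) hM'
    linarith

theorem BddLip.sub {f g : E → ℝ} (hf : BddLip f) (hg : BddLip g) :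
    BddLip fun x => f x - g x := by
  have := hf.add ((BddLip.const (-1)).mul hg)
  simpa [sub_eq_add_neg] using this

theorem BddLip.pow {f : E → ℝ} (hf : BddLip f) (k : ℕ) : BddLip fun x => f x ^ k := by
  induction k with
  | zero => simpa using BddLip.const 1
  | succ k ih => simpa [pow_succ] using ih.mul hf

theorem BddLip.sum {ι : Type*} (s : Finset ι) {f : ι → E → ℝ} (hf : ∀ i, BddLip (f i)) :
    BddLip fun x => ∑ i ∈ s, f i x := by
  classical
  induction s using Finset.induction_on with
  | empty => simpa using BddLip.const 0
  | insert i s hi ih => simpa [Finset.sum_insert hi] using (hf i).add ih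

theorem BddLip.max_zero {f : E → ℝ} (hf : BddLip f) : BddLip fun x => max (f x) 0 := by
  obtain ⟨M, K, h1, h2⟩ := hf
  refine ⟨M, K, fun x => ?_, fun x y => (abs_max_sub_max_le_abs _ _ _).trans (h2 x y)⟩
  rw [abs_of_nonneg (le_max_right _ _)]
  exact max_le ((le_abs_self _).trans (h1 x)) ((abs_nonneg _).trans (h1 x))

end BoundedLipschitz

/-! ### Existence, uniqueness and Euler steps for the differential equation -/

section Solution

variable {C : ℕ}

/-- Coordinatewise truncation to `[a, b]`. -/
def clampVec (a b : ℝ) (ξ : Fin (C + 1) → ℝ) : Fin (C + 1) → ℝ := fun k => max a (min b (ξ k))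

theorem clampVec_eq {a b : ℝ} {ξ : Fin (C + 1) → ℝ} (h : ∀ k, a ≤ ξ k ∧ ξ k ≤ b) :
    clampVec a b ξ = ξ := by
  ext k
  rw [clampVec, min_eq_right (h k).2, max_eq_right (h k).1]

theorem bddLip_coord_clamp (a b : ℝ) (k : ℕ) :
    BddLip fun ξ : Fin (C + 1) → ℝ => coord (clampVec a b ξ) k := by
  unfold coord
  split_ifs with h
  · refine ⟨max |a| |b|, 1, fun ξ => ?_, fun ξ ζ => ?_⟩
    · change |max a (min b (ξ ⟨k, h⟩))| ≤ max |a| |b|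
      rcases le_total b (ξ ⟨k, h⟩) with h1 | h1
      · rw [min_eq_left h1]
        exact abs_max_le_max_abs_abs
      · rw [min_eq_right h1]
        rcases le_total a (ξ ⟨k, h⟩) with h2 | h2
        · rw [max_eq_right h2]
          exact abs_le_max_abs_abs h2 h1
        · rw [max_eq_left h2]
          exact le_max_left _ _
    · change |max a (min b (ξ ⟨k, h⟩)) - max a (min b (ζ ⟨k, h⟩))| ≤ 1 * ‖ξ - ζ‖
      rw [one_mul, max_comm a, max_comm a, min_comm b, min_comm b]
      refine (abs_max_sub_max_le_abs _ _ _).trans ?_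
      refine (abs_min_sub_min_le_max _ _ _ _).trans ?_
      rw [sub_self, abs_zero, max_eq_left (abs_nonneg _)]
      exact norm_le_pi_norm (ξ - ζ) ⟨k, h⟩
  · exact BddLip.const 0

theorem bddLip_cum_clamp (a b : ℝ) (i : ℕ) :
    BddLip fun ξ : Fin (C + 1) → ℝ => cum (clampVec a b ξ) i :=
  BddLip.sum _ fun k => bddLip_coord_clamp a b k

theorem bddLip_choiceSum_clamp (a b : ℝ) (d i : ℕ) :
    BddLip fun ξ : Fin (C + 1) → ℝ => choiceSum d (clampVec a b ξ) i :=
  BddLip.sum _ fun _ => (((BddLip.const 1).sub ((bddLip_cum_clamp a b _).pow 2)).pow _).mul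
    (((BddLip.const 1).sub ((bddLip_cum_clamp a b _).pow 2)).pow _)

theorem bddLip_gain_clamp (a b : ℝ) (d k : ℕ) :
    BddLip fun ξ : Fin (C + 1) → ℝ => gain d (clampVec a b ξ) k :=
  ((BddLip.const 2).mul (bddLip_coord_clamp a b C)).mul (BddLip.sum _ fun i =>
    (bddLip_coord_clamp a b i).mul (bddLip_choiceSum_clamp a b d _))

theorem bddLip_rates_clamp (lam a b : ℝ) (d k : ℕ) :
    BddLip fun ξ : Fin (C + 1) → ℝ => rates lam d (clampVec a b ξ) k := by
  unfold rates
  split_ifs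
  · exact (BddLip.const lam).mul ((BddLip.const 1).add (bddLip_gain_clamp a b d k))
  · exact BddLip.const 0

theorem bddLip_flow {E : Type*} [NormedAddCommGroup E] {c p : E → ℕ → ℝ}
    (hc : ∀ k, BddLip fun x => c x k) (hp : ∀ k, BddLip fun x => p x k) (k : ℕ) :
    BddLip fun x => flow (c x) (p x) k := by
  unfold flow
  refine BddLip.add (BddLip.sub ?_ ((hc k).mul (hp k)))
    (BddLip.sub ((BddLip.const _).mul (hp _)) ((BddLip.const _).mul (hp _)))
  split_ifs
  · exact BddLip.const 0
  · exact (hc _).mul (hp _)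

theorem exists_bounds_of_bddLip {V : (Fin (C + 1) → ℝ) → Fin (C + 1) → ℝ}
    (hV : ∀ k, BddLip fun ξ => V ξ k) :
    ∃ M K : ℝ≥0, (∀ ξ, ‖V ξ‖ ≤ M) ∧ LipschitzWith K V := by
  choose M K h1 h2 using hV
  have hM : ∀ k, 0 ≤ M k := fun k => (abs_nonneg _).trans (h1 k 0)
  refine ⟨∑ k, (M k).toNNReal, ∑ k, (K k).toNNReal, fun ξ => ?_, ?_⟩
  · refine (pi_norm_le_iff_of_nonneg (NNReal.coe_nonneg _)).2 fun k => (h1 k ξ).trans ?_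
    refine (Real.le_coe_toNNReal _).trans ?_
    exact_mod_cast Finset.single_le_sum (f := fun k => (M k).toNNReal)
      (fun _ _ => zero_le) (Finset.mem_univ k)
  · refine LipschitzWith.of_dist_le_mul fun ξ ζ => ?_
    rw [dist_eq_norm, dist_eq_norm]
    refine (pi_norm_le_iff_of_nonneg (by positivity)).2 fun k => (h2 k ξ ζ).trans ?_
    refine mul_le_mul_of_nonneg_right ?_ (norm_nonneg _)
    refine (Real.le_coe_toNNReal _).trans ?_
    exact_mod_cast Finset.single_le_sum (f := fun k => (K k).toNNReal)
      (fun _ _ => zero_le) (Finset.mem_univ k)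

/-- Boundedness lets Picard–Lindelöf reach the whole interval at once: a solution cannot leave the
ball of radius `M * T`. -/
theorem exists_solution_of_bddLip {V : (Fin (C + 1) → ℝ) → Fin (C + 1) → ℝ}
    (hV : ∀ k, BddLip fun ξ => V ξ k) {T : ℝ} (hT : 0 ≤ T) (ξ₀ : Fin (C + 1) → ℝ) :
    ∃ ξ : ℝ → Fin (C + 1) → ℝ, ξ 0 = ξ₀ ∧
      ∀ t ∈ Set.Icc 0 T, HasDerivWithinAt ξ (V (ξ t)) (Set.Icc 0 T) t := by
  obtain ⟨M, K, hM, hK⟩ := exists_bounds_of_bddLip hV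
  have hpl : IsPicardLindelof (fun _ => V) (⟨0, le_rfl, hT⟩ : Set.Icc 0 T) ξ₀
      (M * T.toNNReal) 0 M K :=
    { lipschitzOnWith := fun _ _ => hK.lipschitzOnWith
      continuousOn := fun _ _ => continuousOn_const
      norm_le := fun _ _ ξ _ => hM ξ
      mul_max_le := by
        simp [hT] }
  exact hpl.exists_eq_forall_mem_Icc_hasDerivWithinAt₀

/-- If `f t < 0`, let `s` be the last earlier time with `f s ≥ 0`. After `s` the function is
negative, hence nondecreasing, so `f t ≥ f s`. -/
theorem nonneg_of_deriv_nonneg_of_neg {f f' : ℝ → ℝ} {T : ℝ}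
    (hf : ∀ t ∈ Set.Icc 0 T, HasDerivWithinAt f (f' t) (Set.Icc 0 T) t) (h0 : 0 ≤ f 0)
    (h : ∀ t ∈ Set.Icc 0 T, f t < 0 → 0 ≤ f' t) : ∀ t ∈ Set.Icc 0 T, 0 ≤ f t := by
  intro t ht
  by_contra hneg
  push Not at hneg
  have hcont : ContinuousOn f (Set.Icc 0 T) := fun s hs => (hf s hs).continuousWithinAt
  have hsub : Set.Icc 0 t ⊆ Set.Icc 0 T := Set.Icc_subset_Icc_right ht.2
  set S : Set ℝ := Set.Icc 0 t ∩ f ⁻¹' Set.Ici 0 with hS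
  have hSc : IsCompact S :=
    isCompact_Icc.of_isClosed_subset
      ((hcont.mono hsub).preimage_isClosed_of_isClosed isClosed_Icc isClosed_Ici)
      Set.inter_subset_left
  have hSne : S.Nonempty := ⟨0, ⟨le_rfl, ht.1⟩, h0⟩
  obtain ⟨s, hs, hmax⟩ := hSc.exists_isGreatest hSne
  have hlt : ∀ r ∈ Set.Ioc s t, f r < 0 := by
    intro r hr
    by_contra hr'
    push Not at hr'
    have : r ≤ s := hmax ⟨⟨hs.1.1.trans hr.1.le, hr.2⟩, hr'⟩
    exact absurd hr.1 (not_lt.2 this)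
  have hsub2 : Set.Icc s t ⊆ Set.Icc 0 T := Set.Icc_subset_Icc hs.1.1 ht.2
  have hmono : MonotoneOn f (Set.Icc s t) := by
    refine monotoneOn_of_hasDerivWithinAt_nonneg (f' := f') (convex_Icc s t) (hcont.mono hsub2)
      (fun r hr => (hf r (hsub2 (interior_subset hr))).mono (interior_subset.trans hsub2))
      fun r hr => ?_
    rw [interior_Icc] at hr
    exact h r (hsub2 ⟨hr.1.le, hr.2.le⟩) (hlt r ⟨hr.1, hr.2.le⟩)
  have := hmono ⟨le_rfl, hs.1.2⟩ ⟨hs.1.2, le_rfl⟩ hs.1.2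
  have h3 : 0 ≤ f s := hs.2
  linarith

theorem sum_range_flow (c p : ℕ → ℝ) (N : ℕ) :
    ∑ k ∈ Finset.range (N + 1), flow c p k = -(c N * p N) + (N + 1) * p (N + 1) := by
  induction N with
  | zero => simp [flow]
  | succ N ih =>
    rw [Finset.sum_range_succ, ih]
    unfold flow
    simp only [Nat.add_eq_zero_iff, one_ne_zero, and_false, if_false, Nat.add_sub_cancel]
    push_cast
    ring

theorem IsSolution.continuousOn {lam : ℝ} {d : ℕ} {t₀ : ℝ} {ξ₀ : Fin (C + 1) → ℝ}
    {ξ : ℝ → Fin (C + 1) → ℝ} (h : IsSolution lam d t₀ ξ₀ ξ) : ContinuousOn ξ (Set.Icc 0 t₀) :=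
  fun t ht => (h.2 t ht).continuousWithinAt

/-- `F` is only locally Lipschitz, but two solutions on a compact interval share a bound `R`.
Truncating at `R` changes neither and makes the field globally Lipschitz, so uniqueness holds among
all solutions, not only those in the simplex. -/
theorem IsSolution.eqOn (hC : 1 ≤ C) {lam : ℝ} {d : ℕ} {t₀ : ℝ} {ξ₀ : Fin (C + 1) → ℝ}
    {ξ η : ℝ → Fin (C + 1) → ℝ} (hξ : IsSolution lam d t₀ ξ₀ ξ) (hη : IsSolution lam d t₀ ξ₀ η) :
    Set.EqOn η ξ (Set.Icc 0 t₀) := by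
  obtain ⟨R₁, hR₁⟩ := isCompact_Icc.exists_bound_of_continuousOn hξ.continuousOn
  obtain ⟨R₂, hR₂⟩ := isCompact_Icc.exists_bound_of_continuousOn hη.continuousOn
  set R := max R₁ R₂
  have hclamp : ∀ (ζ : Fin (C + 1) → ℝ), ‖ζ‖ ≤ R → clampVec (-R) R ζ = ζ := fun ζ hζ =>
    clampVec_eq fun k => abs_le.1 ((norm_le_pi_norm ζ k).trans hζ)
  have hV : ∀ k : Fin (C + 1), BddLip fun ζ => F lam d (clampVec (-R) R ζ) k := by
    intro k
    simp only [F_eq_flow hC]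
    exact bddLip_flow (bddLip_rates_clamp lam _ _ d) (bddLip_coord_clamp _ _) k
  obtain ⟨-, K, -, hK⟩ := exists_bounds_of_bddLip hV
  have hder : ∀ ζ : ℝ → Fin (C + 1) → ℝ, IsSolution lam d t₀ ξ₀ ζ →
      (∀ t ∈ Set.Icc 0 t₀, ‖ζ t‖ ≤ R) → ∀ t ∈ Set.Ico 0 t₀,
      HasDerivWithinAt ζ (F lam d (clampVec (-R) R (ζ t))) (Set.Ici t) t := by
    intro ζ hζ hb t ht
    rw [hclamp _ (hb t ⟨ht.1, ht.2.le⟩)]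
    have h1 := (hζ.2 t ⟨ht.1, ht.2.le⟩).mono
      (Set.Icc_subset_Icc_left ht.1 : Set.Icc t t₀ ⊆ Set.Icc 0 t₀)
    exact h1.mono_of_mem_nhdsWithin (Icc_mem_nhdsGE ht.2)
  exact ODE_solution_unique (v := fun _ ζ => F lam d (clampVec (-R) R ζ)) (K := K)
    (fun _ => hK) hη.continuousOn
    (hder η hη fun t ht => (hR₂ t ht).trans (le_max_right _ _)) hξ.continuousOn
    (hder ξ hξ fun t ht => (hR₁ t ht).trans (le_max_left _ _)) (hη.1.trans hξ.1.symm)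

/-- A truncated field has a solution on the whole interval, and that solution stays in the simplex:
at a negative coordinate the outflow vanishes and the inflow is nonnegative, while the total mass is
constant because the flow telescopes. On the simplex the truncation is invisible. -/
theorem exists_isSolution (hC : 1 ≤ C) {lam : ℝ} (hlam : 0 ≤ lam) (d : ℕ) {t₀ : ℝ} (ht₀ : 0 ≤ t₀)
    {ξ₀ : Fin (C + 1) → ℝ} (hξ₀ : IsProfile ξ₀) :
    ∃ ξ : ℝ → Fin (C + 1) → ℝ, IsSolution lam d t₀ ξ₀ ξ ∧
      ∀ t ∈ Set.Icc 0 t₀, IsProfile (ξ t) := by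
  -- A clamped vector need not have total mass 1, so its `rates` may be negative; the positive part
  -- secures nonnegative inflow.
  set V : (Fin (C + 1) → ℝ) → Fin (C + 1) → ℝ := fun ξ k =>
    flow (fun j => max (rates lam d (clampVec 0 1 ξ) j) 0) (coord (clampVec 0 1 ξ)) k with hVdef
  have hV : ∀ k, BddLip fun ξ => V ξ k := fun k =>
    bddLip_flow (fun j => (bddLip_rates_clamp lam 0 1 d j).max_zero) (bddLip_coord_clamp 0 1) k
  obtain ⟨ξ, h0, hξ⟩ := exists_solution_of_bddLip hV ht₀ ξ₀
  have hcoord : ∀ t ∈ Set.Icc 0 t₀, ∀ k,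
      HasDerivWithinAt (fun t => ξ t k) (V (ξ t) k) (Set.Icc 0 t₀) t := fun t ht k =>
    hasDerivWithinAt_pi.1 (hξ t ht) k
  have hpos : ∀ (ζ : Fin (C + 1) → ℝ) k, 0 ≤ coord (clampVec 0 1 ζ) k :=
    fun ζ k => coord_nonneg (fun k => le_max_left _ _) k
  have hnn : ∀ k, ∀ t ∈ Set.Icc 0 t₀, 0 ≤ ξ t k := by
    intro k
    refine nonneg_of_deriv_nonneg_of_neg (fun t ht => hcoord t ht k) ?_ fun t ht hneg => ?_
    · rw [h0]; exact hξ₀.1 k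
    · have hz : coord (clampVec 0 1 (ξ t)) k = 0 := by
        unfold coord clampVec
        rw [dif_pos k.2]
        exact max_eq_left ((min_le_right _ _).trans hneg.le)
      simp only [hVdef, flow, hz, mul_zero, sub_zero]
      refine add_nonneg ?_ (mul_nonneg (by positivity) (hpos _ _))
      split_ifs
      · exact le_rfl
      · exact mul_nonneg (le_max_right _ _) (hpos _ _)
  have hsum : ∀ t ∈ Set.Icc 0 t₀, ∑ k, ξ t k = 1 := by
    intro t ht
    have hder : ∀ t ∈ Set.Icc 0 t₀,
        HasDerivWithinAt (fun t => ∑ k, ξ t k) 0 (Set.Icc 0 t₀) t := by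
      intro t ht
      have h1 : HasDerivWithinAt (fun t => ∑ k, ξ t k) (∑ k, V (ξ t) k) (Set.Icc 0 t₀) t :=
        HasDerivWithinAt.fun_sum fun k _ => hcoord t ht k
      have h2 : ∑ k, V (ξ t) k = 0 := by
        simp only [hVdef]
        rw [Fin.sum_univ_eq_sum_range (fun k => flow (fun j => max (rates lam d
          (clampVec 0 1 (ξ t)) j) 0) (coord (clampVec 0 1 (ξ t))) k), sum_range_flow]
        simp [rates, coord_of_lt]
      rwa [h2] at h1
    have h3 := constant_of_has_deriv_right_zero (f := fun t => ∑ k, ξ t k)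
      (fun t ht => (hder t ht).continuousWithinAt)
      (fun t ht => ((hder t ⟨ht.1, ht.2.le⟩).mono
        (Set.Icc_subset_Icc_left ht.1 : Set.Icc t t₀ ⊆ Set.Icc 0 t₀)).mono_of_mem_nhdsWithin
        (Icc_mem_nhdsGE ht.2)) t ht
    rw [h3, h0, hξ₀.2]
  have hprof : ∀ t ∈ Set.Icc 0 t₀, IsProfile (ξ t) := fun t ht =>
    ⟨fun k => hnn k t ht, hsum t ht⟩
  refine ⟨ξ, ⟨h0, fun t ht => ?_⟩, hprof⟩
  have h1 : V (ξ t) = F lam d (ξ t) := by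
    ext k
    have h2 : clampVec 0 1 (ξ t) = ξ t := clampVec_eq fun k => ⟨hnn k t ht, by
      have := coord_le_one (hprof t ht) k
      rwa [coord, dif_pos k.2] at this⟩
    have h3 : (fun j => max (rates lam d (ξ t) j) 0) = rates lam d (ξ t) :=
      funext fun j => max_eq_left (rates_nonneg hlam (hprof t ht) d j)
    simp only [hVdef]
    rw [F_eq_flow hC, h2, h3]
  rw [← h1]
  exact hξ t ht

@[fun_prop]
theorem continuous_coord (k : ℕ) : Continuous fun ξ : Fin (C + 1) → ℝ => coord ξ k := by
  unfold coord
  split_ifs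
  · exact continuous_apply _
  · exact continuous_const

@[fun_prop]
theorem continuous_cum (i : ℕ) : Continuous fun ξ : Fin (C + 1) → ℝ => cum ξ i := by
  unfold cum
  fun_prop

@[fun_prop]
theorem continuous_choiceSum (d i : ℕ) :
    Continuous fun ξ : Fin (C + 1) → ℝ => choiceSum d ξ i := by
  unfold choiceSum
  fun_prop

@[fun_prop]
theorem continuous_g (d i : ℕ) : Continuous fun ξ : Fin (C + 1) → ℝ => g d i ξ := by
  unfold g
  fun_prop

theorem continuous_F (lam : ℝ) (d : ℕ) :
    Continuous fun ξ : Fin (C + 1) → ℝ => F lam d ξ := by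
  refine continuous_pi fun k => ?_
  unfold F
  split_ifs <;> fun_prop

/-- One Euler step of the solution, uniformly along a fine grid. -/
theorem IsSolution.eventually_step {lam : ℝ} {d : ℕ} {T : ℝ} (hT : 0 < T)
    {ξ₀ : Fin (C + 1) → ℝ} {ξ : ℝ → Fin (C + 1) → ℝ} (h : IsSolution lam d T ξ₀ ξ)
    {η : ℝ} (hη : 0 < η) :
    ∀ᶠ N : ℕ in Filter.atTop, ∀ i < N, ∀ k : Fin (C + 1),
      |ξ (T / N * (i + 1 : ℕ)) k - ξ (T / N * i) k - T / N * F lam d (ξ (T / N * i)) k|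
        ≤ T / N * η := by
  have huc : UniformContinuousOn (fun t => F lam d (ξ t)) (Set.Icc 0 T) :=
    isCompact_Icc.uniformContinuousOn_of_continuous
      ((continuous_F lam d).comp_continuousOn h.continuousOn)
  obtain ⟨δ, hδ, hF⟩ := Metric.uniformContinuousOn_iff_le.1 huc η hη
  filter_upwards [(tendsto_const_div_atTop_nhds_zero_nat T).eventually (gt_mem_nhds hδ),
    Filter.eventually_gt_atTop 0] with N hN hN0 i hi k
  have hN0' : (0 : ℝ) < N := by exact_mod_cast hN0
  have hd : 0 < T / N := div_pos hT hN0'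
  set a := T / N * i with ha
  have hb : T / N * (i + 1 : ℕ) = a + T / N := by rw [ha]; push_cast; ring
  rw [hb]
  have ha0 : 0 ≤ a := by positivity
  have hbT : a + T / N ≤ T := by
    rw [← hb, div_mul_eq_mul_div, div_le_iff₀ hN0']
    exact mul_le_mul_of_nonneg_left (by exact_mod_cast hi) hT.le
  have hsub : Set.Icc a (a + T / N) ⊆ Set.Icc 0 T := Set.Icc_subset_Icc ha0 hbT
  -- The mean value inequality is applied to the solution minus its linear part at `a`; uniform
  -- continuity of `F` along the solution makes this derivative small.
  have hder : ∀ t ∈ Set.Icc a (a + T / N), HasDerivWithinAt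
      (fun t => ξ t k - t * F lam d (ξ a) k) (F lam d (ξ t) k - 1 * F lam d (ξ a) k)
      (Set.Icc a (a + T / N)) t := fun t ht =>
    ((hasDerivWithinAt_pi.1 (h.2 t (hsub ht)) k).mono hsub).sub
      ((hasDerivWithinAt_id t _).mul_const _)
  have hbd : ∀ t ∈ Set.Icc a (a + T / N), ‖F lam d (ξ t) k - 1 * F lam d (ξ a) k‖ ≤ η := by
    intro t ht
    have h1 := hF t (hsub ht) a (hsub ⟨le_rfl, by linarith⟩) (by
      rw [Real.dist_eq, abs_of_nonneg (by linarith [ht.1])]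
      linarith [ht.2])
    rw [one_mul]
    exact (norm_le_pi_norm (F lam d (ξ t) - F lam d (ξ a)) k).trans (by rwa [← dist_eq_norm])
  have := (convex_Icc a (a + T / N)).norm_image_sub_le_of_norm_hasDerivWithin_le hder hbd
    (⟨le_rfl, by linarith⟩ : a ∈ Set.Icc a (a + T / N)) ⟨by linarith, le_rfl⟩
  rw [Real.norm_eq_abs, Real.norm_eq_abs, add_sub_cancel_left, abs_of_pos hd, mul_comm η] at this
  refine le_trans (le_of_eq ?_) this
  congr 1
  ring

end Solution

/-! ### Numerical consequences of the lower bound on n -/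

section Numerics

variable {lam t₀ : ℝ} {d C n : ℕ}

theorem two_le_add_one_div {x : ℝ} (hx : 0 < x) : 2 ≤ x + 1 / x := by
  have h : x + 1 / x - 2 = (x - 1) ^ 2 / x := by field_simp; ring
  have : 0 ≤ (x - 1) ^ 2 / x := by positivity
  linarith

theorem gam_pos (hlam : 0 < lam) (ht₀ : 0 < t₀) (hd : 1 ≤ d) : 0 < gam lam d C t₀ := by
  have : (0 : ℝ) < d := by exact_mod_cast hd
  unfold gam
  positivity

/-- The inner bracket is the number `s` of the tail estimate, where an exponent `1 / (2 * s)` is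
available; γ does not exceed it. -/
theorem gam_mul_le (hlam : 0 < lam) (ht₀ : 0 < t₀) (hd : 1 ≤ d) :
    gam lam d C t₀ * (2 * (64 * (3 * lam * d + C) * t₀ + 1)) ≤ 1 := by
  have hd' : (1 : ℝ) ≤ d := by exact_mod_cast hd
  have hC' : (0 : ℝ) ≤ C := Nat.cast_nonneg C
  unfold gam
  rw [one_div, inv_mul_le_iff₀ (by positivity), mul_one]
  have h1 : (1 : ℝ) ≤ Real.exp (800 * d * lam * t₀) := Real.one_le_exp (by positivity)
  have h2 : 8 * lam * t₀ + 1 ≤ (8 * lam * t₀ + 1) ^ 3 :=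
    le_self_pow₀ (by nlinarith [mul_pos hlam ht₀]) (by norm_num)
  have h3 : (d : ℝ) ≤ d ^ 8 := le_self_pow₀ hd' (by norm_num)
  have h4 : C / lam ≤ (d : ℝ) ^ 4 * C / lam := by
    gcongr
    nlinarith [one_le_pow₀ hd' (n := 4)]
  calc 2 * (64 * (3 * lam * d + C) * t₀ + 1)
      ≤ 2 ^ 25 * ((d : ℝ) + C / lam) * (8 * lam * t₀ + 1) * 1 := by
        have h5 : ((d : ℝ) + C / lam) * (8 * lam * t₀ + 1) =
            8 * (d * (lam * t₀)) + 8 * (C * t₀) + d + C / lam := by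
          field_simp
          ring
        have h6 : 0 ≤ (C : ℝ) / lam := by positivity
        have h7 : 0 ≤ (C : ℝ) * t₀ := by positivity
        have h8 : 0 ≤ (d : ℝ) * (lam * t₀) := by positivity
        rw [mul_assoc (2 ^ 25 : ℝ), h5]
        nlinarith
    _ ≤ _ := by gcongr

theorem le_sqrt_of_nZero_le (hn : nZero lam d C t₀ ≤ n) :
    2 ^ 9 * (lam + 1 / lam) ^ 2 * (d : ℝ) ^ 2 * ((C : ℝ) + 1) ^ 3 * (t₀ + 1 / t₀) ≤
      Real.sqrt n := by
  refine Real.le_sqrt_of_sq_le (le_trans (le_of_eq ?_) ((le_max_left _ _).trans hn))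
  ring

theorem sq_le_sqrt_of_nZero_le (hlam : 0 < lam) (ht₀ : 0 < t₀) (hd : 1 ≤ d)
    (hn : nZero lam d C t₀ ≤ n) : 2 ^ 12 * ((C : ℝ) + 1) ^ 3 ≤ Real.sqrt n := by
  refine le_trans ?_ (le_sqrt_of_nZero_le hn)
  have hd' : (1 : ℝ) ≤ d := by exact_mod_cast hd
  calc 2 ^ 12 * ((C : ℝ) + 1) ^ 3 = 2 ^ 9 * 2 ^ 2 * 1 ^ 2 * ((C : ℝ) + 1) ^ 3 * 2 := by ring
    _ ≤ _ := by
      gcongr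
      · exact two_le_add_one_div hlam
      · exact two_le_add_one_div ht₀

theorem le_cast_of_nZero_le (hlam : 0 < lam) (ht₀ : 0 < t₀) (hd : 1 ≤ d)
    (hn : nZero lam d C t₀ ≤ n) : 2 ^ 24 * ((C : ℝ) + 1) ^ 2 ≤ n := by
  have h1 := sq_le_sqrt_of_nZero_le hlam ht₀ hd hn
  have hC : (1 : ℝ) ≤ (C : ℝ) + 1 := by linarith [Nat.cast_nonneg (α := ℝ) C]
  have h2 : ((C : ℝ) + 1) ≤ ((C : ℝ) + 1) ^ 3 := le_self_pow₀ hC (by norm_num)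
  calc 2 ^ 24 * ((C : ℝ) + 1) ^ 2 = (2 ^ 12 * ((C : ℝ) + 1)) ^ 2 := by ring
    _ ≤ Real.sqrt n ^ 2 := by
      gcongr
      linarith
    _ = n := Real.sq_sqrt (Nat.cast_nonneg n)

theorem three_le_of_nZero_le (hlam : 0 < lam) (ht₀ : 0 < t₀) (hd : 1 ≤ d)
    (hn : nZero lam d C t₀ ≤ n) : 3 ≤ n := by
  have h1 := le_cast_of_nZero_le hlam ht₀ hd hn
  have h2 : (1 : ℝ) ≤ ((C : ℝ) + 1) ^ 2 :=
    one_le_pow₀ (by linarith [Nat.cast_nonneg (α := ℝ) C])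
  have : (3 : ℝ) ≤ n := by nlinarith
  exact_mod_cast this

/-- With `y = n ^ (1/4) ≥ 64` one has `log n = 4 log y ≤ 4 y` and `32 y ≤ y ^ 2`. This keeps the
exponential parameter within `8 * θ ≤ 1`. -/
theorem eight_mul_log_le (hlam : 0 < lam) (ht₀ : 0 < t₀) (hd : 1 ≤ d)
    (hn : nZero lam d C t₀ ≤ n) : 8 * Real.log n ≤ Real.sqrt n := by
  have h1 := le_cast_of_nZero_le hlam ht₀ hd hn
  have hC : (1 : ℝ) ≤ ((C : ℝ) + 1) ^ 2 :=
    one_le_pow₀ (by linarith [Nat.cast_nonneg (α := ℝ) C])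
  have hn0 : (0 : ℝ) < n := by nlinarith
  have h2 : (2 : ℝ) ^ 12 ≤ Real.sqrt n := Real.le_sqrt_of_sq_le (by nlinarith)
  have h3 : (2 : ℝ) ^ 6 ≤ Real.sqrt (Real.sqrt n) := Real.le_sqrt_of_sq_le (by linarith)
  have h4 : Real.log n = 4 * Real.log (Real.sqrt (Real.sqrt n)) := by
    rw [Real.log_sqrt (Real.sqrt_nonneg _), Real.log_sqrt hn0.le]; ring
  have h5 := Real.log_le_sub_one_of_pos (show 0 < Real.sqrt (Real.sqrt n) by linarith)
  have h6 : Real.sqrt (Real.sqrt n) * Real.sqrt (Real.sqrt n) = Real.sqrt n :=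
    Real.mul_self_sqrt (Real.sqrt_nonneg _)
  nlinarith

theorem eight_le_gam_mul_log (hlam : 0 < lam) (ht₀ : 0 < t₀) (hd : 1 ≤ d)
    (hn : nZero lam d C t₀ ≤ n) : 8 ≤ gam lam d C t₀ * Real.log n := by
  have h0 := gam_pos (C := C) hlam ht₀ hd
  have h1 : Real.exp (8 / gam lam d C t₀) ≤ n := (le_max_right _ _).trans hn
  have h2 := Real.log_le_log (Real.exp_pos _) h1
  rw [Real.log_exp, div_le_iff₀ h0] at h2
  linarith

theorem one_le_log (hlam : 0 < lam) (ht₀ : 0 < t₀) (hd : 1 ≤ d)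
    (hn : nZero lam d C t₀ ≤ n) : 1 ≤ Real.log n := by
  have h0 := gam_pos (C := C) hlam ht₀ hd
  have h1 := eight_le_gam_mul_log hlam ht₀ hd hn
  have h2 := gam_mul_le (C := C) hlam ht₀ hd
  have h3 : gam lam d C t₀ ≤ 1 := by
    refine le_trans ?_ h2
    refine le_mul_of_one_le_right h0.le ?_
    have : 0 ≤ 64 * (3 * lam * d + C) * t₀ := by positivity
    linarith
  nlinarith

end Numerics

/-! ### Simultaneous concentration of all observables -/

section Statistics

variable {n C : ℕ}

/-- The family of observables whose fluctuations control the process. -/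
abbrev Stat (n C : ℕ) : Type :=
  (Fin n × Fin (C + 1)) ⊕ (Pair n × Fin (C + 1) × Fin (C + 1)) ⊕ Pair n

/-- The observable with a given index. -/
def stat : Stat n C → (Route n → ℕ) → ℝ
  | .inl p => cnt p.1 p.2
  | .inr (.inl p) => pairDev p.1.1.1 p.1.1.2 p.2.1 p.2.2
  | .inr (.inr p) => altCalls ⟨s(p.1.1, p.1.2), by simpa using p.2⟩

/-- A common variation bound lets a single exponential estimate serve all three kinds of observable.
-/
theorem exists_local_stat (hn : 3 ≤ n) (s : Stat n C) :
    ∃ u v : Fin n, Local (stat s) fun r => 2 * (deg u r + deg v r) := by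
  obtain ⟨v, k⟩ | ⟨⟨⟨u, v⟩, huv⟩, j, k⟩ | ⟨⟨u, v⟩, huv⟩ := s
  · refine ⟨v, v, Local.mono (H := cnt v k) (local_cntOn (Finset.univ.erase v) v k) fun r => ?_⟩
    have h1 := sum_mem_links_le_deg (s := Finset.univ.erase v) (v := v) (by simp) r
    have h2 := deg_nonneg v r
    linarith
  · exact ⟨u, v, local_pairDev hn huv j k⟩
  · refine ⟨u, v, (local_altCalls u v huv).mono fun r => ?_⟩
    have h1 := deg_nonneg u r
    have h2 := deg_nonneg v r
    linarith

theorem expGenerator_stat_le {lam : ℝ} (hlam : 0 ≤ lam) (hn : 3 ≤ n) {d : ℕ} (hd : 1 ≤ d)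
    (s : Stat n C) {θ : ℝ} (hθ : 0 ≤ θ) (hθ1 : 8 * θ ≤ 1) {ε : ℝ} (hε : ε ^ 2 = 1)
    (x : State n C) :
    ∑ y, generator n C lam d x y * Real.exp (θ * (ε * stat s y.1 - ε * stat s x.1)) ≤
      θ * drift lam d (fun y => ε * stat s y.1) x + θ ^ 2 * (32 * n * (3 * lam * d + C)) := by
  obtain ⟨u, v, huv⟩ := exists_local_stat hn s
  refine expGenerator_le hlam (by omega) d huv hθ (fun r => ?_) _ ε hε x ?_
  · have h1 := deg_le u r
    have h2 := deg_le v r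
    nlinarith
  · have h1 := sum_mul_deg_le hlam hd hn x u
    have h2 := sum_mul_deg_le hlam hd hn x v
    -- As `deg u + deg v ≤ 4`, its square is at most four times itself. Two sums linear in degree
    -- remain, each with coefficient 16.
    calc ∑ r, (arr lam d x r + x.1 r) * (2 * (deg u r + deg v r)) ^ 2
        ≤ ∑ r, 16 * ((arr lam d x r + x.1 r) * deg u r + (arr lam d x r + x.1 r) * deg v r) := by
          refine Finset.sum_le_sum fun r _ => ?_
          have h3 : 0 ≤ arr lam d x r + x.1 r :=
            add_nonneg (arr_nonneg hlam (by omega) d x r) (Nat.cast_nonneg _)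
          have h4 := deg_le u r
          have h5 := deg_le v r
          have h6 := deg_nonneg u r
          have h7 := deg_nonneg v r
          rw [← mul_add, mul_left_comm]
          refine mul_le_mul_of_nonneg_left ?_ h3
          nlinarith
      _ ≤ _ := by
          rw [← Finset.mul_sum, Finset.sum_add_distrib]
          linarith

theorem comp_const_mul {Ω : Type*} (lam : ℝ) (d : ℕ) (T : ℝ≥0) (X : ℝ≥0 → Ω → State n C)
    (h : State n C → ℝ) (ε : ℝ) (N k : ℕ) (ω : Ω) :
    comp lam d T X (fun y => ε * h y) N k ω = ε * comp lam d T X h N k ω := by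
  have h1 : ∀ x, drift lam d (fun y => ε * h y) x = ε * drift lam d h x := fun x => by
    unfold drift
    rw [Finset.mul_sum]
    exact Finset.sum_congr rfl fun _ _ => by ring
  unfold comp
  simp only [h1]
  rw [← Finset.mul_sum]
  ring

/-- The compensated observables stay within `a` of zero along the whole grid. -/
def GoodPath {Ω : Type*} (lam : ℝ) (d : ℕ) (T : ℝ≥0) (X : ℝ≥0 → Ω → State n C) (a : ℝ) (N : ℕ)
    (ω : Ω) : Prop :=
  ∀ (s : Stat n C) (k : ℕ), k ≤ N → |comp lam d T X (fun y => stat s y.1) N k ω| ≤ a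

theorem eventually_prob_not_goodPath_le {Ω : Type*} [MeasurableSpace Ω] {μ : Measure Ω}
    [IsProbabilityMeasure μ] {lam : ℝ} (hlam : 0 ≤ lam) (hn : 3 ≤ n) {d : ℕ} (hd : 1 ≤ d)
    {X : ℝ≥0 → Ω → State n C} (hX : IsProcess μ lam d X) {T : ℝ≥0} (hT : 0 < T) {θ : ℝ}
    (hθ : 0 < θ) (hθ1 : 8 * θ ≤ 1) (a : ℝ) :
    ∀ᶠ N : ℕ in Filter.atTop, μ.real {ω | ¬ GoodPath lam d T X a N ω} ≤
      Fintype.card (Stat n C) *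
        (2 * Real.exp (-(θ * a) + T * (θ ^ 2 * (32 * n * (3 * lam * d + C))) + 1)) := by
  have key : ∀ ε : ℝ, ε ^ 2 = 1 → ∀ᶠ N : ℕ in Filter.atTop, ∀ s : Stat n C,
      μ.real {ω | ∃ k, k ≤ N ∧ a ≤ comp lam d T X (fun y => ε * stat s y.1) N k ω} ≤
        Real.exp (-(θ * a) + T * (θ ^ 2 * (32 * n * (3 * lam * d + C))) + 1) := fun ε hε =>
    Filter.eventually_all.2 fun s => prob_comp_ge_le hlam (by omega) hX hT _ (by positivity) hθ
      (fun x => expGenerator_stat_le hlam hn hd s hθ.le hθ1 hε x) a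
  filter_upwards [key 1 (by norm_num), key (-1) (by norm_num)] with N h1 h2
  have hsub : {ω | ¬ GoodPath lam d T X a N ω} ⊆ ⋃ s : Stat n C,
      {ω | ∃ k, k ≤ N ∧ a ≤ comp lam d T X (fun y => 1 * stat s y.1) N k ω} ∪
      {ω | ∃ k, k ≤ N ∧ a ≤ comp lam d T X (fun y => -1 * stat s y.1) N k ω} := by
    intro ω hω
    simp only [GoodPath, Set.mem_ofPred_eq, not_forall, not_le] at hω
    obtain ⟨s, k, hk, h⟩ := hω
    refine Set.mem_iUnion.2 ⟨s, ?_⟩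
    rcases lt_abs.1 h with h | h
    · refine Or.inl ⟨k, hk, ?_⟩
      rw [comp_const_mul lam d T X (fun y => stat s y.1), one_mul]
      exact h.le
    · refine Or.inr ⟨k, hk, ?_⟩
      rw [comp_const_mul lam d T X (fun y => stat s y.1), neg_one_mul]
      exact h.le
  refine (measureReal_mono hsub (measure_ne_top _ _)).trans ?_
  refine (measureReal_iUnion_fintype_le _).trans ?_
  refine (Finset.sum_le_card_nsmul _ _ _ fun s _ =>
    (measureReal_union_le _ _).trans (add_le_add (h1 s) (h2 s))).trans_eq ?_
  rw [nsmul_eq_mul, Finset.card_univ]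
  ring

theorem card_stat_le (hn : 1 ≤ n) :
    (Fintype.card (Stat n C) : ℝ) ≤ 3 * ((n : ℝ) ^ 2 * ((C : ℝ) + 1) ^ 2) := by
  have h1 : Fintype.card (Pair n) ≤ n ^ 2 :=
    (Fintype.card_subtype_le _).trans (by simp [sq])
  have h2 : (Fintype.card (Pair n) : ℝ) ≤ (n : ℝ) ^ 2 := by exact_mod_cast h1
  have hn' : (1 : ℝ) ≤ n := by exact_mod_cast hn
  have hC : (1 : ℝ) ≤ (C : ℝ) + 1 := by linarith [Nat.cast_nonneg (α := ℝ) C]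
  simp only [Fintype.card_sum, Fintype.card_prod, Fintype.card_fin]
  push_cast
  have h3 : (n : ℝ) * (C + 1) ≤ (n : ℝ) ^ 2 * ((C : ℝ) + 1) ^ 2 := by
    gcongr
    · exact le_self_pow₀ hn' (by norm_num)
    · exact le_self_pow₀ hC (by norm_num)
  have h4 : (Fintype.card (Pair n) : ℝ) * (((C : ℝ) + 1) * (C + 1)) ≤
      (n : ℝ) ^ 2 * ((C : ℝ) + 1) ^ 2 := by
    rw [← sq]
    gcongr
  have h5 : (Fintype.card (Pair n) : ℝ) ≤ (n : ℝ) ^ 2 * ((C : ℝ) + 1) ^ 2 :=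
    h2.trans (le_mul_of_one_le_right (by positivity) (one_le_pow₀ hC))
  linarith

theorem eventually_prob_not_goodPath_le_exp {Ω : Type*} [MeasurableSpace Ω] {μ : Measure Ω}
    [IsProbabilityMeasure μ] {lam : ℝ} (hlam : 0 < lam) {d : ℕ} (hd : 1 ≤ d)
    {X : ℝ≥0 → Ω → State n C} (hX : IsProcess μ lam d X) {T : ℝ≥0} (hT : 0 < T)
    (hn : nZero lam d C T ≤ n) :
    ∀ᶠ N : ℕ in Filter.atTop,
      μ.real {ω | ¬ GoodPath lam d T X (Real.sqrt n * Real.log n) N ω} ≤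
        Real.exp (-(1 / 2) * gam lam d C T * Real.log n ^ 2) := by
  have hT' : (0 : ℝ) < T := by exact_mod_cast hT
  have hC : (1 : ℝ) ≤ ((C : ℝ) + 1) ^ 2 :=
    one_le_pow₀ (by linarith [Nat.cast_nonneg (α := ℝ) C])
  have hn1 := le_cast_of_nZero_le hlam hT' hd hn
  have hn2 := eight_mul_log_le hlam hT' hd hn
  have hn3 := eight_le_gam_mul_log hlam hT' hd hn
  have hn4 := one_le_log hlam hT' hd hn
  have hg := gam_mul_le (C := C) hlam hT' hd
  have hg0 := gam_pos (C := C) hlam hT' hd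
  have hn5 : (2 : ℝ) ^ 24 ≤ n := by nlinarith
  have hn6 := three_le_of_nZero_le hlam hT' hd hn
  have hn0 : (0 : ℝ) < n := by linarith
  have hsq : Real.sqrt n ^ 2 = n := Real.sq_sqrt hn0.le
  have hsq0 : 0 < Real.sqrt n := Real.sqrt_pos.2 hn0
  set l := Real.log n with hl
  set b := (3 * lam * d + C) * (T : ℝ) with hb
  have hb0 : 0 ≤ b := by positivity
  set s := 64 * b + 1 with hs
  have hs' : 2 * (64 * (3 * lam * d + C) * (T : ℝ) + 1) = 2 * s := by rw [hs, hb]; ring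
  rw [hs'] at hg
  have hs1 : 1 ≤ s := by linarith
  -- The variance term over `[0, T]` is `32 * n * b * θ ^ 2`. With `s = 64 * b + 1` this choice of θ
  -- leaves the exponent `l ^ 2 * (s - 32 * b) / s ^ 2`, at least `l ^ 2 / (2 * s)`.
  filter_upwards [eventually_prob_not_goodPath_le hlam.le hn6 hd hX hT
    (θ := l / (Real.sqrt n * s)) (by positivity) (by
      rw [mul_div_assoc', div_le_one (by positivity)]
      exact hn2.trans (le_mul_of_one_le_right hsq0.le hs1)) (Real.sqrt n * l)] with N hN
  refine hN.trans ?_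
  have h1 : -(l / (Real.sqrt n * s) * (Real.sqrt n * l)) +
      T * ((l / (Real.sqrt n * s)) ^ 2 * (32 * n * (3 * lam * d + C))) + 1 ≤
      -(gam lam d C T * l ^ 2) + 1 := by
    have h2 : -(l / (Real.sqrt n * s) * (Real.sqrt n * l)) +
      T * ((l / (Real.sqrt n * s)) ^ 2 * (32 * n * (3 * lam * d + C))) =
      -(l ^ 2 * ((s - 32 * b) / s ^ 2)) := by
      rw [div_pow, mul_pow, hsq, hb]
      field_simp
      ring
    rw [h2]
    have h3 : gam lam d C T ≤ (s - 32 * b) / s ^ 2 := by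
      rw [le_div_iff₀ (by positivity)]
      nlinarith
    nlinarith [mul_le_mul_of_nonneg_left h3 (sq_nonneg l)]
  -- Half of the exponent pays for the union bound: it is worth `n ^ 4` because `γ log n ≥ 8`.
  have h2 : (n : ℝ) ^ 4 ≤ Real.exp (1 / 2 * gam lam d C T * l ^ 2) := by
    have h3 : (n : ℝ) ^ 4 = Real.exp (4 * l) := by
      rw [hl, ← Real.exp_log (pow_pos hn0 4), Real.log_pow]; norm_num
    rw [h3, Real.exp_le_exp]
    nlinarith
  have h3 : (Fintype.card (Stat n C) : ℝ) * (2 * Real.exp 1) ≤ (n : ℝ) ^ 4 := by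
    have h4 := card_stat_le (C := C) (show 1 ≤ n by omega)
    have h5 := Real.exp_one_lt_d9
    calc (Fintype.card (Stat n C) : ℝ) * (2 * Real.exp 1)
        ≤ 3 * ((n : ℝ) ^ 2 * ((C : ℝ) + 1) ^ 2) * 6 := by gcongr; linarith
      _ = (n : ℝ) ^ 2 * (18 * ((C : ℝ) + 1) ^ 2) := by ring
      _ ≤ (n : ℝ) ^ 2 * (n * n) := by
          refine mul_le_mul_of_nonneg_left ?_ (by positivity)
          nlinarith
      _ = (n : ℝ) ^ 4 := by ring
  calc (Fintype.card (Stat n C) : ℝ) * (2 * Real.exp (-(l / (Real.sqrt n * s) *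
        (Real.sqrt n * l)) + T * ((l / (Real.sqrt n * s)) ^ 2 *
        (32 * n * (3 * lam * d + C))) + 1))
      ≤ (Fintype.card (Stat n C) : ℝ) * (2 * Real.exp (-(gam lam d C T * l ^ 2) + 1)) := by
        gcongr
    _ = (Fintype.card (Stat n C) : ℝ) * (2 * Real.exp 1) * Real.exp (-(gam lam d C T * l ^ 2)) := by
        rw [Real.exp_add]; ring
    _ ≤ Real.exp (1 / 2 * gam lam d C T * l ^ 2) * Real.exp (-(gam lam d C T * l ^ 2)) := by
        gcongr
        exact h3.trans h2
    _ = _ := by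
        rw [← Real.exp_add]
        congr 1
        ring

end Statistics

/-! ### Distance of the counts from a profile -/

section Discrepancy

variable {n C : ℕ}

theorem abs_cnt_sub_le_discrepancy (ξ : Fin (C + 1) → ℝ) (x : State n C) (v : Fin n)
    (k : Fin (C + 1)) : |cnt v k x.1 - ((n : ℝ) - 1) * ξ k| ≤ discrepancy ξ x := by
  rw [← cast_count]
  refine le_ciSup_of_le (Set.finite_range _).bddAbove v ?_
  exact le_ciSup_of_le (Set.finite_range _).bddAbove k le_rfl

theorem discrepancy_le (hn : 1 ≤ n) (ξ : Fin (C + 1) → ℝ) (x : State n C) {M : ℝ}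
    (h : ∀ v, ∀ k : Fin (C + 1), |cnt v k x.1 - ((n : ℝ) - 1) * ξ k| ≤ M) :
    discrepancy ξ x ≤ M := by
  have : Nonempty (Fin n) := ⟨⟨0, by omega⟩⟩
  refine ciSup_le fun v => ciSup_le fun k => ?_
  rw [cast_count]
  exact h v k

theorem discrepancy_nonneg (hn : 1 ≤ n) (ξ : Fin (C + 1) → ℝ) (x : State n C) :
    0 ≤ discrepancy ξ x :=
  (abs_nonneg _).trans (abs_cnt_sub_le_discrepancy ξ x ⟨0, by omega⟩ 0)

theorem abs_profile_sub_le (hn : 3 ≤ n) (ξ : Fin (C + 1) → ℝ) (x : State n C) (v : Fin n)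
    (k : Fin (C + 1)) : |profile v x k - ξ k| ≤ discrepancy ξ x / ((n : ℝ) - 1) := by
  have h1 : (0 : ℝ) < (n : ℝ) - 1 := by linarith [two_lt_cast hn]
  rw [le_div_iff₀ h1, ← abs_of_pos h1, ← abs_mul]
  have h2 : (profile v x k - ξ k) * ((n : ℝ) - 1) = cnt v k x.1 - ((n : ℝ) - 1) * ξ k := by
    unfold profile
    field_simp
  rw [h2]
  exact abs_cnt_sub_le_discrepancy ξ x v k

/-- Compare first with `F` at the profile of `v`, then move to `ξ` by the Lipschitz bound. The two
profiles differ by at most `discrepancy / (n - 1)`, so the factor `n - 1` cancels. -/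
theorem abs_gen_cnt_sub_F_le_discrepancy {lam : ℝ} (hlam : 0 ≤ lam) (hn : 3 ≤ n) {d : ℕ}
    (hd : 1 ≤ d) (hC : 1 ≤ C) (x : State n C) (v : Fin n) (k : Fin (C + 1))
    {ξ : Fin (C + 1) → ℝ} (hξ : IsProfile ξ) :
    |gen lam d x (cnt v k) - ((n : ℝ) - 1) * F lam d ξ k| ≤
      6 * rateConst lam d C * discrepancy ξ x + 12 * rateConst lam d C * (psi x + 2) := by
  have h1 : (0 : ℝ) < (n : ℝ) - 1 := by linarith [two_lt_cast hn]
  have h2 := abs_gen_cnt_sub_F_le hlam hn hd hC x v k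
  have h3 := abs_F_sub_le hC hlam hd (isProfile_profile hn v x) hξ
    (abs_profile_sub_le hn ξ x v) k
  obtain ⟨b1, b2, b3, b4, b5⟩ := rateConst_bounds (C := C) hlam hd hC
  have hX : 0 ≤ lam * (d : ℝ) ^ 2 * ((C : ℝ) + 1) ^ 2 := by positivity
  have h4 : 6 * lam * d + 2 * C + 16 * lam * C * (d : ℝ) ^ 2 ≤ 6 * rateConst lam d C := by
    nlinarith
  have h5 : 0 ≤ discrepancy ξ x / ((n : ℝ) - 1) :=
    div_nonneg (discrepancy_nonneg (by omega) ξ x) h1.le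
  have h6 : |((n : ℝ) - 1) * F lam d (profile v x) k - ((n : ℝ) - 1) * F lam d ξ k| ≤
      6 * rateConst lam d C * discrepancy ξ x := by
    rw [← mul_sub, abs_mul, abs_of_pos h1]
    calc ((n : ℝ) - 1) * |F lam d (profile v x) k - F lam d ξ k|
        ≤ ((n : ℝ) - 1) * (6 * rateConst lam d C * (discrepancy ξ x / ((n : ℝ) - 1))) :=
          mul_le_mul_of_nonneg_left (h3.trans (mul_le_mul_of_nonneg_right h4 h5)) h1.le
      _ = 6 * rateConst lam d C * discrepancy ξ x := by field_simp
  have h7 := abs_sub_le (gen lam d x (cnt v k)) (((n : ℝ) - 1) * F lam d (profile v x) k)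
    (((n : ℝ) - 1) * F lam d ξ k)
  linarith

end Discrepancy

/-! ### Discrete Gronwall inequality -/

section Gronwall

/-- The induction runs on the majorant, which grows by a factor at most `1 + δ * B` per step. -/
theorem discrete_gronwall {E : ℕ → ℝ} {A B δ : ℝ} (hB : 0 ≤ B) (hδ : 0 ≤ δ) (hA : 0 ≤ A) {N : ℕ}
    (h : ∀ k ≤ N, E k ≤ A + δ * ∑ i ∈ Finset.range k, B * E i) {k : ℕ} (hk : k ≤ N) :
    E k ≤ A * Real.exp (B * (δ * k)) := by
  have key : ∀ k ≤ N, A + δ * ∑ i ∈ Finset.range k, B * E i ≤ A * (1 + δ * B) ^ k := by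
    intro k
    induction k with
    | zero => intro _; simp
    | succ k ih =>
      intro hk
      have h1 := ih (by omega)
      have h2 := (h k (by omega)).trans h1
      rw [Finset.sum_range_succ, pow_succ]
      have h3 := mul_le_mul_of_nonneg_left h2 (mul_nonneg hδ hB)
      nlinarith
  refine (h k hk).trans ((key k hk).trans (mul_le_mul_of_nonneg_left ?_ hA))
  calc (1 + δ * B) ^ k ≤ Real.exp (δ * B) ^ k := by
        refine pow_le_pow_left₀ (by positivity) ?_ k
        linarith [Real.add_one_le_exp (δ * B)]
    _ = Real.exp (B * (δ * k)) := by
        rw [← Real.exp_nat_mul]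
        congr 1
        ring

theorem abs_le_of_compensated {h₀ h₁ δ a : ℝ} {D B : ℕ → ℝ} {k : ℕ} (hδ : 0 ≤ δ)
    (h : |h₁ - h₀ - δ * ∑ i ∈ Finset.range k, D i| ≤ a) (hD : ∀ i < k, |D i| ≤ B i) :
    |h₁| ≤ |h₀| + a + δ * ∑ i ∈ Finset.range k, B i := by
  have h1 : |∑ i ∈ Finset.range k, D i| ≤ ∑ i ∈ Finset.range k, B i :=
    (Finset.abs_sum_le_sum_abs _ _).trans
      (Finset.sum_le_sum fun i hi => hD i (Finset.mem_range.1 hi))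
  have h2 : |δ * ∑ i ∈ Finset.range k, D i| ≤ δ * ∑ i ∈ Finset.range k, B i := by
    rw [abs_mul, abs_of_nonneg hδ]
    exact mul_le_mul_of_nonneg_left h1 hδ
  have h3 : h₁ = (h₁ - h₀ - δ * ∑ i ∈ Finset.range k, D i) + h₀ +
    δ * ∑ i ∈ Finset.range k, D i := by ring
  rw [h3]
  refine (abs_add_three _ _ _).trans ?_
  linarith

end Gronwall

/-! ### Deterministic estimates along a good path -/

section GoodPath

variable {n C N : ℕ} {lam δ a : ℝ} {d : ℕ} {x : ℕ → State n C}

/-- Each observable in `psi` is its initial value plus accumulated drift plus an error at most `a`.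
A difference of two counts involves two such errors, whence `2 * a`. -/
theorem psi_le_of_good (hlam : 0 ≤ lam) (hn : 3 ≤ n) (hd : 1 ≤ d) (hC : 1 ≤ C) (hδ : 0 ≤ δ)
    (ha : 0 ≤ a) {k : ℕ}
    (h : ∀ s : Stat n C, |stat s (x k).1 - stat s (x 0).1 -
      δ * ∑ i ∈ Finset.range k, gen lam d (x i) (stat s)| ≤ a) :
    psi (x k) ≤ psi (x 0) + 2 * a + δ * ∑ i ∈ Finset.range k,
      (27 * rateConst lam d C * psi (x i) + 53 * rateConst lam d C) := by
  refine psi_le hn _ (fun u v huv j hj l hl => ?_) (fun u v l hl => ?_) fun u v huv => ?_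
  · have h1 := h (.inr (.inl (⟨(u, v), huv⟩, ⟨j, by omega⟩, ⟨l, by omega⟩)))
    have h2 := abs_le_of_compensated hδ h1 fun i _ =>
      abs_gen_pairDev_le_psi hlam hn hd hC (x i) huv hj hl
    have h3 := abs_pairDev_le_psi hn (x 0) huv hj hl
    have h4 : |pairDev u v j l (x k).1| ≤ |pairDev u v j l (x 0).1| + a + δ *
      ∑ i ∈ Finset.range k,
        (27 * rateConst lam d C * psi (x i) + 53 * rateConst lam d C) := h2
    linarith
  · have h1 : |cnt u l (x k).1 - cnt u l (x 0).1 -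
        δ * ∑ i ∈ Finset.range k, gen lam d (x i) (cnt u l)| ≤ a := h (.inl (u, ⟨l, by omega⟩))
    have h2 : |cnt v l (x k).1 - cnt v l (x 0).1 -
        δ * ∑ i ∈ Finset.range k, gen lam d (x i) (cnt v l)| ≤ a := h (.inl (v, ⟨l, by omega⟩))
    have h3 : |(cnt u l (x k).1 - cnt v l (x k).1) - (cnt u l (x 0).1 - cnt v l (x 0).1) -
        δ * ∑ i ∈ Finset.range k, (gen lam d (x i) (cnt u l) - gen lam d (x i) (cnt v l))| ≤
        2 * a := by
      rw [Finset.sum_sub_distrib]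
      have h4 := abs_sub (cnt u l (x k).1 - cnt u l (x 0).1 -
        δ * ∑ i ∈ Finset.range k, gen lam d (x i) (cnt u l)) (cnt v l (x k).1 - cnt v l (x 0).1 -
        δ * ∑ i ∈ Finset.range k, gen lam d (x i) (cnt v l))
      refine (le_of_eq ?_).trans (h4.trans (by linarith))
      congr 1
      ring
    have h4 := abs_le_of_compensated hδ h3 fun i _ =>
      abs_gen_cnt_sub_le_psi hlam hn hd hC (x i) u v hl
    have h5 := abs_cnt_sub_le_psi hn (x 0) u v l
    linarith
  · have h1 := h (.inr (.inr ⟨(u, v), huv⟩))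
    have h2 : altCalls ⟨s(u, v), by simpa using huv⟩ (x k).1 -
        altCalls ⟨s(u, v), by simpa using huv⟩ (x 0).1 - δ * ∑ i ∈ Finset.range k,
          gen lam d (x i) (altCalls ⟨s(u, v), by simpa using huv⟩) ≤ a := (le_abs_self _).trans h1
    have h3 := mul_le_mul_of_nonneg_left (Finset.sum_le_sum fun i (_ : i ∈ Finset.range k) =>
      gen_altCalls_le_rateConst hlam hn hd hC (x i) huv) hδ
    have h4 := altCalls_le_psi hn (x 0) ⟨s(u, v), by simpa using huv⟩
    linarith

theorem abs_sub_sum_le_of_step {y f : ℕ → ℝ} {ε : ℝ} {k : ℕ}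
    (h : ∀ i < k, |y (i + 1) - y i - f i| ≤ ε) :
    |y k - y 0 - ∑ i ∈ Finset.range k, f i| ≤ k * ε := by
  rw [← Finset.sum_range_sub, ← Finset.sum_sub_distrib]
  refine (Finset.abs_sum_le_sum_abs _ _).trans ?_
  refine (Finset.sum_le_card_nsmul _ _ ε fun i hi => h i (Finset.mem_range.1 hi)).trans_eq ?_
  simp

/-- The compensated counts are subtracted from `n - 1` times the Euler scheme of the solution, whose
errors add up to at most `k * ε`. -/
theorem discrepancy_le_of_good (hlam : 0 ≤ lam) (hn : 3 ≤ n) (hd : 1 ≤ d) (hC : 1 ≤ C)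
    (hδ : 0 ≤ δ) {k : ℕ}
    (h : ∀ s : Stat n C, |stat s (x k).1 - stat s (x 0).1 -
      δ * ∑ i ∈ Finset.range k, gen lam d (x i) (stat s)| ≤ a)
    {y : ℕ → Fin (C + 1) → ℝ} (hy : ∀ i < k, IsProfile (y i)) {ε : ℝ}
    (hstep : ∀ i < k, ∀ j, |y (i + 1) j - y i j - δ * F lam d (y i) j| ≤ ε) :
    discrepancy (y k) (x k) ≤ discrepancy (y 0) (x 0) + a + ((n : ℝ) - 1) * (k * ε) +
      δ * ∑ i ∈ Finset.range k, (6 * rateConst lam d C * discrepancy (y i) (x i) +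
        12 * rateConst lam d C * (psi (x i) + 2)) := by
  have h0 : (0 : ℝ) < (n : ℝ) - 1 := by linarith [two_lt_cast hn]
  refine discrepancy_le (by omega) _ _ fun v j => ?_
  have h1 : |cnt v j (x k).1 - cnt v j (x 0).1 -
      δ * ∑ i ∈ Finset.range k, gen lam d (x i) (cnt v j)| ≤ a := h (.inl (v, j))
  have h2 := abs_sub_sum_le_of_step (y := fun i => y i j) (f := fun i => δ * F lam d (y i) j)
    fun i hi => hstep i hi j
  rw [← Finset.mul_sum] at h2
  have h3 : |(cnt v j (x k).1 - ((n : ℝ) - 1) * y k j) - (cnt v j (x 0).1 - ((n : ℝ) - 1) * y 0 j)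
      - δ * ∑ i ∈ Finset.range k, (gen lam d (x i) (cnt v j) - ((n : ℝ) - 1) * F lam d (y i) j)| ≤
      a + ((n : ℝ) - 1) * (k * ε) := by
    have h4 := mul_le_mul_of_nonneg_left h2 h0.le
    rw [← abs_of_pos h0, ← abs_mul, abs_of_pos h0] at h4
    rw [Finset.sum_sub_distrib, ← Finset.mul_sum]
    refine (le_of_eq ?_).trans ((abs_sub _ _).trans (add_le_add h1 h4))
    congr 1
    ring
  have h4 := abs_le_of_compensated hδ h3 fun i hi =>
    abs_gen_cnt_sub_F_le_discrepancy hlam hn hd hC (x i) v j (hy i hi)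
  have h5 := abs_cnt_sub_le_discrepancy (y 0) (x 0) v j
  linarith

/-- The main deterministic estimate along a path whose compensated observables are small. -/
theorem discrepancy_le_exp_of_good (hlam : 0 ≤ lam) (hn : 3 ≤ n) (hd : 1 ≤ d) (hC : 1 ≤ C)
    (hδ : 0 ≤ δ) (ha : 0 ≤ a) {T K : ℝ} (hK : 1 ≤ K) (hT : δ * N ≤ T)
    (h : ∀ s : Stat n C, ∀ k ≤ N, |stat s (x k).1 - stat s (x 0).1 -
      δ * ∑ i ∈ Finset.range k, gen lam d (x i) (stat s)| ≤ a)
    {y : ℕ → Fin (C + 1) → ℝ} (hy : ∀ i ≤ N, IsProfile (y i)) {ε : ℝ} (hε0 : 0 ≤ ε)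
    (hstep : ∀ i < N, ∀ j, |y (i + 1) j - y i j - δ * F lam d (y i) j| ≤ ε)
    (hε : ((n : ℝ) - 1) * (N * ε) ≤ 1) {k : ℕ} (hk : k ≤ N) :
    discrepancy (y k) (x k) ≤ (discrepancy (y 0) (x 0) + K * psi (x 0) +
      (a + 1 + 2 * K * a + 77 * rateConst lam d C * K * T)) *
        Real.exp (39 * rateConst lam d C * T) := by
  have h0 : (0 : ℝ) < (n : ℝ) - 1 := by linarith [two_lt_cast hn]
  have hQ : 0 ≤ rateConst lam d C := by unfold rateConst; positivity
  have hT0 : 0 ≤ T := le_trans (by positivity) hT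
  set Q := rateConst lam d C
  -- The growth of the discrepancy involves `psi`, whose own growth involves only `psi`, so the
  -- weighted sum closes. For `K ≥ 1` the coefficients combine as 12 + 27 = 39 and 24 + 53 = 77; `K`
  -- stays free in order to match the stated error bound.
  set E : ℕ → ℝ := fun i => discrepancy (y i) (x i) + K * psi (x i) with hE
  set A := E 0 + (a + 1 + 2 * K * a + 77 * Q * K * T) with hA
  have hE0 : ∀ i, 0 ≤ E i := fun i => add_nonneg (discrepancy_nonneg (by omega) _ _)
    (mul_nonneg (by linarith) (psi_nonneg hn _))
  have hA0 : 0 ≤ A := by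
    have := hE0 0
    have : 0 ≤ 77 * Q * K * T := by positivity
    have : 0 ≤ 2 * K * a := by positivity
    linarith
  have key : ∀ k ≤ N, E k ≤ A + δ * ∑ i ∈ Finset.range k, 39 * Q * E i := by
    intro k hk
    have hkN : (k : ℝ) ≤ N := by exact_mod_cast hk
    have h1 := discrepancy_le_of_good hlam hn hd hC hδ (fun s => h s k hk)
      (fun i hi => hy i (by omega)) (fun i hi => hstep i (by omega))
    have h2 := psi_le_of_good hlam hn hd hC hδ ha (fun s => h s k hk)
    have h3 := mul_le_mul_of_nonneg_left h2 (show 0 ≤ K by linarith)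
    have h4 : ((n : ℝ) - 1) * (k * ε) ≤ 1 := le_trans (by gcongr) hε
    have h5 : δ * ∑ i ∈ Finset.range k, (6 * Q * discrepancy (y i) (x i) +
        12 * Q * (psi (x i) + 2)) + K * (δ * ∑ i ∈ Finset.range k,
        (27 * Q * psi (x i) + 53 * Q)) ≤
        δ * ∑ i ∈ Finset.range k, (39 * Q * E i + 77 * Q * K) := by
      rw [mul_left_comm K, ← mul_add, Finset.mul_sum _ _ K, ← Finset.sum_add_distrib]
      refine mul_le_mul_of_nonneg_left (Finset.sum_le_sum fun i _ => ?_) hδ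
      have h6 := discrepancy_nonneg (show 1 ≤ n by omega) (y i) (x i)
      have h7 := psi_nonneg hn (x i)
      have h8 : 0 ≤ Q * discrepancy (y i) (x i) := mul_nonneg hQ h6
      have h9 : 0 ≤ (K - 1) * (Q * psi (x i)) := mul_nonneg (by linarith) (mul_nonneg hQ h7)
      have h10 : 0 ≤ (K - 1) * Q := mul_nonneg (by linarith) hQ
      simp only [hE]
      nlinarith
    have h6 : δ * ∑ i ∈ Finset.range k, (39 * Q * E i + 77 * Q * K) ≤
        δ * ∑ i ∈ Finset.range k, 39 * Q * E i + 77 * Q * K * T := by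
      rw [Finset.sum_add_distrib, mul_add, Finset.sum_const, Finset.card_range, nsmul_eq_mul]
      have h7 : δ * k ≤ T := (mul_le_mul_of_nonneg_left hkN hδ).trans hT
      have h8 := mul_le_mul_of_nonneg_left h7 (show 0 ≤ 77 * Q * K by positivity)
      linarith
    simp only [hA, hE] at *
    linarith
  have h1 := discrete_gronwall (by positivity) hδ hA0 key hk
  have h2 : discrepancy (y k) (x k) ≤ E k :=
    le_add_of_nonneg_right (mul_nonneg (by linarith) (psi_nonneg hn _))
  refine h2.trans (h1.trans (mul_le_mul_of_nonneg_left (Real.exp_le_exp.2 ?_) hA0))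
  refine mul_le_mul_of_nonneg_left (le_trans ?_ hT) (by positivity)
  exact mul_le_mul_of_nonneg_left (by exact_mod_cast hk) hδ

end GoodPath

/-! ### From the Gronwall bound to the stated error bounds -/

section ErrorBound

variable {n C d : ℕ} {lam t₀ : ℝ}

/-- The constant in the error bounds. -/
def errConst (lam : ℝ) (d C : ℕ) (t₀ : ℝ) : ℝ :=
  64 * (lam + 1) * (t₀ + 1) * (d : ℝ) ^ 2 * ((C : ℝ) + 1) ^ 3

theorem le_errConst (hlam : 0 ≤ lam) (ht₀ : 0 ≤ t₀) (hd : 1 ≤ d) (hC : 1 ≤ C) :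
    512 ≤ errConst lam d C t₀ := by
  have hd' : (1 : ℝ) ≤ d := by exact_mod_cast hd
  have hC' : (1 : ℝ) ≤ C := by exact_mod_cast hC
  calc (512 : ℝ) = 64 * 1 * 1 * 1 ^ 2 * (1 + 1) ^ 3 := by norm_num
    _ ≤ errConst lam d C t₀ := by
      unfold errConst
      gcongr <;> linarith

/-- The polynomial part of `nZero` makes the additive drift terms small compared with √n log n, so
that they can be absorbed. -/
theorem rateConst_mul_le (hlam : 0 < lam) (ht₀ : 0 < t₀) (hd : 1 ≤ d)
    (hn : nZero lam d C t₀ ≤ n) :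
    2 ^ 9 * (rateConst lam d C * t₀) ≤ Real.sqrt n * Real.log n := by
  have h1 := le_sqrt_of_nZero_le hn
  have h2 := one_le_log hlam ht₀ hd hn
  refine le_trans (le_trans ?_ h1) (le_mul_of_one_le_right (Real.sqrt_nonneg _) h2)
  have hC' : (1 : ℝ) ≤ (C : ℝ) + 1 := by linarith [Nat.cast_nonneg (α := ℝ) C]
  have hl : lam + 1 ≤ (lam + 1 / lam) ^ 2 := by
    have h3 := two_le_add_one_div hlam
    have h4 : 0 < 1 / lam := by positivity
    have h5 : (lam + 1 / lam) ^ 2 = lam ^ 2 + 2 + (1 / lam) ^ 2 := by field_simp; ring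
    nlinarith [sq_nonneg (lam - 1), sq_nonneg (1 / lam)]
  have ht : t₀ ≤ t₀ + 1 / t₀ := by
    have : 0 < 1 / t₀ := by positivity
    linarith
  calc 2 ^ 9 * (rateConst lam d C * t₀)
      = 2 ^ 9 * (lam + 1) * (d : ℝ) ^ 2 * ((C : ℝ) + 1) ^ 2 * t₀ := by unfold rateConst; ring
    _ ≤ 2 ^ 9 * (lam + 1 / lam) ^ 2 * (d : ℝ) ^ 2 * ((C : ℝ) + 1) ^ 3 * (t₀ + 1 / t₀) := by
      gcongr
      norm_num

theorem le_errorBound (hlam : 0 < lam) (ht₀ : 0 < t₀) (hd : 1 ≤ d) (hC : 1 ≤ C) (hn3 : 3 ≤ n)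
    (hn : nZero lam d C t₀ ≤ n) (ξ₀ : Fin (C + 1) → ℝ) (x : State n C) :
    (discrepancy ξ₀ x + errConst lam d C t₀ * psi x + (Real.sqrt n * Real.log n + 1 +
      2 * errConst lam d C t₀ * (Real.sqrt n * Real.log n) +
      77 * rateConst lam d C * errConst lam d C t₀ * t₀)) *
        Real.exp (39 * rateConst lam d C * t₀) ≤ errorBound lam d t₀ ξ₀ x := by
  have h0 := discrepancy_nonneg (show 1 ≤ n by omega) ξ₀ x
  have h1 := psi_nonneg hn3 x
  have h2 := two_lt_cast hn3
  have h3 := le_errConst hlam.le ht₀.le hd hC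
  have h4 := rateConst_mul_le hlam ht₀ hd hn
  have h5 : 1 ≤ Real.sqrt n * Real.log n := by
    have h6 := one_le_log hlam ht₀ hd hn
    have h7 := eight_mul_log_le hlam ht₀ hd hn
    nlinarith
  have hphi : 0 ≤ phi x := nonneg_of_mul_nonneg_right h1 h2
  have hQ : 0 ≤ rateConst lam d C := by unfold rateConst; positivity
  have h8 : psi x ≤ n * phi x := by unfold psi; linarith
  unfold errorBound
  change _ ≤ (discrepancy ξ₀ x + errConst lam d C t₀ * (n * phi x + 3 * Real.sqrt n * Real.log n))
    * _
  set K := errConst lam d C t₀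
  set a := Real.sqrt n * Real.log n with ha
  have ha3 : 3 * Real.sqrt n * Real.log n = 3 * a := by rw [ha]; ring
  rw [ha3]
  have h9 : K * psi x ≤ K * (n * phi x) := mul_le_mul_of_nonneg_left h8 (by linarith)
  -- `2 * K * a` is the martingale error; the rest fits into one further `K * a`, since `512 ≤ K`,
  -- `1 ≤ a` and `512 * rateConst * t₀ ≤ a`.
  have h10 : a + 1 + 2 * K * a + 77 * rateConst lam d C * K * t₀ ≤ K * (3 * a) := by
    have h11 := mul_le_mul_of_nonneg_left h4 (show 0 ≤ K by linarith)
    have h12 := mul_le_mul_of_nonneg_right h3 (show 0 ≤ a by linarith)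
    nlinarith
  have hK0 : 0 ≤ K * (n * phi x + 3 * a) := by
    have := Nat.cast_nonneg (α := ℝ) n
    have : 0 ≤ (n : ℝ) * phi x := by positivity
    exact mul_nonneg (by linarith) (by linarith)
  refine mul_le_mul (by linarith) (Real.exp_le_exp.2 ?_) (Real.exp_pos _).le (by linarith)
  have hC' : (1 : ℝ) ≤ (C : ℝ) + 1 := by linarith [Nat.cast_nonneg (α := ℝ) C]
  calc 39 * rateConst lam d C * t₀
      = 39 * (lam + 1) * (d : ℝ) ^ 2 * ((C : ℝ) + 1) ^ 2 * t₀ := by unfold rateConst; ring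
    _ ≤ 216 * (lam + 1) * (d : ℝ) ^ 2 * ((C : ℝ) + 1) ^ 3 * t₀ := by
      gcongr <;> norm_num

/-- If `ξ₀` is the profile of `v₀`, the initial discrepancy is a difference of counts at two nodes,
which φ² bounds by `n * phi`. As `errConst ≥ 1`, this is the second `n * phi` in the bound. -/
theorem errorBound_le_errorBound' (hlam : 0 < lam) (ht₀ : 0 < t₀) (hd : 1 ≤ d) (hC : 1 ≤ C)
    (hn3 : 3 ≤ n) {ξ₀ : Fin (C + 1) → ℝ} {x : State n C} {v₀ : Fin n}
    (h : ∀ j : Fin (C + 1), ξ₀ j = 1 / ((n : ℝ) - 1) * count v₀ j x) :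
    errorBound lam d t₀ ξ₀ x ≤ errorBound' lam d t₀ x := by
  have h2 := two_lt_cast hn3
  have h1 := psi_nonneg hn3 x
  have hphi : 0 ≤ phi x := nonneg_of_mul_nonneg_right h1 h2
  have h8 : psi x ≤ n * phi x := by unfold psi; linarith
  have h3 := le_errConst hlam.le ht₀.le hd hC
  have h4 : discrepancy ξ₀ x ≤ n * phi x := by
    refine (discrepancy_le (by omega) _ _ fun v k => ?_).trans h8
    have h5 : ((n : ℝ) - 1) * ξ₀ k = cnt v₀ k x.1 := by
      have : (n : ℝ) - 1 ≠ 0 := by linarith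
      rw [h k, cast_count]
      field_simp
    rw [h5]
    exact abs_cnt_sub_le_psi hn3 x v v₀ k
  unfold errorBound errorBound'
  change (discrepancy ξ₀ x + errConst lam d C t₀ * _) * _ ≤ errConst lam d C t₀ * _ * _
  refine mul_le_mul_of_nonneg_right ?_ (Real.exp_pos _).le
  have h6 : (n : ℝ) * phi x ≤ errConst lam d C t₀ * (n * phi x) :=
    le_mul_of_one_le_left (h1.trans h8) (by linarith)
  linarith

end ErrorBound

/-! ### From dyadic grids to all times -/

section Main

variable {Ω : Type*} {n C d : ℕ} {lam : ℝ}
  {X : ℝ≥0 → Ω → State n C} {T : ℝ≥0} {ξ₀ : Fin (C + 1) → ℝ} {ξ : ℝ → Fin (C + 1) → ℝ}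

theorem grid_zero (T : ℝ≥0) (N : ℕ) : grid T N 0 = 0 := by simp [grid]

/-- The tolerance per Euler step is such that over `N` steps, after scaling by `n - 1`, it adds
exactly 1. -/
theorem discrepancy_le_errorBound (hlam : 0 < lam) (hT : 0 < T) (hd : 1 ≤ d) (hC : 1 ≤ C)
    (hn3 : 3 ≤ n) (hn : nZero lam d C T ≤ n) (hξ : IsSolution lam d T ξ₀ ξ)
    (hprof : ∀ t ∈ Set.Icc 0 (T : ℝ), IsProfile (ξ t)) {N : ℕ} (hN : 0 < N)
    (hstep : ∀ i < N, ∀ k : Fin (C + 1),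
      |ξ (T / N * (i + 1 : ℕ)) k - ξ (T / N * i) k - T / N * F lam d (ξ (T / N * i)) k|
        ≤ T / N * (1 / (((n : ℝ) - 1) * T))) {ω : Ω}
    (hω : GoodPath lam d T X (Real.sqrt n * Real.log n) N ω) {k : ℕ} (hk : k ≤ N) :
    discrepancy (ξ (grid T N k)) (X (grid T N k) ω) ≤ errorBound lam d T ξ₀ (X 0 ω) := by
  have hT' : (0 : ℝ) < T := by exact_mod_cast hT
  have hN' : (0 : ℝ) < N := by exact_mod_cast hN
  have h0 : (0 : ℝ) < (n : ℝ) - 1 := by linarith [two_lt_cast hn3]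
  have h1 := one_le_log hlam hT' hd hn
  have h2 := discrepancy_le_exp_of_good (x := fun i => X (grid T N i) ω)
    (y := fun i => ξ (T / N * i)) (δ := T / N) (T := T) (a := Real.sqrt n * Real.log n)
    (K := errConst lam d C T) (ε := T / N * (1 / (((n : ℝ) - 1) * T))) (N := N)
    hlam.le hn3 hd hC (by positivity) (by positivity)
    (by linarith [le_errConst hlam.le hT'.le hd hC]) (by field_simp; rfl)
    (fun s k hk => by
      have := hω s k hk
      simpa only [comp, drift_eq_gen] using this)
    (fun i hi => hprof _ ⟨by positivity, by
      rw [div_mul_eq_mul_div, div_le_iff₀ hN']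
      exact mul_le_mul_of_nonneg_left (by exact_mod_cast hi) hT'.le⟩)
    (by positivity) hstep (by field_simp; rfl) hk
  simp only [Nat.cast_zero, mul_zero, hξ.1, grid_zero] at h2
  rw [coe_grid]
  exact h2.trans (le_errorBound hlam hT' hd hC hn3 hn ξ₀ (X 0 ω))

/-- The points of the dyadic grid just above `t`. -/
def dyadicAbove (T t : ℝ≥0) (j : ℕ) : ℝ≥0 := grid T (2 ^ j) (⌊(t : ℝ) * 2 ^ j / T⌋₊ + 1)

/-- The floor plus one lies strictly above `t`, as right-continuity is stated on `𝓝[>] t`. -/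
theorem tendsto_dyadicAbove (hT : 0 < T) (t : ℝ≥0) :
    Filter.Tendsto (dyadicAbove T t) Filter.atTop (𝓝[>] t) := by
  have hT' : (0 : ℝ) < T := by exact_mod_cast hT
  have hco : ∀ j, ((dyadicAbove T t j : ℝ≥0) : ℝ) =
      T / 2 ^ j * (⌊(t : ℝ) * 2 ^ j / T⌋₊ + 1) := fun j => by
    unfold dyadicAbove
    rw [coe_grid]
    push_cast
    rfl
  have hlow : ∀ j, (t : ℝ) < dyadicAbove T t j := fun j => by
    have h1 := Nat.lt_floor_add_one ((t : ℝ) * 2 ^ j / T)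
    rw [hco]
    calc (t : ℝ) = T / 2 ^ j * (t * 2 ^ j / T) := by field_simp
      _ < _ := by gcongr
  have hup : ∀ j, (dyadicAbove T t j : ℝ) ≤ t + T / 2 ^ j := fun j => by
    have h1 := Nat.floor_le (show 0 ≤ (t : ℝ) * 2 ^ j / T by positivity)
    rw [hco]
    calc (T : ℝ) / 2 ^ j * (⌊(t : ℝ) * 2 ^ j / T⌋₊ + 1) ≤
        T / 2 ^ j * (t * 2 ^ j / T + 1) := by gcongr
      _ = t + T / 2 ^ j := by field_simp
  refine tendsto_nhdsWithin_iff.2 ⟨?_, Filter.Eventually.of_forall fun j => by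
    exact_mod_cast hlow j⟩
  rw [← NNReal.tendsto_coe]
  have h2 : Filter.Tendsto (fun j : ℕ => (t : ℝ) + T / 2 ^ j) Filter.atTop (𝓝 (t + 0)) := by
    refine tendsto_const_nhds.add ?_
    have := (tendsto_pow_atTop_nhds_zero_of_lt_one (r := (1 / 2 : ℝ)) (by norm_num)
      (by norm_num)).const_mul (T : ℝ)
    simpa [div_eq_mul_inv] using this
  rw [add_zero] at h2
  exact tendsto_of_tendsto_of_tendsto_of_le_of_le tendsto_const_nhds h2
    (fun j => (hlow j).le) hup

theorem grid_two_pow_succ (T : ℝ≥0) (j k : ℕ) :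
    grid T (2 ^ (j + 1)) (2 * k) = grid T (2 ^ j) k := by
  unfold grid
  push_cast
  rw [pow_succ]
  field_simp

theorem discrepancy_le_of_dyadic (hT : 0 < T) (hξ : IsSolution lam d T ξ₀ ξ) {ω : Ω}
    (hrc : ∀ t : ℝ≥0, ∀ᶠ s in 𝓝[>] t, X s ω = X t ω) {M : ℝ}
    (h : ∀ j k : ℕ, k ≤ 2 ^ j →
      discrepancy (ξ (grid T (2 ^ j) k)) (X (grid T (2 ^ j) k) ω) ≤ M)
    {t : ℝ≥0} (ht : t ≤ T) (v : Fin n) (k : Fin (C + 1)) :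
    |(count v k (X t ω) : ℝ) - ((n : ℝ) - 1) * ξ t k| ≤ M := by
  have hT' : (0 : ℝ) < T := by exact_mod_cast hT
  -- The endpoint is itself a grid point (`j = 0`, `k = 1`). For `t < T` the dyadic points above `t`
  -- remain in `[0, T]`.
  rcases ht.eq_or_lt with rfl | ht
  · have h1 := (abs_cnt_sub_le_discrepancy _ _ v k).trans (h 0 1 le_rfl)
    simpa [grid, cast_count] using h1
  · have ht' : (t : ℝ) < T := by exact_mod_cast ht
    have hk : ∀ j, ⌊(t : ℝ) * 2 ^ j / T⌋₊ + 1 ≤ 2 ^ j := fun j => by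
      rw [Nat.succ_le_iff, Nat.floor_lt (by positivity), div_lt_iff₀ hT']
      push_cast
      rw [mul_comm]
      gcongr
    have hb : ∀ j, |cnt v k (X (dyadicAbove T t j) ω).1 -
        ((n : ℝ) - 1) * ξ (dyadicAbove T t j) k| ≤ M := fun j =>
      (abs_cnt_sub_le_discrepancy _ _ v k).trans (h j _ (hk j))
    have hlim := tendsto_dyadicAbove hT t
    have hle : ∀ j, (dyadicAbove T t j : ℝ) ≤ T := fun j => by
      unfold dyadicAbove
      rw [coe_grid, div_mul_eq_mul_div, div_le_iff₀ (by positivity)]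
      exact mul_le_mul_of_nonneg_left (by exact_mod_cast hk j) hT'.le
    have hξlim : Filter.Tendsto (fun j => ξ (dyadicAbove T t j) k) Filter.atTop
        (𝓝 (ξ t k)) := by
      have h1 : Filter.Tendsto ξ (𝓝[Set.Icc 0 (T : ℝ)] (t : ℝ)) (𝓝 (ξ t)) :=
        hξ.continuousOn t ⟨t.2, ht'.le⟩
      have h2 : Filter.Tendsto (fun j => ((dyadicAbove T t j : ℝ≥0) : ℝ)) Filter.atTop
          (𝓝[Set.Icc 0 (T : ℝ)] (t : ℝ)) := by
        refine tendsto_nhdsWithin_iff.2 ⟨NNReal.tendsto_coe.2 (tendsto_nhdsWithin_iff.1 hlim).1,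
          Filter.Eventually.of_forall fun j => ⟨NNReal.coe_nonneg _, hle j⟩⟩
      exact ((continuous_apply k).tendsto _).comp (h1.comp h2)
    rw [cast_count]
    refine le_of_tendsto ((tendsto_const_nhds.sub (hξlim.const_mul _)).abs) ?_
    filter_upwards [hlim.eventually (hrc t)] with j hj
    have := hb j
    rwa [hj] at this

/-- The discrepancy exceeds the error bound at some point of the `j`-th dyadic grid. -/
def dyadicBad (lam : ℝ) (d : ℕ) (X : ℝ≥0 → Ω → State n C) (T : ℝ≥0) (ξ₀ : Fin (C + 1) → ℝ)
    (ξ : ℝ → Fin (C + 1) → ℝ) (j : ℕ) : Set Ω :=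
  {ω | ∃ k, k ≤ 2 ^ j ∧ errorBound lam d T ξ₀ (X 0 ω) <
    discrepancy (ξ (grid T (2 ^ j) k)) (X (grid T (2 ^ j) k) ω)}

/-- Nested grids give increasing events, so their union has the supremum of their measures and no
union bound over scales is needed. -/
theorem monotone_dyadicBad : Monotone (dyadicBad lam d X T ξ₀ ξ) := by
  refine monotone_nat_of_le_succ fun j ω hω => ?_
  obtain ⟨k, hk, h⟩ := hω
  refine ⟨2 * k, by rw [pow_succ]; omega, ?_⟩
  rwa [grid_two_pow_succ]

variable [MeasurableSpace Ω] {μ : Measure Ω}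

theorem measure_iUnion_dyadicBad_le [IsProbabilityMeasure μ] (hlam : 0 < lam) (hT : 0 < T)
    (hd : 1 ≤ d) (hC : 1 ≤ C) (hn : nZero lam d C T ≤ n) (hX : IsProcess μ lam d X)
    (hξ : IsSolution lam d T ξ₀ ξ) (hprof : ∀ t ∈ Set.Icc 0 (T : ℝ), IsProfile (ξ t)) :
    μ.real (⋃ j, dyadicBad lam d X T ξ₀ ξ j) ≤
      Real.exp (-(1 / 2) * gam lam d C T * Real.log n ^ 2) := by
  have hT' : (0 : ℝ) < T := by exact_mod_cast hT
  have hn3 := three_le_of_nZero_le hlam hT' hd hn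
  have h0 : (0 : ℝ) < (n : ℝ) - 1 := by linarith [two_lt_cast hn3]
  have hev := (tendsto_pow_atTop_atTop_of_one_lt (r := 2) (by norm_num)).eventually
    ((eventually_prob_not_goodPath_le_exp hlam hd hX hT hn).and
      (hξ.eventually_step hT' (η := 1 / (((n : ℝ) - 1) * T)) (by positivity)))
  rw [measureReal_def, monotone_dyadicBad.measure_iUnion]
  refine ENNReal.toReal_le_of_le_ofReal (Real.exp_pos _).le ?_
  refine iSup_le fun i => ?_
  -- The tail bound and the Euler estimate hold only on fine grids, so the event at level `i` is
  -- enlarged to one at a suitable finer level `j`.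
  obtain ⟨j, hij, hgood, hstep⟩ := ((Filter.eventually_ge_atTop i).and hev).exists
  refine (measure_mono (monotone_dyadicBad hij)).trans ?_
  refine (measure_mono (t := {ω | ¬ GoodPath lam d T X (Real.sqrt n * Real.log n) (2 ^ j) ω})
    ?_).trans ?_
  · rintro ω ⟨k, hk, h⟩ hω
    exact absurd (discrepancy_le_errorBound hlam hT hd hC hn3 hn hξ hprof (by positivity) hstep
      hω hk) (not_le.2 h)
  · rw [← ENNReal.ofReal_toReal (measure_ne_top μ _)]
    exact ENNReal.ofReal_le_ofReal hgood

/-- Allowing any almost sure majorant `M` of the error bound yields both conclusions of the theorem.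
The complement is covered up to a null set by `dyadicBad`, so its measurability is not needed. -/
theorem prob_compl_le [IsProbabilityMeasure μ] (hlam : 0 < lam) (hT : 0 < T)
    (hd : 1 ≤ d) (hC : 1 ≤ C) (hn : nZero lam d C T ≤ n) (hX : IsProcess μ lam d X)
    (hξ : IsSolution lam d T ξ₀ ξ) (hprof : ∀ t ∈ Set.Icc 0 (T : ℝ), IsProfile (ξ t))
    {M : Ω → ℝ} (hM : ∀ᵐ ω ∂μ, errorBound lam d T ξ₀ (X 0 ω) ≤ M ω) :
    μ.real {ω | ∀ (v : Fin n) (k : Fin (C + 1)) (t : ℝ≥0), (t : ℝ) ≤ T →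
      |(count v k (X t ω) : ℝ) - ((n : ℝ) - 1) * ξ t k| ≤ M ω}ᶜ ≤
      Real.exp (-(1 / 2) * gam lam d C T * Real.log n ^ 2) := by
  refine le_trans ?_ (measure_iUnion_dyadicBad_le hlam hT hd hC hn hX hξ hprof)
  refine ENNReal.toReal_mono (measure_ne_top _ _) (measure_mono_ae ?_)
  filter_upwards [hX.rightContinuous, hM] with ω hrc hMω hω
  by_contra hbad
  refine hω fun v k t ht => ?_
  refine (discrepancy_le_of_dyadic hT hξ hrc (fun j k hk => ?_) (by exact_mod_cast ht) v k).trans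
    hMω
  by_contra hlt
  exact hbad (Set.mem_iUnion.2 ⟨j, k, hk, not_le.1 hlt⟩)

end Main

end BDAR


end

theorem theorem1p1 {Ω : Type*} [MeasurableSpace Ω] (μ : Measure Ω) [IsProbabilityMeasure μ]
    (lam t₀ : ℝ) (hlam : 0 < lam) (ht₀ : 0 < t₀) (d C : ℕ) (hd : 1 ≤ d) (hC : 1 ≤ C)
    (n : ℕ) (hn : BDAR.nZero lam d C t₀ ≤ n)
    (ξ₀ : Fin (C + 1) → ℝ) (hξ₀ : (∀ k, 0 ≤ ξ₀ k) ∧ ∑ k, ξ₀ k = 1)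
    (X : ℝ≥0 → Ω → BDAR.State n C) (hX : BDAR.IsProcess μ lam d X)
    (hX₀ : ∀ᵐ ω ∂μ, (BDAR.calls (X 0 ω) : ℝ) ≤ 2 * lam * (n.choose 2 : ℝ)) :
    ∃ ξ : ℝ → Fin (C + 1) → ℝ,
      BDAR.IsSolution lam d t₀ ξ₀ ξ ∧
      (∀ η, BDAR.IsSolution lam d t₀ ξ₀ η → Set.EqOn η ξ (Set.Icc 0 t₀)) ∧
      μ.real {ω | ∀ (v : Fin n) (k : Fin (C + 1)) (t : ℝ≥0), (t : ℝ) ≤ t₀ →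
          |(BDAR.count v k (X t ω) : ℝ) - ((n : ℝ) - 1) * ξ t k|
            ≤ BDAR.errorBound lam d t₀ ξ₀ (X 0 ω)}ᶜ
        ≤ Real.exp (-(1 / 2) * BDAR.gam lam d C t₀ * Real.log n ^ 2) ∧
      ((∀ᵐ ω ∂μ, ∃ v₀ : Fin n, ∀ j : Fin (C + 1),
          ξ₀ j = 1 / ((n : ℝ) - 1) * BDAR.count v₀ j (X 0 ω)) →
        μ.real {ω | ∀ (v : Fin n) (k : Fin (C + 1)) (t : ℝ≥0), (t : ℝ) ≤ t₀ →
            |(BDAR.count v k (X t ω) : ℝ) - ((n : ℝ) - 1) * ξ t k|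
              ≤ BDAR.errorBound' lam d t₀ (X 0 ω)}ᶜ
          ≤ Real.exp (-(1 / 2) * BDAR.gam lam d C t₀ * Real.log n ^ 2)) := by
  lift t₀ to ℝ≥0 using ht₀.le
  have hT : 0 < t₀ := by exact_mod_cast ht₀
  have hn3 := BDAR.three_le_of_nZero_le hlam ht₀ hd hn
  obtain ⟨ξ, hξ, hprof⟩ := BDAR.exists_isSolution hC hlam.le d ht₀.le hξ₀
  refine ⟨ξ, hξ, fun η hη => hξ.eqOn hC hη,
    BDAR.prob_compl_le hlam hT hd hC hn hX hξ hprof (Filter.Eventually.of_forall fun _ => le_rfl),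
    fun h => BDAR.prob_compl_le hlam hT hd hC hn hX hξ hprof ?_⟩
  filter_upwards [h] with ω hω
  obtain ⟨v₀, hv₀⟩ := hω
  exact BDAR.errorBound_le_errorBound' hlam ht₀ hd hC hn3 hv₀
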